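/- Fix a smoothed modulus on $\mathbb R^3$: let $a\in C^\infty(\mathbb R)$, $a\ge 0$, $\{a\neq 0\}=(1,2)$, $\int_1^2 a=1$, let $\beta(r)=r$ for $r\ge 2$, $\beta(r)=\int_1^r\int_1^s a(\tau)\,d\tau\,ds+C_0$ for $1\le r\le 2$, $\beta(r)=C_0$ for $0\le r\le 1$, with $C_0$ chosen so that $\beta$ is smooth, and put $\langle x\rangle=\beta(|x|)$. Let $\gamma=\frac12(\nabla\langle x\rangle\cdot \mathbf p+\mathbf p\cdot\nabla\langle x\rangle)$, $\mathbf p=-i\nabla$. A smooth characteristic function of $[1,\infty)$ is a smooth nondecreasing $F:\mathbb R\to\mathbb R$ with $F(\lambda)=0$ for $\lambda\le\frac12$ and $F(\lambda)=1$ for $\lambda\ge1$. Let $\mathcal N$ be real valued and let $\phi$ be a global spherically symmetric $H^1(\mathbb R^3)$ solution on $[0,\infty)$ of $$i\partial_t\phi+\Delta\phi=\mathcal N(|\phi|,|x|,t)\,\phi,\qquad \phi(0)=\phi_0,$$ that is, $\phi\in C([0,\infty);L^2)$, $\phi(t)\in H^1$ is radial for all $t\ge 0$, $\mathcal N(|\phi|,|x|,t)\phi$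 is locally integrable on $[0,\infty)\times\mathbb R^3$, and the equation holds weakly. Assume that $|x|^{1/2}\phi_0\in L^2(\mathbb R^3)$, that $\sup_{t\ge0}\|\phi(t)\|_{H^1}<\infty$, and that for every smooth characteristic function $F$ of $[1,\infty)$ and every $\alpha\in(\frac13,1)$ there are $\beta_0=\beta_0(\alpha,F)\ge\frac32$ and $C=C(\alpha,F)$ such that $$\Big|F\Big(\frac{|x|}{t^\alpha}\Big)\,\mathcal N(|\phi(t,x)|,|x|,t)\Big|\le C\,t^{-\beta_0}\qquad\text{for all } t\ge1\text{ and almost every }x.$$ Call $\phi$ a weakly localized state with respect to $(F,\alpha)$ if its $\gamma$-limit is zero: $$\lim_{t\to+\infty}\Big(F\big(\tfrac{\langle x\rangle}{t^\alpha}\big)\,\gamma\, F\big(\tfrac{\langle x\rangle}{t^\alpha}\big)\phi(t),\phi(t)\Big)_{L^2}=0.$$ Then: 1. This property does not depend on $F$ and $\alpha$: for all smooth characteristic functions $F,F'$ of $[1,\infty)$ and all $\alpha,\alpha'\in(\frac13,1)$, $\phi$ is a weakly localized state with respect to $(F,\alpha)$ if and only if it is one with respect to $(F',\alpha')$. 2.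 If $\phi$ is a weakly localized state with respect to some such $(F,\alpha)$, then there is a constant $C$ (depending on $\phi$) such that $\int_{\mathbb R^3}|x|\,|\phi(t,x)|^2\,dx\le C\,t^{1/2}$ for all $t\ge1$. -/

import Mathlib

open MeasureTheory Set Filter Topology
open scoped ContDiff ENNReal

noncomputable section

namespace GammaLimit

/-- The physical space `ℝ³` with its Euclidean norm. -/
abbrev E3 : Type := EuclideanSpace ℝ (Fin 3)

/-- The `j`-th classical partial derivative of `f` at `x`. -/
def partialDeriv {V : Type*} [NormedAddCommGroup V] [NormedSpace ℝ V]
    (j : Fin 3) (f : E3 → V) (x : E3) : V :=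
  fderiv ℝ f x (EuclideanSpace.single j 1)

/-- Test functions: smooth, compactly supported, complex valued functions on `ℝ³`. -/
def IsTestFunction (ψ : E3 → ℂ) : Prop :=
  ContDiff ℝ ∞ ψ ∧ HasCompactSupport ψ

/-- `v` is a weak `j`-th partial derivative of `u`. -/
def HasWeakDeriv (j : Fin 3) (u v : E3 → ℂ) : Prop :=
  LocallyIntegrable u volume ∧ LocallyIntegrable v volume ∧
    ∀ ψ : E3 → ℂ, IsTestFunction ψ →
      ∫ x, u x * partialDeriv j ψ x = - ∫ x, v x * ψ x

open Classical in
/-- The weak `j`-th partial derivative (unique up to null sets); `0` if there is none. -/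
def weakDeriv (j : Fin 3) (u : E3 → ℂ) : E3 → ℂ :=
  if h : ∃ v, HasWeakDeriv j u v then h.choose else 0

/-- `u ∈ H¹(ℝ³)`. -/
def MemH1 (u : E3 → ℂ) : Prop :=
  MemLp u 2 volume ∧ ∀ j, ∃ v, HasWeakDeriv j u v ∧ MemLp v 2 volume

/-- The `H¹(ℝ³)` norm, for `u` in `H¹(ℝ³)`. -/
def h1Norm (u : E3 → ℂ) : ℝ≥0∞ :=
  (eLpNorm u 2 volume ^ 2 + ∑ j, eLpNorm (weakDeriv j u) 2 volume ^ 2) ^ (1 / 2 : ℝ)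

/-- Spherically symmetric functions (up to null sets). -/
def IsRadial (u : E3 → ℂ) : Prop :=
  ∃ f : ℝ → ℂ, u =ᵐ[volume] fun x => f ‖x‖

/-- Smooth characteristic functions `F(λ ≥ 1)` of `[1, ∞)`. -/
structure IsSmoothCutoff (F : ℝ → ℝ) : Prop where
  smooth : ContDiff ℝ ∞ F
  mono : Monotone F
  eq_zero : ∀ l ≤ 1 / 2, F l = 0
  eq_one : ∀ l, 1 ≤ l → F l = 1

/-- The densities on `(1, 2)` from which the smoothed modulus `⟨x⟩` is built. -/
structure IsProfile (a : ℝ → ℝ) : Prop where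
  smooth : ContDiff ℝ ∞ a
  nonneg : ∀ r, 0 ≤ a r
  support_eq : Function.support a = Ioo 1 2
  integral_eq : ∫ r in (1 : ℝ)..2, a r = 1

/-- The radial profile `β` of `⟨x⟩`: it is `r` for `r ≥ 2`, constant for `r ≤ 1`, and `β'' = a`
in between. The value `C` of the constant is the one for which `β` is continuous at `2`. -/
def smoothedModulus (a : ℝ → ℝ) (r : ℝ) : ℝ :=
  let C : ℝ := 2 - ∫ s in (1 : ℝ)..2, ∫ τ in (1 : ℝ)..s, a τ
  if 2 ≤ r then r
  else if 1 ≤ r then (∫ s in (1 : ℝ)..r, ∫ τ in (1 : ℝ)..s, a τ) + C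
  else C

/-- The function `⟨x⟩ = β(|x|)` on `ℝ³`. -/
def bracket (a : ℝ → ℝ) (x : E3) : ℝ := smoothedModulus a ‖x‖

/-- The operator `γ = ½ (∇⟨x⟩ · p + p · ∇⟨x⟩)` with `p = -i∇`, acting on `H¹(ℝ³)`. -/
def gammaOp (a : ℝ → ℝ) (u : E3 → ℂ) (x : E3) : ℂ :=
  (1 / 2 : ℂ) * ∑ j : Fin 3,
    (((partialDeriv j (bracket a) x : ℝ) : ℂ) * (-Complex.I * weakDeriv j u x)
      + -Complex.I * weakDeriv j (fun y => ((partialDeriv j (bracket a) y : ℝ) : ℂ) * u y) x)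

/-- Multiplication of `u` by `F(⟨x⟩ / t ^ α ≥ 1)`. -/
def cutoffMul (a F : ℝ → ℝ) (α t : ℝ) (u : E3 → ℂ) (x : E3) : ℂ :=
  (F (bracket a x / t ^ α) : ℂ) * u x

/-- The expectation `⟨F γ F⟩ = (F γ F u, u)` at time `t`, where `F = F(⟨x⟩ / t ^ α ≥ 1)` and
`(f, g) = ∫ g f̄`. -/
def gammaExpectation (a F : ℝ → ℝ) (α t : ℝ) (u : E3 → ℂ) : ℂ :=
  ∫ x, u x * (starRingEnd ℂ) (cutoffMul a F α t (gammaOp a (cutoffMul a F α t u)) x)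

/-- `φ` is a weakly localized state with respect to `F` and `α`: its `γ`-limit exists and is
zero. -/
def IsWeaklyLocalized (a F : ℝ → ℝ) (α : ℝ) (φ : ℝ → E3 → ℂ) : Prop :=
  Tendsto (fun t => gammaExpectation a F α t (φ t)) atTop (𝓝 0)

/-- The interaction term `𝐍(φ)(t, x) = 𝒩(|φ|, |x|, t) φ`. -/
def interaction (N : ℝ → ℝ → ℝ → ℝ) (φ : ℝ → E3 → ℂ) (t : ℝ) (x : E3) : ℂ :=
  (N ‖φ t x‖ ‖x‖ t : ℂ) * φ t x

/-- `φ` is a global spherically symmetric `H¹` solution of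
`i ∂ₜ φ + Δ φ = 𝒩(|φ|, |x|, t) φ`, `φ(0) = φ₀`: it is a continuous curve in `L²` with values in
radial `H¹` functions, and the equation holds in the weak sense, tested against
`ψ ∈ C_c^∞(ℝ³)` and integrated over time intervals `[s, t] ⊆ [0, ∞)`. -/
structure IsGlobalSolution (N : ℝ → ℝ → ℝ → ℝ) (φ₀ : E3 → ℂ) (φ : ℝ → E3 → ℂ) : Prop where
  measurable : AEStronglyMeasurable (fun z : ℝ × E3 => φ z.1 z.2)
    ((volume.restrict (Ici 0)).prod volume)
  memH1 : ∀ t, 0 ≤ t → MemH1 (φ t)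
  radial : ∀ t, 0 ≤ t → IsRadial (φ t)
  continuous : ∀ t, 0 ≤ t →
    Tendsto (fun s => eLpNorm (fun x => φ s x - φ t x) 2 volume) (𝓝[Ici 0] t) (𝓝 0)
  initial : φ 0 =ᵐ[volume] φ₀
  integrable : LocallyIntegrableOn (fun z : ℝ × E3 => interaction N φ z.1 z.2)
    (Ici 0 ×ˢ univ) volume
  equation : ∀ ψ : E3 → ℂ, IsTestFunction ψ → ∀ s t, 0 ≤ s → s ≤ t →
    Complex.I * ((∫ x, φ t x * ψ x) - ∫ x, φ s x * ψ x)
      = ∫ τ in s..t, ∫ x,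
          (interaction N φ τ x * ψ x - φ τ x * Laplacian.laplacian ψ x)

/-- Decay of the interaction in the exterior region:
`|F(|x| / t ^ α ≥ 1) 𝒩(|φ|, |x|, t)| ≤ C t ^ (-β₀)` for all `t ≥ 1`. -/
def ExteriorDecay (N : ℝ → ℝ → ℝ → ℝ) (φ : ℝ → E3 → ℂ) (F : ℝ → ℝ) (α β₀ C : ℝ) : Prop :=
  ∀ t, 1 ≤ t → ∀ᵐ x ∂(volume : Measure E3),
    |F (‖x‖ / t ^ α) * N ‖φ t x‖ ‖x‖ t| ≤ C * t ^ (-β₀)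

end GammaLimit

end

/-! Once t^α ≥ 4, the modulus ⟨x⟩ equals |x| on the support of the cutoff, and the symmetrisation in
γ removes the real part of the quadratic form. The expectation of FγF is then the outgoing current ∫
f(|x|/μ) Im(∂_r φ φ̄) with f = F² and μ = t^α (`IsH1.gammaExpectation_eq`, `exteriorCurrent`). Two
facts about this current carry the theorem.

It is almost nondecreasing in time. In the momentum balance for the field f(|x|/μ) x/|x|, the
Hessian-type term is nonnegative: f'/μ acts on the radial derivative and f/|x| on the tangential
ones. The motion of the cutoff contributes a term of the form f' μ'/μ Im(∂_r φ φ̄), which the radial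
part absorbs at the cost of μ'²/μ ≲ t^(α-2) (`IsSmoothCutoff.window_positivity`). The remaining
errors are the third-order term of size μ^(-3) = t^(-3α) and the exterior interaction of size
t^(-3/2). All are integrable exactly because 1/3 < α < 1. So current minus A t^(-δ) is nondecreasing
and bounded, the limit L exists, and the current is at most L + A t^(-δ)
(`IsDecayingEvolution.exists_tendsto_exteriorCurrent`).

Twice the current is the time derivative of a smoothed first moment. If Γ' = f, the derivative of ∫
μΓ(|x|/μ)|φ|² is twice the current plus O(μ') (`IsEvolution.smoothMoment_evolution`), the real
potential dropping out. Since r - μ ≤ μΓ(r/μ) ≤ r, every choice of cutoff and exponent gives the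
same moment up to O(t^α) = o(t). Two different limits would make two such moments separate linearly,
so the limit does not depend on the choice (`IsDecayingEvolution.limit_le`). If the limit is 0, it
is also 0 for α = 1/2, where δ = 1/2 is allowed. The moment then has derivative at most O(t^(-1/2)),
which integrates to t^(1/2) (`IsDecayingEvolution.exists_moment_le`).

The rest is justification. The equation holds only weakly and its source is only locally integrable,
so the identities are proved for spatial mollifications, which satisfy the equation classically in
space and as absolutely continuous functions of time. In the momentum balance the source is
dominated by |φ| on the exterior region, uniformly in the mollification. In the mass balance it
disappears only in the limit, and the radial Sobolev bound away from the origin is what allows an L¹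
source there. -/

namespace GammaLimit

noncomputable section

/-! ### Partial derivatives and integration by parts on ℝ³. -/

section Calculus

variable {V : Type*} [NormedAddCommGroup V] [NormedSpace ℝ V]

theorem partialDeriv_contDiff {f : E3 → V} {n m : WithTop ℕ∞} (hf : ContDiff ℝ n f)
    (hmn : m + 1 ≤ n) (j : Fin 3) : ContDiff ℝ m (partialDeriv j f) :=
  (hf.fderiv_right hmn).clm_apply contDiff_const

theorem partialDeriv_smooth {f : E3 → V} (hf : ContDiff ℝ ∞ f) (j : Fin 3) :
    ContDiff ℝ ∞ (partialDeriv j f) :=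
  partialDeriv_contDiff hf (by simp) j

theorem partialDeriv_continuous {f : E3 → V} (hf : ContDiff ℝ 1 f) (j : Fin 3) :
    Continuous (partialDeriv j f) :=
  (partialDeriv_contDiff (m := 0) hf (by simp) j).continuous

theorem partialDeriv_hasCompactSupport {f : E3 → V} (hf : HasCompactSupport f) (j : Fin 3) :
    HasCompactSupport (partialDeriv j f) :=
  hf.fderiv_apply ℝ _

theorem partialDeriv_mul {f g : E3 → ℂ} {x : E3} (hf : DifferentiableAt ℝ f x)
    (hg : DifferentiableAt ℝ g x) (j : Fin 3) :
    partialDeriv j (fun y => f y * g y) x = partialDeriv j f x * g x + f x * partialDeriv j g x := by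
  simp only [partialDeriv]
  rw [fderiv_fun_mul hf hg]
  simp [mul_comm]
  ring

theorem partialDeriv_mul_real {f g : E3 → ℝ} {x : E3} (hf : DifferentiableAt ℝ f x)
    (hg : DifferentiableAt ℝ g x) (j : Fin 3) :
    partialDeriv j (fun y => f y * g y) x = partialDeriv j f x * g x + f x * partialDeriv j g x := by
  simp only [partialDeriv]
  rw [fderiv_fun_mul hf hg]
  simp [mul_comm]
  ring

theorem partialDeriv_conj {f : E3 → ℂ} {x : E3} (hf : DifferentiableAt ℝ f x) (j : Fin 3) :
    partialDeriv j (fun y => (starRingEnd ℂ) (f y)) x = (starRingEnd ℂ) (partialDeriv j f x) := by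
  have h := (Complex.conjCLE.toContinuousLinearMap.hasFDerivAt.comp x hf.hasFDerivAt).fderiv
  have h2 : (fun y => (starRingEnd ℂ) (f y)) = Complex.conjCLE.toContinuousLinearMap ∘ f := by
    ext y; simp
  simp only [partialDeriv]
  rw [h2, h]
  simp

theorem partialDeriv_ofReal {f : E3 → ℝ} {x : E3} (hf : DifferentiableAt ℝ f x) (j : Fin 3) :
    partialDeriv j (fun y => (f y : ℂ)) x = ((partialDeriv j f x : ℝ) : ℂ) := by
  have h := (Complex.ofRealCLM.hasFDerivAt.comp x hf.hasFDerivAt).fderiv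
  have h2 : (fun y => (f y : ℂ)) = Complex.ofRealCLM ∘ f := by ext y; simp
  simp only [partialDeriv]
  rw [h2, h]
  simp

theorem partialDeriv_comm {f : E3 → V} (hf : ContDiff ℝ 2 f) (i j : Fin 3) (x : E3) :
    partialDeriv i (partialDeriv j f) x = partialDeriv j (partialDeriv i f) x := by
  have hd : Differentiable ℝ (fderiv ℝ f) :=
    (hf.fderiv_right (m := 1) (by norm_num)).differentiable (by norm_num)
  have key : ∀ i j : Fin 3, partialDeriv i (partialDeriv j f) x
      = fderiv ℝ (fderiv ℝ f) x (EuclideanSpace.single i 1) (EuclideanSpace.single j 1) := by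
    intro i j
    have h := ((hd x).hasFDerivAt.clm_apply
      (hasFDerivAt_const (EuclideanSpace.single j (1 : ℝ)) x)).fderiv
    change fderiv ℝ (fun y => fderiv ℝ f y (EuclideanSpace.single j 1)) x _ = _
    rw [h]
    simp
  rw [key, key]
  exact (hf.contDiffAt.isSymmSndFDerivAt (by simp)).eq _ _

theorem laplacian_eq_sum {f : E3 → V} (hf : ContDiff ℝ 2 f) (x : E3) :
    Laplacian.laplacian f x = ∑ j, partialDeriv j (partialDeriv j f) x := by
  rw [InnerProductSpace.laplacian_eq_iteratedFDeriv_orthonormalBasis f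
    (EuclideanSpace.basisFun (Fin 3) ℝ)]
  have hd : Differentiable ℝ (fderiv ℝ f) :=
    (hf.fderiv_right (m := 1) (by norm_num)).differentiable (by norm_num)
  refine Finset.sum_congr rfl fun j _ => ?_
  rw [iteratedFDeriv_two_apply]
  have h := ((hd x).hasFDerivAt.clm_apply
      (hasFDerivAt_const (EuclideanSpace.single j (1 : ℝ)) x)).fderiv
  change _ = fderiv ℝ (fun y => fderiv ℝ f y (EuclideanSpace.single j 1)) x _
  rw [h]
  simp

/-- Integration by parts against a compactly supported factor. -/
theorem integral_mul_partialDeriv {f g : E3 → ℂ} (hf : ContDiff ℝ 1 f) (hg : ContDiff ℝ 1 g)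
    (hc : HasCompactSupport f) (j : Fin 3) :
    ∫ x, f x * partialDeriv j g x = - ∫ x, partialDeriv j f x * g x := by
  refine integral_mul_fderiv_eq_neg_fderiv_mul_of_integrable ?_ ?_ ?_ ?_ ?_
  · exact ((partialDeriv_continuous hf j).mul hg.continuous).integrable_of_hasCompactSupport
      ((partialDeriv_hasCompactSupport hc j).mul_right)
  · exact (hf.continuous.mul (partialDeriv_continuous hg j)).integrable_of_hasCompactSupport
      hc.mul_right
  · exact (hf.continuous.mul hg.continuous).integrable_of_hasCompactSupport hc.mul_right
  · exact fun x _ => hf.differentiable (by norm_num) x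
  · exact fun x _ => hg.differentiable (by norm_num) x

end Calculus

/-! ### Product rule for absolutely continuous functions of time. -/

section AbsolutelyContinuous

/-- Primitives of integrable functions are absolutely continuous with the expected derivative almost
everywhere. No continuity of a' or b' can be asked for, since the mollified source is merely
integrable in time. -/
theorem integral_mul_add_mul_real {a b a' b' : ℝ → ℝ} {s t : ℝ} (hst : s ≤ t)
    (ha' : IntervalIntegrable a' volume s t) (hb' : IntervalIntegrable b' volume s t)
    (ha : ∀ r ∈ Icc s t, a r = a s + ∫ τ in s..r, a' τ)
    (hb : ∀ r ∈ Icc s t, b r = b s + ∫ τ in s..r, b' τ) :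
    a t * b t - a s * b s = ∫ τ in s..t, (a' τ * b τ + a τ * b' τ) := by
  have main : ∀ {a a' : ℝ → ℝ}, IntervalIntegrable a' volume s t →
      AbsolutelyContinuousOnInterval (fun r => a s + ∫ τ in s..r, a' τ) s t ∧
      ∀ᵐ r, r ∈ uIcc s t → deriv (fun r => a s + ∫ τ in s..r, a' τ) r = a' r := by
    intro a a' ha'
    refine ⟨?_, ?_⟩
    · have h1 : AbsolutelyContinuousOnInterval (fun _ : ℝ => a s) s t :=
        ((LipschitzWith.const' (a s)).lipschitzOnWith (K := 0)
          (s := uIcc s t)).absolutelyContinuousOnInterval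
      exact h1.add (ha'.absolutelyContinuousOnInterval_intervalIntegral left_mem_uIcc)
    · filter_upwards [ha'.ae_hasDerivAt_integral] with r hr hrm
      exact ((hr hrm s left_mem_uIcc).const_add (a s)).deriv
  obtain ⟨A1, A2⟩ := main (a := a) ha'
  obtain ⟨B1, B2⟩ := main (a := b) hb'
  have h := A1.integral_deriv_mul_eq_sub B1
  simp only [intervalIntegral.integral_same, add_zero] at h
  rw [← ha t ⟨hst, le_rfl⟩, ← hb t ⟨hst, le_rfl⟩] at h
  rw [← h]
  refine intervalIntegral.integral_congr_ae ?_
  filter_upwards [A2, B2] with r hA hB hr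
  have hr1 : r ∈ uIcc s t := uIoc_subset_uIcc hr
  have hr2 : r ∈ Icc s t := by rwa [uIcc_of_le hst] at hr1
  rw [hA hr1, hB hr1, ← ha r hr2, ← hb r hr2]

theorem integral_mul_add_mul {a b a' b' : ℝ → ℂ} {s t : ℝ} (hst : s ≤ t)
    (ha' : IntervalIntegrable a' volume s t) (hb' : IntervalIntegrable b' volume s t)
    (ha : ∀ r ∈ Icc s t, a r - a s = ∫ τ in s..r, a' τ)
    (hb : ∀ r ∈ Icc s t, b r - b s = ∫ τ in s..r, b' τ) :
    IntervalIntegrable (fun τ => a' τ * b τ + a τ * b' τ) volume s t ∧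
    a t * b t - a s * b s = ∫ τ in s..t, (a' τ * b τ + a τ * b' τ) := by
  have hcont : ∀ {a a' : ℝ → ℂ}, IntervalIntegrable a' volume s t →
      (∀ r ∈ Icc s t, a r - a s = ∫ τ in s..r, a' τ) → ContinuousOn a (uIcc s t) := by
    intro a a' h1 h2
    have : ContinuousOn (fun r => a s + ∫ τ in s..r, a' τ) (uIcc s t) :=
      continuousOn_const.add (intervalIntegral.continuousOn_primitive_interval' h1 left_mem_uIcc)
    refine this.congr fun r hr => ?_
    rw [uIcc_of_le hst] at hr
    simp [← h2 r hr]
  have ca := hcont ha' ha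
  have cb := hcont hb' hb
  have i1 := ha'.mul_continuousOn cb
  have i2 := hb'.continuousOn_mul ca
  refine ⟨i1.add i2, ?_⟩
  have sub : ∀ {a : ℝ → ℂ}, IntervalIntegrable a volume s t → ∀ r ∈ Icc s t,
      IntervalIntegrable a volume s r := fun h r hr =>
    h.mono_set (by rw [uIcc_of_le hst, uIcc_of_le hr.1]; exact Icc_subset_Icc_right hr.2)
  have re_ : ∀ {a a' : ℝ → ℂ}, IntervalIntegrable a' volume s t →
      (∀ r ∈ Icc s t, a r - a s = ∫ τ in s..r, a' τ) →
      ∀ r ∈ Icc s t, (a r).re = (a s).re + ∫ τ in s..r, (a' τ).re := by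
    intro a a' h1 h2 r hr
    have := (Complex.reCLM.intervalIntegral_comp_comm (sub h1 r hr))
    simp only [Complex.reCLM_apply] at this
    rw [this, ← h2 r hr]; simp
  have im_ : ∀ {a a' : ℝ → ℂ}, IntervalIntegrable a' volume s t →
      (∀ r ∈ Icc s t, a r - a s = ∫ τ in s..r, a' τ) →
      ∀ r ∈ Icc s t, (a r).im = (a s).im + ∫ τ in s..r, (a' τ).im := by
    intro a a' h1 h2 r hr
    have := (Complex.imCLM.intervalIntegral_comp_comm (sub h1 r hr))
    simp only [Complex.imCLM_apply] at this
    rw [this, ← h2 r hr]; simp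
  have ire : ∀ {a : ℝ → ℂ}, IntervalIntegrable a volume s t →
      IntervalIntegrable (fun τ => (a τ).re) volume s t := fun h =>
    ⟨Complex.reCLM.integrable_comp h.1, Complex.reCLM.integrable_comp h.2⟩
  have iim : ∀ {a : ℝ → ℂ}, IntervalIntegrable a volume s t →
      IntervalIntegrable (fun τ => (a τ).im) volume s t := fun h =>
    ⟨Complex.imCLM.integrable_comp h.1, Complex.imCLM.integrable_comp h.2⟩
  have cre : ∀ {a : ℝ → ℂ}, ContinuousOn a (uIcc s t) →
      ContinuousOn (fun τ => (a τ).re) (uIcc s t) := fun h =>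
    Complex.continuous_re.comp_continuousOn h
  have cim : ∀ {a : ℝ → ℂ}, ContinuousOn a (uIcc s t) →
      ContinuousOn (fun τ => (a τ).im) (uIcc s t) := fun h =>
    Complex.continuous_im.comp_continuousOn h
  -- The real part of the product is the combination rr - ii and the imaginary part is ri + ir.
  have rr := integral_mul_add_mul_real hst (ire ha') (ire hb') (re_ ha' ha) (re_ hb' hb)
  have ii := integral_mul_add_mul_real hst (iim ha') (iim hb') (im_ ha' ha) (im_ hb' hb)
  have ri := integral_mul_add_mul_real hst (ire ha') (iim hb') (re_ ha' ha) (im_ hb' hb)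
  have ir := integral_mul_add_mul_real hst (iim ha') (ire hb') (im_ ha' ha) (re_ hb' hb)
  apply Complex.ext
  · have := Complex.reCLM.intervalIntegral_comp_comm (i1.add i2)
    simp only [Complex.reCLM_apply] at this
    rw [← this]
    simp only [Complex.sub_re, Complex.mul_re, Complex.add_re]
    have e : ∫ τ in s..t, ((a' τ).re * (b τ).re - (a' τ).im * (b τ).im +
        ((a τ).re * (b' τ).re - (a τ).im * (b' τ).im))
      = (∫ τ in s..t, ((a' τ).re * (b τ).re + (a τ).re * (b' τ).re))
        - ∫ τ in s..t, ((a' τ).im * (b τ).im + (a τ).im * (b' τ).im) := by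
      rw [← intervalIntegral.integral_sub
        (((ire ha').mul_continuousOn (cre cb)).add ((ire hb').continuousOn_mul (cre ca)))
        (((iim ha').mul_continuousOn (cim cb)).add ((iim hb').continuousOn_mul (cim ca)))]
      congr 1; ext τ; ring
    rw [e, ← rr, ← ii]; ring
  · have := Complex.imCLM.intervalIntegral_comp_comm (i1.add i2)
    simp only [Complex.imCLM_apply] at this
    rw [← this]
    simp only [Complex.sub_im, Complex.mul_im, Complex.add_im]
    have e : ∫ τ in s..t, ((a' τ).re * (b τ).im + (a' τ).im * (b τ).re +
        ((a τ).re * (b' τ).im + (a τ).im * (b' τ).re))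
      = (∫ τ in s..t, ((a' τ).re * (b τ).im + (a τ).re * (b' τ).im))
        + ∫ τ in s..t, ((a' τ).im * (b τ).re + (a τ).im * (b' τ).re) := by
      rw [← intervalIntegral.integral_add
        (((ire ha').mul_continuousOn (cim cb)).add ((iim hb').continuousOn_mul (cre ca)))
        (((iim ha').mul_continuousOn (cre cb)).add ((ire hb').continuousOn_mul (cim ca)))]
      congr 1; ext τ; ring
    rw [e, ← ri, ← ir]; ring

end AbsolutelyContinuous

/-! ### Radial mollifiers. -/

section Mollifier

/-- An unnormalised smooth radial bump supported in the ball of radius `ε`. -/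
def bump (ε : ℝ) (x : E3) : ℝ := Real.smoothTransition (ε ^ 2 - ‖x‖ ^ 2)

/-- A smooth radial mollifier supported in the ball of radius `ε`. -/
def mollifier (ε : ℝ) (x : E3) : ℝ := bump ε x / ∫ y, bump ε y

variable {ε : ℝ}

theorem bump_contDiff : ContDiff ℝ ∞ (bump ε) :=
  Real.smoothTransition.contDiff.comp (contDiff_const.sub (contDiff_norm_sq ℝ))

theorem bump_eq_zero {x : E3} (hε : 0 < ε) (h : ε ≤ ‖x‖) : bump ε x = 0 :=
  Real.smoothTransition.zero_of_nonpos (by nlinarith)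

theorem bump_hasCompactSupport (hε : 0 < ε) : HasCompactSupport (bump ε) :=
  HasCompactSupport.intro (isCompact_closedBall (0 : E3) ε) fun x hx =>
    bump_eq_zero hε (by simpa using (not_le.mp (by simpa using hx)).le)

theorem integral_bump_pos (hε : 0 < ε) : 0 < ∫ y, bump ε y := by
  refine bump_contDiff.continuous.integral_pos_of_hasCompactSupport_nonneg_nonzero
    (bump_hasCompactSupport hε) (fun x => Real.smoothTransition.nonneg _) (x := 0) ?_
  exact (Real.smoothTransition.pos_of_pos (by simp; positivity)).ne'

theorem mollifier_contDiff : ContDiff ℝ ∞ (mollifier ε) := bump_contDiff.div_const _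

theorem mollifier_eq_zero {x : E3} (hε : 0 < ε) (h : ε ≤ ‖x‖) : mollifier ε x = 0 := by
  simp [mollifier, bump_eq_zero hε h]

theorem mollifier_hasCompactSupport (hε : 0 < ε) : HasCompactSupport (mollifier ε) :=
  HasCompactSupport.intro (isCompact_closedBall (0 : E3) ε) fun x hx =>
    mollifier_eq_zero hε (by simpa using (not_le.mp (by simpa using hx)).le)

theorem mollifier_nonneg (hε : 0 < ε) (x : E3) : 0 ≤ mollifier ε x :=
  div_nonneg (Real.smoothTransition.nonneg _) (integral_bump_pos hε).le

theorem integral_mollifier (hε : 0 < ε) : ∫ x, mollifier ε x = 1 := by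
  simp only [mollifier]
  rw [integral_div, div_self (integral_bump_pos hε).ne']

/-- Radiality of the kernel is what keeps mollifications of radial functions radial, as needed for
the radial Sobolev bound. -/
theorem mollifier_radial {x y : E3} (h : ‖x‖ = ‖y‖) : mollifier ε x = mollifier ε y := by
  simp [mollifier, bump, h]

theorem mollifier_isTestFunction (hε : 0 < ε) :
    IsTestFunction (fun x => (mollifier ε x : ℂ)) :=
  ⟨Complex.ofRealCLM.contDiff.comp mollifier_contDiff,
    (mollifier_hasCompactSupport hε).comp_left (g := fun r : ℝ => (r : ℂ)) (by simp)⟩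

theorem measurable_mollifier : Measurable fun x => ENNReal.ofReal (mollifier ε x) :=
  ENNReal.measurable_ofReal.comp mollifier_contDiff.continuous.measurable

/-- The probability measure with density `mollifier ε`. -/
def mollifierMeasure (ε : ℝ) : Measure E3 :=
  volume.withDensity fun x => ENNReal.ofReal (mollifier ε x)

theorem mollifierMeasure_isProbability (hε : 0 < ε) :
    IsProbabilityMeasure (mollifierMeasure ε) := by
  constructor
  rw [mollifierMeasure, withDensity_apply _ MeasurableSet.univ, Measure.restrict_univ,
    ← ofReal_integral_eq_lintegral_ofReal
      (mollifier_contDiff.continuous.integrable_of_hasCompactSupport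
        (mollifier_hasCompactSupport hε))
      (.of_forall (mollifier_nonneg hε)), integral_mollifier hε]
  simp

theorem mollifierMeasure_ae (hε : 0 < ε) : ∀ᵐ y ∂mollifierMeasure ε, ‖y‖ < ε := by
  rw [mollifierMeasure, ae_withDensity_iff
    measurable_mollifier]
  refine .of_forall fun y hy => ?_
  by_contra h
  exact hy (by simp [mollifier_eq_zero hε (not_lt.mp h)])

theorem integral_mollifierMeasure (hε : 0 < ε) (g : E3 → ℂ) :
    ∫ y, g y ∂mollifierMeasure ε = ∫ y, (mollifier ε y : ℂ) * g y := by
  rw [mollifierMeasure, integral_withDensity_eq_integral_toReal_smul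
    measurable_mollifier
    (.of_forall fun x => by simp)]
  refine integral_congr_ae (.of_forall fun y => ?_)
  simp [ENNReal.toReal_ofReal (mollifier_nonneg hε y)]

end Mollifier

/-! ### Convolution with test functions. -/

section Convolution

/-- Convolution of `u` with a test function. -/
def smear (u η : E3 → ℂ) (y : E3) : ℂ := ∫ x, u x * η (y - x)

variable {u v η : E3 → ℂ}

theorem smear_eq_convolution : smear u η = convolution u η (ContinuousLinearMap.mul ℝ ℂ) volume :=
  rfl

theorem smear_contDiff (hu : LocallyIntegrable u volume) (hη : IsTestFunction η) :
    ContDiff ℝ ∞ (smear u η) :=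
  hη.2.contDiff_convolution_right (n := ⊤) (ContinuousLinearMap.mul ℝ ℂ) hu hη.1

theorem IsTestFunction.partialDeriv (hη : IsTestFunction η) (j : Fin 3) :
    IsTestFunction (partialDeriv j η) :=
  ⟨partialDeriv_smooth hη.1 j, partialDeriv_hasCompactSupport hη.2 j⟩

theorem IsTestFunction.laplacian (hη : IsTestFunction η) :
    IsTestFunction (fun x => ∑ j, GammaLimit.partialDeriv j (GammaLimit.partialDeriv j η) x) :=
  ⟨ContDiff.sum fun j _ => ((hη.partialDeriv j).partialDeriv j).1, by
    simp only [Fin.sum_univ_three]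
    exact ((((hη.partialDeriv 0).partialDeriv 0).2.add
      ((hη.partialDeriv 1).partialDeriv 1).2).add ((hη.partialDeriv 2).partialDeriv 2).2)⟩

theorem IsTestFunction.translate (hη : IsTestFunction η) (y : E3) :
    IsTestFunction (fun x => η (y - x)) :=
  ⟨hη.1.comp (contDiff_const.sub contDiff_id),
    hη.2.comp_homeomorph (Homeomorph.subLeft y)⟩

theorem partialDeriv_translate (hη : IsTestFunction η) (j : Fin 3) (x y : E3) :
    partialDeriv j (fun x => η (y - x)) x = - partialDeriv j η (y - x) := by
  have h : HasFDerivAt (fun x => y - x) (-ContinuousLinearMap.id ℝ E3) x := by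
    simpa using (hasFDerivAt_id x).const_sub y
  have := (((hη.1.differentiable (by simp)) (y - x)).hasFDerivAt.comp x h).fderiv
  simp only [partialDeriv]
  change (fderiv ℝ (η ∘ fun x => y - x) x) _ = _
  rw [this]; simp

theorem laplacian_translate (hη : IsTestFunction η) (x y : E3) :
    Laplacian.laplacian (fun x => η (y - x)) x
      = ∑ j, partialDeriv j (partialDeriv j η) (y - x) := by
  rw [laplacian_eq_sum ((hη.translate y).1.of_le (by norm_cast))]
  refine Finset.sum_congr rfl fun j _ => ?_
  have : partialDeriv j (fun x => η (y - x)) = fun x => - partialDeriv j η (y - x) :=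
    funext fun x => partialDeriv_translate hη j x y
  rw [this]
  have h2 := partialDeriv_translate (hη.partialDeriv j) j x y
  simp only [partialDeriv] at h2 ⊢
  rw [fderiv_fun_neg]
  simp [h2]

theorem partialDeriv_smear (hu : LocallyIntegrable u volume) (hη : IsTestFunction η) (j : Fin 3) :
    partialDeriv j (smear u η) = smear u (partialDeriv j η) := by
  ext y
  have h := hη.2.hasFDerivAt_convolution_right (ContinuousLinearMap.mul ℝ ℂ) hu
    (hη.1.of_le (by exact_mod_cast le_top)) y
  rw [partialDeriv, smear_eq_convolution, h.fderiv]
  rw [convolution_precompR_apply _ hu (hη.2.fderiv ℝ)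
    (hη.1.continuous_fderiv (by simp))]
  rfl

/-- The weak derivative is tested against x ↦ η (y - x); the sign from the inner minus cancels the
sign of the weak formulation. With `partialDeriv_smear` this shows that mollification commutes with
weak differentiation. -/
theorem smear_partialDeriv (h : HasWeakDeriv j u v) (hη : IsTestFunction η) :
    smear u (partialDeriv j η) = smear v η := by
  ext y
  have := h.2.2 _ (hη.translate y)
  simp only [partialDeriv_translate hη, mul_neg, integral_neg] at this
  exact neg_injective this

theorem integrable_mul_test (hu : LocallyIntegrable u volume) (hη : IsTestFunction η) :
    Integrable (fun x => u x * η x) volume := by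
  have := hu.integrable_smul_left_of_hasCompactSupport hη.1.continuous hη.2
  simpa [mul_comm] using this

theorem smear_laplacian (hu : LocallyIntegrable u volume) (hη : IsTestFunction η) (y : E3) :
    smear u (fun x => ∑ j, partialDeriv j (partialDeriv j η) x) y
      = ∑ j, partialDeriv j (partialDeriv j (smear u η)) y := by
  simp only [partialDeriv_smear hu hη, partialDeriv_smear hu (hη.partialDeriv _)]
  simp only [smear, Finset.mul_sum]
  exact integral_finsetSum _ fun j _ => integrable_mul_test hu
    (((hη.partialDeriv j).partialDeriv j).translate y)

theorem smear_congr_ae (h : u =ᵐ[volume] v) : smear u η = smear v η := by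
  ext y
  exact integral_congr_ae (h.mono fun x hx => by simp [hx])

/-- As an average of translates over a probability measure, mollification obeys Jensen and Minkowski
with constant one. -/
theorem smear_mollifier_eq {ε : ℝ} (hε : 0 < ε) (y : E3) :
    smear u (fun x => (mollifier ε x : ℂ)) y = ∫ z, u (y - z) ∂mollifierMeasure ε := by
  rw [integral_mollifierMeasure hε, smear, ← integral_sub_left_eq_self _ _ y]
  refine integral_congr_ae (.of_forall fun x => ?_)
  simp [mul_comm]

end Convolution

/-! ### L² contraction and convergence of mollification. -/

section LTwo

theorem enorm_integral_sq_le {ν : Measure E3} [IsProbabilityMeasure ν] {g : E3 → ℂ}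
    (hg : AEStronglyMeasurable g ν) : ‖∫ y, g y ∂ν‖ₑ ^ 2 ≤ ∫⁻ y, ‖g y‖ₑ ^ 2 ∂ν := by
  have h1 : ‖∫ y, g y ∂ν‖ₑ ≤ eLpNorm g 1 ν := by
    rw [eLpNorm_one_eq_lintegral_enorm]; exact enorm_integral_le_lintegral_enorm _
  have h2 : eLpNorm g 1 ν ≤ eLpNorm g 2 ν := eLpNorm_le_eLpNorm_of_exponent_le (by norm_num) hg
  have h3 : eLpNorm g 2 ν ^ 2 = ∫⁻ y, ‖g y‖ₑ ^ 2 ∂ν := by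
    rw [eLpNorm_eq_lintegral_rpow_enorm_toReal (by norm_num) (by norm_num)]
    simp only [ENNReal.toReal_ofNat, ENNReal.rpow_ofNat]
    rw [← ENNReal.rpow_natCast, ← ENNReal.rpow_mul]; simp
  rw [← h3]
  gcongr
  exact h1.trans h2

theorem eLpNorm_two_sq {α : Type*} [MeasurableSpace α] {μ : Measure α} (g : α → ℂ) :
    eLpNorm g 2 μ ^ 2 = ∫⁻ y, ‖g y‖ₑ ^ 2 ∂μ := by
  rw [eLpNorm_eq_lintegral_rpow_enorm_toReal (by norm_num) (by norm_num)]
  simp only [ENNReal.toReal_ofNat, ENNReal.rpow_ofNat]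
  rw [← ENNReal.rpow_natCast, ← ENNReal.rpow_mul]; simp

/-- Minkowski's inequality for averages, in `L²`. -/
theorem eLpNorm_average_sq_le {ν : Measure E3} [IsProbabilityMeasure ν] {g : E3 → E3 → ℂ}
    (hg : AEStronglyMeasurable (Function.uncurry g) (volume.prod ν)) :
    eLpNorm (fun x => ∫ y, g x y ∂ν) 2 volume ^ 2
      ≤ ∫⁻ y, eLpNorm (fun x => g x y) 2 volume ^ 2 ∂ν := by
  rw [eLpNorm_two_sq]
  simp only [eLpNorm_two_sq]
  rw [← lintegral_lintegral_swap (f := fun x y => ‖g x y‖ₑ ^ 2) (hg.enorm.pow_const 2)]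
  refine lintegral_mono_ae ?_
  filter_upwards [hg.prodMk_left] with x hx
  exact enorm_integral_sq_le hx

variable {u : E3 → ℂ} {ε : ℝ}

theorem mollifierMeasure_absolutelyContinuous : mollifierMeasure ε ≪ volume :=
  withDensity_absolutelyContinuous _ _

theorem aestronglyMeasurable_sub_prod (hu : AEStronglyMeasurable u volume) :
    AEStronglyMeasurable (fun p : E3 × E3 => u (p.1 - p.2))
      (volume.prod (mollifierMeasure ε)) := by
  have h : AEStronglyMeasurable (fun p : E3 × E3 => u (p.1 - p.2)) (volume.prod volume) :=
    hu.comp_quasiMeasurePreserving (quasiMeasurePreserving_sub volume volume)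
  exact h.mono_ac (Measure.AbsolutelyContinuous.rfl.prod mollifierMeasure_absolutelyContinuous)

theorem measurePreserving_sub_const (y : E3) :
    MeasurePreserving (fun x : E3 => x - y) volume volume :=
  measurePreserving_sub_right volume y

theorem eLpNorm_smear_mollifier_le (hu : AEStronglyMeasurable u volume) (hε : 0 < ε) :
    eLpNorm (smear u fun x => (mollifier ε x : ℂ)) 2 volume ≤ eLpNorm u 2 volume := by
  have := mollifierMeasure_isProbability hε
  have h := eLpNorm_average_sq_le (g := fun x y => u (x - y)) (ν := mollifierMeasure ε)
    (aestronglyMeasurable_sub_prod hu)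
  have h2 : ∀ y, eLpNorm (fun x => u (x - y)) 2 volume = eLpNorm u 2 volume := fun y =>
    eLpNorm_comp_measurePreserving hu (measurePreserving_sub_const y)
  simp only [h2, lintegral_const, measure_univ, mul_one] at h
  have h3 : (smear u fun x => (mollifier ε x : ℂ)) = fun x => ∫ y, u (x - y) ∂mollifierMeasure ε :=
    funext fun y => smear_mollifier_eq hε y
  rw [h3]
  exact (ENNReal.pow_le_pow_left_iff (by norm_num)).mp h

theorem tendsto_eLpNorm_translate (hu : MemLp u 2 volume) :
    Tendsto (fun y => eLpNorm (fun x => u (x - y) - u x) 2 volume) (𝓝 0) (𝓝 0) := by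
  let τ : E3 → C(E3, E3) := fun y => ⟨fun x => x - y, by fun_prop⟩
  have hτ : Continuous τ :=
    ContinuousMap.continuous_of_continuous_uncurry τ
      (by change Continuous fun p : E3 × E3 => p.2 - p.1; fun_prop)
  have hm : ∀ y, MeasurePreserving (τ y) (volume : Measure E3) volume := fun y =>
    measurePreserving_sub_const y
  have hc : Continuous fun y => Lp.compMeasurePreserving (τ y) (hm y) (hu.toLp u) :=
    continuous_const.compMeasurePreservingLp hτ hm (by norm_num)
  have h0 := (hc.tendsto 0)
  rw [Lp.tendsto_Lp_iff_tendsto_eLpNorm'] at h0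
  refine h0.congr fun y => eLpNorm_congr_ae ?_
  have e : ∀ z, Lp.compMeasurePreserving (τ z) (hm z) (hu.toLp u)
      =ᵐ[volume] fun x => u (x - z) := fun z =>
    (Lp.coeFn_compMeasurePreserving _ (hm z)).trans
      ((hm z).quasiMeasurePreserving.ae_eq_comp hu.coeFn_toLp)
  filter_upwards [e y, e 0] with x h1 h2
  rw [Pi.sub_apply, h1, h2, sub_zero]

/-- The difference is the average of u(· - y) - u over |y| < ε. Minkowski bounds its norm by the
largest translation defect, which is small by continuity of translations in L². -/
theorem tendsto_smear_mollifier (hu : MemLp u 2 volume) :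
    Tendsto (fun ε => eLpNorm (fun x => smear u (fun z => (mollifier ε z : ℂ)) x - u x) 2 volume)
      (𝓝[>] 0) (𝓝 0) := by
  rw [ENNReal.tendsto_nhds_zero]
  intro δ hδ
  have h := (ENNReal.tendsto_nhds_zero.mp (tendsto_eLpNorm_translate hu)) δ hδ
  obtain ⟨r, hr, hr2⟩ := Metric.eventually_nhds_iff.mp h
  filter_upwards [Ioo_mem_nhdsGT hr] with ε hε
  have := mollifierMeasure_isProbability hε.1
  have e : (fun x => smear u (fun z => (mollifier ε z : ℂ)) x - u x)
      =ᵐ[volume] fun x => ∫ y, (u (x - y) - u x) ∂mollifierMeasure ε := by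
    have hi : ∀ x, Integrable (fun y => u (x - y)) (mollifierMeasure ε) := by
      intro x
      rw [mollifierMeasure, integrable_withDensity_iff_integrable_smul'
        measurable_mollifier
        (.of_forall fun x => by simp)]
      have h1 : LocallyIntegrable u volume := hu.locallyIntegrable (by norm_num)
      have h2 := integrable_mul_test h1 ((mollifier_isTestFunction hε.1).translate x)
      have h3 := h2.comp_sub_left x
      refine h3.congr (.of_forall fun y => ?_)
      simp [ENNReal.toReal_ofReal (mollifier_nonneg hε.1 y), mul_comm]
    refine .of_forall fun x => ?_
    simp only
    rw [smear_mollifier_eq hε.1, integral_sub (hi x) (integrable_const _)]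
    simp
  rw [eLpNorm_congr_ae e]
  have h2 := eLpNorm_average_sq_le (g := fun x y => u (x - y) - u x) (ν := mollifierMeasure ε)
    ((aestronglyMeasurable_sub_prod hu.1).sub hu.1.comp_fst)
  refine (ENNReal.pow_le_pow_left_iff (n := 2) (by norm_num)).mp (h2.trans ?_)
  calc _ ≤ ∫⁻ y, δ ^ 2 ∂mollifierMeasure ε := by
        refine lintegral_mono_ae ?_
        filter_upwards [mollifierMeasure_ae hε.1] with y hy
        gcongr
        exact hr2 (by simpa using hy.trans hε.2)
    _ = δ ^ 2 := by simp

end LTwo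

/-! ### Weighted quadratic forms on H¹ and their stability under mollification. -/

section Bilinear

/-- The `L²` norm as a real number. -/
def l2 (f : E3 → ℂ) : ℝ := (eLpNorm f 2 volume).toReal

theorem l2_nonneg (f : E3 → ℂ) : 0 ≤ l2 f := ENNReal.toReal_nonneg

theorem integrable_norm_mul_norm {f g : E3 → ℂ} (hf : MemLp f 2 volume) (hg : MemLp g 2 volume) :
    Integrable (fun x => ‖f x‖ * ‖g x‖) volume :=
  MemLp.integrable_mul (f := fun x => ‖f x‖) (g := fun x => ‖g x‖) hf.norm hg.norm

theorem integral_norm_mul_norm_le {f g : E3 → ℂ} (hf : MemLp f 2 volume)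
    (hg : MemLp g 2 volume) : ∫ x, ‖f x‖ * ‖g x‖ ≤ l2 f * l2 g := by
  have h := integral_mul_le_Lp_mul_Lq_of_nonneg (μ := (volume : Measure E3))
    (f := fun x => ‖f x‖) (g := fun x => ‖g x‖) Real.HolderConjugate.two_two
    (.of_forall fun x => norm_nonneg _) (.of_forall fun x => norm_nonneg _)
    (by simpa using hf.norm) (by simpa using hg.norm)
  have e : ∀ {f : E3 → ℂ}, MemLp f 2 volume → (∫ x, ‖f x‖ ^ (2 : ℝ)) ^ (1 / (2 : ℝ)) = l2 f := by
    intro f hf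
    rw [l2, hf.eLpNorm_eq_integral_rpow_norm (by norm_num) (by norm_num),
      ENNReal.toReal_ofReal (by positivity)]
    simp
  rwa [e hf, e hg] at h

theorem integral_norm_sq {f : E3 → ℂ} (hf : MemLp f 2 volume) :
    ∫ x, ‖f x‖ ^ 2 = l2 f ^ 2 := by
  rw [l2, hf.eLpNorm_eq_integral_rpow_norm (by norm_num) (by norm_num),
      ENNReal.toReal_ofReal (by positivity)]
  simp only [ENNReal.toReal_ofNat, Real.rpow_ofNat]
  rw [← Real.rpow_natCast, ← Real.rpow_mul (by positivity)]
  simp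

theorem integrable_weight_mul {b f g : E3 → ℂ} {B : ℝ} (hb : AEStronglyMeasurable b volume)
    (hB : ∀ᵐ x, ‖b x‖ ≤ B) (hf : MemLp f 2 volume) (hg : MemLp g 2 volume) :
    Integrable (fun x => b x * (f x * (starRingEnd ℂ) (g x))) volume := by
  refine ((integrable_norm_mul_norm hf hg).const_mul B).mono'
    (hb.mul (hf.1.mul (Complex.continuous_conj.comp_aestronglyMeasurable hg.1))) ?_
  filter_upwards [hB] with x hx
  simp only [norm_mul, RCLike.norm_conj]
  gcongr

theorem norm_integral_weight_le {b f g : E3 → ℂ} {B : ℝ} (hB : ∀ᵐ x, ‖b x‖ ≤ B)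
    (hf : MemLp f 2 volume) (hg : MemLp g 2 volume) :
    ‖∫ x, b x * (f x * (starRingEnd ℂ) (g x))‖ ≤ B * (l2 f * l2 g) := by
  have hB0 : 0 ≤ B := by
    obtain ⟨x, hx⟩ := hB.exists
    exact (norm_nonneg _).trans hx
  refine (norm_integral_le_of_norm_le ((integrable_norm_mul_norm hf hg).const_mul B) ?_).trans ?_
  · filter_upwards [hB] with x hx
    simp only [norm_mul, RCLike.norm_conj]
    gcongr
  · rw [integral_const_mul]
    gcongr
    exact integral_norm_mul_norm_le hf hg

theorem l2_sub_le {f g : E3 → ℂ} (hf : MemLp f 2 volume) (hg : MemLp g 2 volume) :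
    l2 f ≤ l2 g + l2 (fun x => f x - g x) := by
  have h := eLpNorm_add_le (μ := (volume : Measure E3)) (p := 2) hg.1 (hf.sub hg).1 (by norm_num)
  have e : g + (f - g) = f := by simp
  rw [e] at h
  have h2 := ENNReal.toReal_mono (by simp [hg.2.ne, (hf.sub hg).2.ne]) h
  rwa [ENNReal.toReal_add hg.2.ne (hf.sub hg).2.ne] at h2

/-- Continuity of weighted sesquilinear integrals with respect to `L²` convergence. -/
theorem tendsto_integral_weight {ι : Type*} {l : Filter ι} {b f g : E3 → ℂ} {F G : ι → E3 → ℂ}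
    {B : ℝ} (hb : AEStronglyMeasurable b volume) (hB : ∀ᵐ x, ‖b x‖ ≤ B)
    (hf : MemLp f 2 volume) (hg : MemLp g 2 volume)
    (hF : ∀ᶠ i in l, MemLp (F i) 2 volume) (hG : ∀ᶠ i in l, MemLp (G i) 2 volume)
    (hFf : Tendsto (fun i => l2 (fun x => F i x - f x)) l (𝓝 0))
    (hGg : Tendsto (fun i => l2 (fun x => G i x - g x)) l (𝓝 0)) :
    Tendsto (fun i => ∫ x, b x * (F i x * (starRingEnd ℂ) (G i x))) l
      (𝓝 (∫ x, b x * (f x * (starRingEnd ℂ) (g x)))) := by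
  rw [tendsto_iff_norm_sub_tendsto_zero]
  have hlim : Tendsto (fun i => B * (l2 (fun x => F i x - f x) *
      (l2 g + l2 (fun x => G i x - g x))) + B * (l2 f * l2 (fun x => G i x - g x))) l (𝓝 0) := by
    have := ((hFf.mul (hGg.const_add (l2 g))).const_mul B).add ((hGg.const_mul (l2 f)).const_mul B)
    simpa using this
  refine squeeze_zero' (.of_forall fun i => norm_nonneg _) ?_ hlim
  filter_upwards [hF, hG] with i hFi hGi
  have hFi' : MemLp (fun x => F i x - f x) 2 volume := hFi.sub hf
  have hGi' : MemLp (fun x => G i x - g x) 2 volume := hGi.sub hg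
  have e : (∫ x, b x * (F i x * (starRingEnd ℂ) (G i x))) -
      ∫ x, b x * (f x * (starRingEnd ℂ) (g x))
      = (∫ x, b x * ((F i x - f x) * (starRingEnd ℂ) (G i x))) +
        ∫ x, b x * (f x * (starRingEnd ℂ) (G i x - g x)) := by
    rw [← integral_sub (integrable_weight_mul hb hB hFi hGi) (integrable_weight_mul hb hB hf hg),
      ← integral_add (integrable_weight_mul hb hB hFi' hGi)
        (integrable_weight_mul hb hB hf hGi')]
    congr 1; ext x; simp; ring
  rw [e]
  refine (norm_add_le _ _).trans (add_le_add ?_ (norm_integral_weight_le hB hf hGi'))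
  refine (norm_integral_weight_le hB hFi' hGi).trans ?_
  have hB0 : 0 ≤ B := by
    obtain ⟨x, hx⟩ := hB.exists
    exact (norm_nonneg _).trans hx
  exact mul_le_mul_of_nonneg_left
    (mul_le_mul_of_nonneg_left (l2_sub_le hGi hg) (l2_nonneg _)) hB0

/-- `u ∈ H¹` with gradient `D` and norms at most `K`. -/
structure IsH1 (u : E3 → ℂ) (D : Fin 3 → E3 → ℂ) (K : ℝ) : Prop where
  memLp : MemLp u 2 volume
  grad : ∀ j, HasWeakDeriv j u (D j)
  memLp_grad : ∀ j, MemLp (D j) 2 volume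
  l2_le : l2 u ≤ K
  l2_grad_le : ∀ j, l2 (D j) ≤ K

/-- `Im ∫ (W · D) ū`, where `D` stands for the gradient of `u`. -/
def current (W : Fin 3 → E3 → ℝ) (D : Fin 3 → E3 → ℂ) (u : E3 → ℂ) : ℝ :=
  ∑ k, ∫ x, W k x * (D k x * (starRingEnd ℂ) (u x)).im

/-- `∫ k |u|²`. -/
def mass (k : E3 → ℝ) (u : E3 → ℂ) : ℝ := ∫ x, k x * ‖u x‖ ^ 2

variable {u : E3 → ℂ} {D : Fin 3 → E3 → ℂ} {K ε : ℝ}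

theorem IsH1.nonneg (h : IsH1 u D K) : 0 ≤ K := (l2_nonneg u).trans h.l2_le

theorem integrable_real_weight_mul {w : E3 → ℝ} {f g : E3 → ℂ} {B : ℝ}
    (hb : AEStronglyMeasurable w volume) (hB : ∀ᵐ x, |w x| ≤ B) (hf : MemLp f 2 volume)
    (hg : MemLp g 2 volume) :
    Integrable (fun x => (w x : ℂ) * (f x * (starRingEnd ℂ) (g x))) volume :=
  integrable_weight_mul (Complex.continuous_ofReal.comp_aestronglyMeasurable hb)
    (hB.mono fun x hx => by simpa using hx) hf hg

theorem integral_weight_im {w : E3 → ℝ} {f g : E3 → ℂ} {B : ℝ}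
    (hb : AEStronglyMeasurable w volume) (hB : ∀ᵐ x, |w x| ≤ B) (hf : MemLp f 2 volume)
    (hg : MemLp g 2 volume) :
    ∫ x, w x * (f x * (starRingEnd ℂ) (g x)).im
      = (∫ x, (w x : ℂ) * (f x * (starRingEnd ℂ) (g x))).im := by
  have h := Complex.imCLM.integral_comp_comm (integrable_real_weight_mul hb hB hf hg)
  simp only [Complex.imCLM_apply] at h
  rw [← h]
  simp only [Complex.im_ofReal_mul]

theorem integral_weight_re {w : E3 → ℝ} {f g : E3 → ℂ} {B : ℝ}
    (hb : AEStronglyMeasurable w volume) (hB : ∀ᵐ x, |w x| ≤ B) (hf : MemLp f 2 volume)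
    (hg : MemLp g 2 volume) :
    ∫ x, w x * (f x * (starRingEnd ℂ) (g x)).re
      = (∫ x, (w x : ℂ) * (f x * (starRingEnd ℂ) (g x))).re := by
  have h := Complex.reCLM.integral_comp_comm (integrable_real_weight_mul hb hB hf hg)
  simp only [Complex.reCLM_apply] at h
  rw [← h]
  simp only [Complex.re_ofReal_mul]

theorem mass_eq_re {w : E3 → ℝ} {B : ℝ}
    (hb : AEStronglyMeasurable w volume) (hB : ∀ᵐ x, |w x| ≤ B) (hu : MemLp u 2 volume) :
    mass w u = (∫ x, (w x : ℂ) * (u x * (starRingEnd ℂ) (u x))).re := by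
  rw [← integral_weight_re hb hB hu hu, mass]
  congr 1; ext x
  rw [Complex.mul_conj, Complex.ofReal_re, Complex.normSq_eq_norm_sq]

theorem abs_current_le {W : Fin 3 → E3 → ℝ} {B : ℝ}
    (hb : ∀ k, AEStronglyMeasurable (W k) volume) (hB : ∀ k, ∀ᵐ x, |W k x| ≤ B) (h : IsH1 u D K) :
    |current W D u| ≤ 3 * B * K ^ 2 := by
  have hB0 : 0 ≤ B := by
    obtain ⟨x, hx⟩ := (hB 0).exists
    exact (abs_nonneg _).trans hx
  have hk : ∀ k, |∫ x, W k x * (D k x * (starRingEnd ℂ) (u x)).im| ≤ B * K ^ 2 := by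
    intro k
    rw [integral_weight_im (hb k) (hB k) (h.memLp_grad k) h.memLp]
    refine (Complex.abs_im_le_norm _).trans ((norm_integral_weight_le
      ((hB k).mono fun x hx => by simpa using hx) (h.memLp_grad k) h.memLp).trans ?_)
    rw [pow_two]
    exact mul_le_mul_of_nonneg_left
      (mul_le_mul (h.l2_grad_le k) h.l2_le (l2_nonneg _) h.nonneg) hB0
  refine (Finset.abs_sum_le_sum_abs _ _).trans ((Finset.sum_le_sum fun k _ => hk k).trans ?_)
  simp; linarith

theorem abs_mass_le {w : E3 → ℝ} {B : ℝ}
    (hb : AEStronglyMeasurable w volume) (hB : ∀ᵐ x, |w x| ≤ B) (h : IsH1 u D K) :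
    |mass w u| ≤ B * K ^ 2 := by
  have hB0 : 0 ≤ B := by
    obtain ⟨x, hx⟩ := hB.exists
    exact (abs_nonneg _).trans hx
  rw [mass_eq_re hb hB h.memLp]
  refine (Complex.abs_re_le_norm _).trans ((norm_integral_weight_le
      (hB.mono fun x hx => by simpa using hx) h.memLp h.memLp).trans ?_)
  rw [pow_two]
  exact mul_le_mul_of_nonneg_left (mul_le_mul h.l2_le h.l2_le (l2_nonneg _) h.nonneg) hB0

/-- The mollification of `u`. -/
abbrev moll (ε : ℝ) (u : E3 → ℂ) : E3 → ℂ := smear u fun x => (mollifier ε x : ℂ)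

theorem memLp_moll (hu : MemLp u 2 volume) (hε : 0 < ε) : MemLp (moll ε u) 2 volume :=
  ⟨(smear_contDiff (hu.locallyIntegrable (by norm_num))
    (mollifier_isTestFunction hε)).continuous.aestronglyMeasurable,
    (eLpNorm_smear_mollifier_le hu.1 hε).trans_lt hu.2⟩

theorem l2_moll_le (hu : MemLp u 2 volume) (hε : 0 < ε) : l2 (moll ε u) ≤ l2 u :=
  ENNReal.toReal_mono hu.2.ne (eLpNorm_smear_mollifier_le hu.1 hε)

theorem tendsto_l2_moll (hu : MemLp u 2 volume) :
    Tendsto (fun ε => l2 (fun x => moll ε u x - u x)) (𝓝[>] 0) (𝓝 0) := by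
  have := (ENNReal.tendsto_toReal (by simp)).comp (tendsto_smear_mollifier hu)
  rwa [ENNReal.toReal_zero] at this

/-- Consequently mollification keeps every H¹ bound with the same constant K, and currents of
mollifications converge to the current built from D. -/
theorem IsH1.partialDeriv_moll (h : IsH1 u D K) (hε : 0 < ε) (j : Fin 3) :
    partialDeriv j (moll ε u) = moll ε (D j) := by
  rw [moll, partialDeriv_smear (h.grad j).1 (mollifier_isTestFunction hε),
    smear_partialDeriv (h.grad j) (mollifier_isTestFunction hε)]

theorem hasWeakDeriv_of_contDiff (hu : ContDiff ℝ 1 u) (j : Fin 3) :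
    HasWeakDeriv j u (partialDeriv j u) := by
  refine ⟨hu.continuous.locallyIntegrable, (partialDeriv_continuous hu j).locallyIntegrable,
    fun ψ hψ => ?_⟩
  have := integral_mul_partialDeriv (hψ.1.of_le (by norm_cast)) hu hψ.2 j
  simp only [mul_comm (ψ _), mul_comm (partialDeriv j ψ _)] at this
  rw [this]; simp

theorem IsH1.moll (h : IsH1 u D K) (hε : 0 < ε) :
    IsH1 (moll ε u) (fun j => partialDeriv j (moll ε u)) K where
  memLp := memLp_moll h.memLp hε
  grad j := hasWeakDeriv_of_contDiff ((smear_contDiff (h.grad j).1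
    (mollifier_isTestFunction hε)).of_le (by norm_cast)) j
  memLp_grad j := by rw [h.partialDeriv_moll hε]; exact memLp_moll (h.memLp_grad j) hε
  l2_le := (l2_moll_le h.memLp hε).trans h.l2_le
  l2_grad_le j := by
    rw [h.partialDeriv_moll hε]; exact (l2_moll_le (h.memLp_grad j) hε).trans (h.l2_grad_le j)

theorem IsH1.tendsto_current {W : Fin 3 → E3 → ℝ} {B : ℝ} (h : IsH1 u D K)
    (hb : ∀ k, AEStronglyMeasurable (W k) volume) (hB : ∀ k, ∀ᵐ x, |W k x| ≤ B) :
    Tendsto (fun ε => current W (fun j => partialDeriv j (GammaLimit.moll ε u))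
      (GammaLimit.moll ε u)) (𝓝[>] 0) (𝓝 (current W D u)) := by
  refine tendsto_finsetSum _ fun k _ => ?_
  rw [integral_weight_im (hb k) (hB k) (h.memLp_grad k) h.memLp]
  have hev : ∀ᶠ ε in 𝓝[>] (0 : ℝ), 0 < ε := self_mem_nhdsWithin
  have := tendsto_integral_weight (l := 𝓝[>] (0 : ℝ)) (b := fun x => (W k x : ℂ)) (B := B)
    (F := fun ε => GammaLimit.moll ε (D k))
    (G := fun ε => GammaLimit.moll ε u) (Complex.continuous_ofReal.comp_aestronglyMeasurable (hb k))
    ((hB k).mono fun x hx => by simpa using hx) (h.memLp_grad k) h.memLp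
    (hev.mono fun ε hε => memLp_moll (h.memLp_grad k) hε)
    (hev.mono fun ε hε => memLp_moll h.memLp hε)
    (tendsto_l2_moll (h.memLp_grad k)) (tendsto_l2_moll h.memLp)
  refine ((Complex.continuous_im.tendsto _).comp this).congr' ?_
  filter_upwards [hev] with ε hε
  simp only [Function.comp]
  rw [h.partialDeriv_moll hε, integral_weight_im (hb k) (hB k) (memLp_moll (h.memLp_grad k) hε)
    (memLp_moll h.memLp hε)]

theorem IsH1.tendsto_mass {w : E3 → ℝ} {B : ℝ} (h : IsH1 u D K)
    (hb : AEStronglyMeasurable w volume) (hB : ∀ᵐ x, |w x| ≤ B) :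
    Tendsto (fun ε => mass w (GammaLimit.moll ε u)) (𝓝[>] 0) (𝓝 (mass w u)) := by
  rw [mass_eq_re hb hB h.memLp]
  have hev : ∀ᶠ ε in 𝓝[>] (0 : ℝ), 0 < ε := self_mem_nhdsWithin
  have := tendsto_integral_weight (l := 𝓝[>] (0 : ℝ)) (b := fun x => (w x : ℂ)) (B := B)
    (F := fun ε => GammaLimit.moll ε u)
    (G := fun ε => GammaLimit.moll ε u) (Complex.continuous_ofReal.comp_aestronglyMeasurable hb)
    (hB.mono fun x hx => by simpa using hx) h.memLp h.memLp
    (hev.mono fun ε hε => memLp_moll h.memLp hε)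
    (hev.mono fun ε hε => memLp_moll h.memLp hε)
    (tendsto_l2_moll h.memLp) (tendsto_l2_moll h.memLp)
  refine ((Complex.continuous_re.tendsto _).comp this).congr' ?_
  filter_upwards [hev] with ε hε
  simp only [Function.comp]
  rw [mass_eq_re hb hB (memLp_moll h.memLp hε)]

end Bilinear

/-! ### Mass and momentum balance for smooth functions. -/

section Spatial

theorem integral_real_mul_partialDeriv {f g : E3 → ℝ} (hf : ContDiff ℝ 1 f) (hg : ContDiff ℝ 1 g)
    (hc : HasCompactSupport f) (j : Fin 3) :
    ∫ x, f x * partialDeriv j g x = - ∫ x, partialDeriv j f x * g x := by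
  refine integral_mul_fderiv_eq_neg_fderiv_mul_of_integrable ?_ ?_ ?_ ?_ ?_
  · exact ((partialDeriv_continuous hf j).mul hg.continuous).integrable_of_hasCompactSupport
      ((partialDeriv_hasCompactSupport hc j).mul_right)
  · exact (hf.continuous.mul (partialDeriv_continuous hg j)).integrable_of_hasCompactSupport
      hc.mul_right
  · exact (hf.continuous.mul hg.continuous).integrable_of_hasCompactSupport hc.mul_right
  · exact fun x _ => hf.differentiable (by norm_num) x
  · exact fun x _ => hg.differentiable (by norm_num) x

theorem integrable_compact_mul {k g : E3 → ℝ} (hk : Continuous k) (hc : HasCompactSupport k)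
    (hg : Continuous g) : Integrable (fun x => k x * g x) volume :=
  (hk.mul hg).integrable_of_hasCompactSupport hc.mul_right

variable {f g : E3 → ℂ}

theorem partialDeriv_re {x : E3} (hf : DifferentiableAt ℝ f x) (j : Fin 3) :
    partialDeriv j (fun y => (f y).re) x = (partialDeriv j f x).re := by
  have h := (Complex.reCLM.hasFDerivAt.comp x hf.hasFDerivAt).fderiv
  simp only [partialDeriv]
  change fderiv ℝ (Complex.reCLM ∘ f) x _ = _
  rw [h]; simp

theorem partialDeriv_im {x : E3} (hf : DifferentiableAt ℝ f x) (j : Fin 3) :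
    partialDeriv j (fun y => (f y).im) x = (partialDeriv j f x).im := by
  have h := (Complex.imCLM.hasFDerivAt.comp x hf.hasFDerivAt).fderiv
  simp only [partialDeriv]
  change fderiv ℝ (Complex.imCLM ∘ f) x _ = _
  rw [h]; simp

theorem contDiff_mul_conj {n : WithTop ℕ∞} (hf : ContDiff ℝ n f) (hg : ContDiff ℝ n g) :
    ContDiff ℝ n (fun x => f x * (starRingEnd ℂ) (g x)) :=
  hf.mul (Complex.conjCLE.toContinuousLinearMap.contDiff.comp hg)

theorem partialDeriv_mul_conj (hf : ContDiff ℝ 1 f) (hg : ContDiff ℝ 1 g) (j : Fin 3) (x : E3) :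
    partialDeriv j (fun y => f y * (starRingEnd ℂ) (g y)) x
      = partialDeriv j f x * (starRingEnd ℂ) (g x)
        + f x * (starRingEnd ℂ) (partialDeriv j g x) := by
  have hfd := hf.differentiable (by norm_num) x
  have hgd := hg.differentiable (by norm_num) x
  have hgc : DifferentiableAt ℝ (fun y => (starRingEnd ℂ) (g y)) x :=
    Complex.conjCLE.toContinuousLinearMap.differentiableAt.comp x hgd
  rw [partialDeriv_mul hfd hgc, partialDeriv_conj hgd]

theorem partialDeriv_re_mul_conj (hf : ContDiff ℝ 1 f) (hg : ContDiff ℝ 1 g) (j : Fin 3)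
    (x : E3) :
    partialDeriv j (fun y => (f y * (starRingEnd ℂ) (g y)).re) x
      = (partialDeriv j f x * (starRingEnd ℂ) (g x)).re
        + (f x * (starRingEnd ℂ) (partialDeriv j g x)).re := by
  rw [partialDeriv_re ((contDiff_mul_conj hf hg).differentiable (by norm_num) x),
    partialDeriv_mul_conj hf hg, Complex.add_re]

theorem partialDeriv_im_mul_conj (hf : ContDiff ℝ 1 f) (hg : ContDiff ℝ 1 g) (j : Fin 3)
    (x : E3) :
    partialDeriv j (fun y => (f y * (starRingEnd ℂ) (g y)).im) x
      = (partialDeriv j f x * (starRingEnd ℂ) (g x)).im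
        + (f x * (starRingEnd ℂ) (partialDeriv j g x)).im := by
  rw [partialDeriv_im ((contDiff_mul_conj hf hg).differentiable (by norm_num) x),
    partialDeriv_mul_conj hf hg, Complex.add_im]

theorem integral_mul_re_mul_conj {k : E3 → ℝ} (hk : ContDiff ℝ 1 k) (hc : HasCompactSupport k)
    (hf : ContDiff ℝ 1 f) (hg : ContDiff ℝ 1 g) (j : Fin 3) :
    ∫ x, k x * (partialDeriv j f x * (starRingEnd ℂ) (g x)).re
      = - (∫ x, partialDeriv j k x * (f x * (starRingEnd ℂ) (g x)).re)
        - ∫ x, k x * (f x * (starRingEnd ℂ) (partialDeriv j g x)).re := by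
  have cf := hf.continuous
  have cg := hg.continuous
  have cf' := partialDeriv_continuous hf j
  have cg' := partialDeriv_continuous hg j
  have h := integral_real_mul_partialDeriv hk (Complex.reCLM.contDiff.comp
    (contDiff_mul_conj hf hg)) hc j
  simp only [Function.comp_def, Complex.reCLM_apply] at h
  rw [← h, ← integral_sub]
  · congr 1; ext x
    rw [partialDeriv_re_mul_conj hf hg]; ring
  · simp only [partialDeriv_re_mul_conj hf hg]
    exact Continuous.integrable_of_hasCompactSupport (hk.continuous.mul (by fun_prop)) hc.mul_right
  · exact Continuous.integrable_of_hasCompactSupport (hk.continuous.mul (by fun_prop)) hc.mul_right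

theorem integral_mul_im_mul_conj {k : E3 → ℝ} (hk : ContDiff ℝ 1 k) (hc : HasCompactSupport k)
    (hf : ContDiff ℝ 1 f) (hg : ContDiff ℝ 1 g) (j : Fin 3) :
    ∫ x, k x * (partialDeriv j f x * (starRingEnd ℂ) (g x)).im
      = - (∫ x, partialDeriv j k x * (f x * (starRingEnd ℂ) (g x)).im)
        - ∫ x, k x * (f x * (starRingEnd ℂ) (partialDeriv j g x)).im := by
  have cf := hf.continuous
  have cg := hg.continuous
  have cf' := partialDeriv_continuous hf j
  have cg' := partialDeriv_continuous hg j
  have h := integral_real_mul_partialDeriv hk (Complex.imCLM.contDiff.comp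
    (contDiff_mul_conj hf hg)) hc j
  simp only [Function.comp_def, Complex.imCLM_apply] at h
  rw [← h, ← integral_sub]
  · congr 1; ext x
    rw [partialDeriv_im_mul_conj hf hg]; ring
  · simp only [partialDeriv_im_mul_conj hf hg]
    exact Continuous.integrable_of_hasCompactSupport (hk.continuous.mul (by fun_prop)) hc.mul_right
  · exact Continuous.integrable_of_hasCompactSupport (hk.continuous.mul (by fun_prop)) hc.mul_right

/-- The Laplacian as the sum of the second partial derivatives. -/
def lap {V : Type*} [NormedAddCommGroup V] [NormedSpace ℝ V] (f : E3 → V) (x : E3) : V :=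
  ∑ j, partialDeriv j (partialDeriv j f) x

/-- The right-hand side `i Δ U - i Q` of the Schrödinger equation. -/
def rhs (U Q : E3 → ℂ) (x : E3) : ℂ := Complex.I * lap U x - Complex.I * Q x

variable {U Q : E3 → ℂ}

theorem lap_contDiff {V : Type*} [NormedAddCommGroup V] [NormedSpace ℝ V] {f : E3 → V}
    (hU : ContDiff ℝ ∞ f) : ContDiff ℝ ∞ (lap f) :=
  ContDiff.sum fun j _ => partialDeriv_smooth (partialDeriv_smooth hU j) j

theorem rhs_contDiff (hU : ContDiff ℝ ∞ U) (hQ : ContDiff ℝ ∞ Q) : ContDiff ℝ ∞ (rhs U Q) :=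
  (contDiff_const.mul (lap_contDiff hU)).sub (contDiff_const.mul hQ)

/-- After one integration by parts the term k ∂ⱼU conj(∂ⱼU) is real, so only the gradient of k
survives in the imaginary part. -/
theorem mul_lap_im (hU : ContDiff ℝ ∞ U) {k : E3 → ℝ} (hk : ContDiff ℝ 1 k)
    (hc : HasCompactSupport k) :
    ∫ x, k x * (lap U x * (starRingEnd ℂ) (U x)).im
      = - current (fun j => partialDeriv j k) (fun j => partialDeriv j U) U := by
  have h1 : ∀ j, ContDiff ℝ 1 (partialDeriv j U) := fun j =>
    (partialDeriv_smooth hU j).of_le (by norm_cast)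
  have hU1 : ContDiff ℝ 1 U := hU.of_le (by norm_cast)
  have c0 := hU1.continuous
  have c2 : ∀ j, Continuous (partialDeriv j (partialDeriv j U)) := fun j =>
    partialDeriv_continuous (h1 j) j
  simp only [lap, current, Finset.sum_mul, Complex.im_sum, Finset.mul_sum]
  rw [integral_finsetSum _ fun j _ => integrable_compact_mul hk.continuous hc (by fun_prop), ← Finset.sum_neg_distrib]
  refine Finset.sum_congr rfl fun j _ => ?_
  rw [integral_mul_im_mul_conj hk hc (h1 j) hU1]
  have : ∀ x, (partialDeriv j U x * (starRingEnd ℂ) (partialDeriv j U x)).im = 0 := fun x => by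
    rw [Complex.mul_conj]; simp
  simp [this]

/-- The local mass balance. -/
theorem mass_balance (hU : ContDiff ℝ ∞ U) (hQ : Continuous Q) {k : E3 → ℝ}
    (hk : ContDiff ℝ 1 k) (hc : HasCompactSupport k) :
    ∫ x, k x * (2 * (rhs U Q x * (starRingEnd ℂ) (U x)).re)
      = 2 * current (fun j => partialDeriv j k) (fun j => partialDeriv j U) U
        + 2 * ∫ x, k x * (Q x * (starRingEnd ℂ) (U x)).im := by
  have c0 := hU.continuous
  have cl := (lap_contDiff hU).continuous
  have e : ∀ x, k x * (2 * (rhs U Q x * (starRingEnd ℂ) (U x)).re)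
      = -2 * (k x * (lap U x * (starRingEnd ℂ) (U x)).im)
        + 2 * (k x * (Q x * (starRingEnd ℂ) (U x)).im) := by
    intro x; simp [rhs]; ring
  simp only [e]
  rw [integral_add, integral_const_mul, integral_const_mul, mul_lap_im hU hk hc]
  · ring
  · exact (Continuous.integrable_of_hasCompactSupport
      (hk.continuous.mul (by fun_prop)) hc.mul_right).const_mul _
  · exact (Continuous.integrable_of_hasCompactSupport
      (hk.continuous.mul (by fun_prop)) hc.mul_right).const_mul _

/-- The divergence of a vector field. -/
def divergence (W : Fin 3 → E3 → ℝ) (x : E3) : ℝ := ∑ k, partialDeriv k (W k) x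

variable {W : Fin 3 → E3 → ℝ}

theorem divergence_contDiff (hW : ∀ k, ContDiff ℝ ∞ (W k)) : ContDiff ℝ ∞ (divergence W) :=
  ContDiff.sum fun k _ => partialDeriv_smooth (hW k) k

theorem divergence_hasCompactSupport (hc : ∀ k, HasCompactSupport (W k)) :
    HasCompactSupport (divergence W) := by
  have : divergence W = fun x => partialDeriv 0 (W 0) x + partialDeriv 1 (W 1) x
      + partialDeriv 2 (W 2) x := by ext x; simp [divergence, Fin.sum_univ_three]
  rw [this]
  exact ((partialDeriv_hasCompactSupport (hc 0) 0).add
    (partialDeriv_hasCompactSupport (hc 1) 1)).add (partialDeriv_hasCompactSupport (hc 2) 2)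

/-- The first integration by parts leaves Re(U conj ∂ⱼU) = ½ ∂ⱼ|U|², and the second moves that
derivative onto the weight. -/
theorem mul_lap_re (hU : ContDiff ℝ ∞ U) {d : E3 → ℝ} (hd : ContDiff ℝ ∞ d)
    (hc : HasCompactSupport d) :
    ∫ x, d x * (lap U x * (starRingEnd ℂ) (U x)).re
      = (1 / 2) * (∫ x, lap d x * ‖U x‖ ^ 2)
        - ∑ j, ∫ x, d x * ‖partialDeriv j U x‖ ^ 2 := by
  have h1 : ∀ j, ContDiff ℝ 1 (partialDeriv j U) := fun j =>
    (partialDeriv_smooth hU j).of_le (by norm_cast)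
  have hU1 : ContDiff ℝ 1 U := hU.of_le (by norm_cast)
  have hd1 : ContDiff ℝ 1 d := hd.of_le (by norm_cast)
  have hd2 : ∀ j, ContDiff ℝ 1 (partialDeriv j d) := fun j =>
    (partialDeriv_smooth hd j).of_le (by norm_cast)
  have c0 := hU1.continuous
  have c2 : ∀ j, Continuous (partialDeriv j (partialDeriv j U)) := fun j =>
    partialDeriv_continuous (h1 j) j
  simp only [lap, Finset.sum_mul, Complex.re_sum, Finset.mul_sum]
  rw [integral_finsetSum _ fun j _ => integrable_compact_mul hd.continuous hc (by fun_prop),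
    integral_finsetSum _ fun j _ => integrable_compact_mul (partialDeriv_continuous (hd2 j) j)
      (partialDeriv_hasCompactSupport (partialDeriv_hasCompactSupport hc j) j) (by fun_prop),
    Finset.mul_sum, ← Finset.sum_sub_distrib]
  refine Finset.sum_congr rfl fun j _ => ?_
  rw [integral_mul_re_mul_conj hd1 hc (h1 j) hU1]
  have e1 : ∀ z : ℂ, (z * (starRingEnd ℂ) z).re = ‖z‖ ^ 2 := fun z => by
    rw [Complex.mul_conj, Complex.ofReal_re, Complex.normSq_eq_norm_sq]
  simp only [e1]
  have h := integral_mul_re_mul_conj (hd2 j) (partialDeriv_hasCompactSupport hc j) hU1 hU1 j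
  simp only [e1] at h
  have e2 : ∀ x, (U x * (starRingEnd ℂ) (partialDeriv j U x)).re
      = (partialDeriv j U x * (starRingEnd ℂ) (U x)).re := fun x => by
    simp; ring
  simp only [e2] at h
  linarith

/-- The local momentum balance. -/
theorem momentum_balance (hU : ContDiff ℝ ∞ U) (hQ : ContDiff ℝ ∞ Q)
    (hW : ∀ k, ContDiff ℝ ∞ (W k)) (hc : ∀ k, HasCompactSupport (W k)) :
    ∑ k, ∫ x, W k x * (partialDeriv k (rhs U Q) x * (starRingEnd ℂ) (U x)
        + partialDeriv k U x * (starRingEnd ℂ) (rhs U Q x)).im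
      = 2 * (∑ j, ∑ k, ∫ x, partialDeriv j (W k) x *
          (partialDeriv j U x * (starRingEnd ℂ) (partialDeriv k U x)).re)
        - (1 / 2) * (∫ x, lap (divergence W) x * ‖U x‖ ^ 2)
        + (∫ x, divergence W x * (Q x * (starRingEnd ℂ) (U x)).re)
        + 2 * ∑ k, ∫ x, W k x * (Q x * (starRingEnd ℂ) (partialDeriv k U x)).re := by
  have hU1 : ContDiff ℝ 1 U := hU.of_le (by norm_cast)
  have h1 : ∀ j, ContDiff ℝ 1 (partialDeriv j U) := fun j =>
    (partialDeriv_smooth hU j).of_le (by norm_cast)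
  have hW1 : ∀ k, ContDiff ℝ 1 (W k) := fun k => (hW k).of_le (by norm_cast)
  have hP1 : ContDiff ℝ 1 (rhs U Q) := (rhs_contDiff hU hQ).of_le (by norm_cast)
  have c0 := hU1.continuous
  have c1 : ∀ j, Continuous (partialDeriv j U) := fun j => (h1 j).continuous
  have c2 : ∀ i j, Continuous (partialDeriv i (partialDeriv j U)) := fun i j =>
    partialDeriv_continuous (h1 j) i
  have cl := (lap_contDiff hU).continuous
  have cP := hP1.continuous
  have cP1 := fun k => partialDeriv_continuous hP1 k
  have cQ := hQ.continuous
  have cW : ∀ k, Continuous (W k) := fun k => (hW k).continuous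
  have cW1 : ∀ j k, Continuous (partialDeriv j (W k)) := fun j k =>
    partialDeriv_continuous (hW1 k) j
  have hd := divergence_contDiff hW
  have hdc := divergence_hasCompactSupport hc
  have cd := hd.continuous
  have iW : ∀ k {g : E3 → ℝ}, Continuous g → Integrable (fun x => W k x * g x) volume :=
    fun k g hg => ((cW k).mul hg).integrable_of_hasCompactSupport (hc k).mul_right
  have iW1 : ∀ j k {g : E3 → ℝ}, Continuous g →
      Integrable (fun x => partialDeriv j (W k) x * g x) volume :=
    fun j k g hg => ((cW1 j k).mul hg).integrable_of_hasCompactSupport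
      (partialDeriv_hasCompactSupport (hc k) j).mul_right
  have iD : ∀ {g : E3 → ℝ}, Continuous g → Integrable (fun x => divergence W x * g x) volume :=
    fun {g} hg => (cd.mul hg).integrable_of_hasCompactSupport hdc.mul_right
  -- moving the derivative off the right-hand side
  have s1 : ∑ k, ∫ x, W k x * (partialDeriv k (rhs U Q) x * (starRingEnd ℂ) (U x)
        + partialDeriv k U x * (starRingEnd ℂ) (rhs U Q x)).im
      = - (∫ x, divergence W x * (rhs U Q x * (starRingEnd ℂ) (U x)).im)
        - 2 * ∑ k, ∫ x, W k x * (rhs U Q x * (starRingEnd ℂ) (partialDeriv k U x)).im := by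
    have e : ∫ x, divergence W x * (rhs U Q x * (starRingEnd ℂ) (U x)).im
        = ∑ k, ∫ x, partialDeriv k (W k) x * (rhs U Q x * (starRingEnd ℂ) (U x)).im := by
      simp only [divergence, Finset.sum_mul]
      exact integral_finsetSum _ fun k _ => iW1 k k (by fun_prop)
    rw [e, Finset.mul_sum, ← Finset.sum_neg_distrib, ← Finset.sum_sub_distrib]
    refine Finset.sum_congr rfl fun k _ => ?_
    have e2 : ∀ x, W k x * (partialDeriv k (rhs U Q) x * (starRingEnd ℂ) (U x)
        + partialDeriv k U x * (starRingEnd ℂ) (rhs U Q x)).im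
        = W k x * (partialDeriv k (rhs U Q) x * (starRingEnd ℂ) (U x)).im
          - W k x * (rhs U Q x * (starRingEnd ℂ) (partialDeriv k U x)).im := by
      intro x; simp; ring
    simp only [e2]
    rw [integral_sub (iW k (by fun_prop)) (iW k (by fun_prop)),
      integral_mul_im_mul_conj (hW1 k) (hc k) hP1 hU1]
    ring
  have s2 : ∫ x, divergence W x * (rhs U Q x * (starRingEnd ℂ) (U x)).im
      = (1 / 2) * (∫ x, lap (divergence W) x * ‖U x‖ ^ 2)
        - (∑ j, ∫ x, divergence W x * ‖partialDeriv j U x‖ ^ 2)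
        - ∫ x, divergence W x * (Q x * (starRingEnd ℂ) (U x)).re := by
    rw [← mul_lap_re hU hd hdc, ← integral_sub (iD (by fun_prop)) (iD (by fun_prop))]
    congr 1; ext x; simp [rhs]; ring
  -- Integration by parts in xⱼ produces W_k Re(∂ⱼU conj ∂ⱼ∂_kU). By symmetry of second derivatives
  -- this is ½ W_k ∂_k|∂ⱼU|², and a further integration by parts in x_k gives the divergence.
  have s3 : ∑ k, ∫ x, W k x * (lap U x * (starRingEnd ℂ) (partialDeriv k U x)).re
      = - (∑ j, ∑ k, ∫ x, partialDeriv j (W k) x *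
          (partialDeriv j U x * (starRingEnd ℂ) (partialDeriv k U x)).re)
        + (1 / 2) * ∑ j, ∫ x, divergence W x * ‖partialDeriv j U x‖ ^ 2 := by
    have e1 : ∀ z : ℂ, (z * (starRingEnd ℂ) z).re = ‖z‖ ^ 2 := fun z => by
      rw [Complex.mul_conj, Complex.ofReal_re, Complex.normSq_eq_norm_sq]
    have t1 : ∀ k, ∫ x, W k x * (lap U x * (starRingEnd ℂ) (partialDeriv k U x)).re
        = ∑ j, (- (∫ x, partialDeriv j (W k) x *
          (partialDeriv j U x * (starRingEnd ℂ) (partialDeriv k U x)).re)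
          + (1 / 2) * ∫ x, partialDeriv k (W k) x * ‖partialDeriv j U x‖ ^ 2) := by
      intro k
      simp only [lap, Finset.sum_mul, Complex.re_sum, Finset.mul_sum]
      rw [integral_finsetSum _ fun j _ => iW k (by fun_prop)]
      refine Finset.sum_congr rfl fun j _ => ?_
      rw [integral_mul_re_mul_conj (hW1 k) (hc k) (h1 j) (h1 k)]
      have h := integral_mul_re_mul_conj (hW1 k) (hc k) (h1 j) (h1 j) k
      simp only [e1] at h
      have e2 : ∀ x, (partialDeriv k (partialDeriv j U) x
          * (starRingEnd ℂ) (partialDeriv j U x)).re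
          = (partialDeriv j U x * (starRingEnd ℂ) (partialDeriv j (partialDeriv k U) x)).re :=
        fun x => by
          rw [partialDeriv_comm (hU.of_le (by norm_cast)) k j]; simp; ring
      have e3 : ∀ x, (partialDeriv j U x
          * (starRingEnd ℂ) (partialDeriv k (partialDeriv j U) x)).re
          = (partialDeriv j U x * (starRingEnd ℂ) (partialDeriv j (partialDeriv k U) x)).re :=
        fun x => by rw [partialDeriv_comm (hU.of_le (by norm_cast)) k j]
      simp only [e2, e3] at h
      linarith
    simp only [t1]
    rw [Finset.sum_comm]
    simp only [Finset.sum_add_distrib, Finset.sum_neg_distrib, Finset.mul_sum]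
    congr 1
    refine Finset.sum_congr rfl fun j _ => ?_
    rw [← Finset.mul_sum, ← integral_finsetSum _ fun k _ => iW1 k k (by fun_prop)]
    simp only [divergence, Finset.sum_mul]
  have s4 : ∑ k, ∫ x, W k x * (rhs U Q x * (starRingEnd ℂ) (partialDeriv k U x)).im
      = (∑ k, ∫ x, W k x * (lap U x * (starRingEnd ℂ) (partialDeriv k U x)).re)
        - ∑ k, ∫ x, W k x * (Q x * (starRingEnd ℂ) (partialDeriv k U x)).re := by
    rw [← Finset.sum_sub_distrib]
    refine Finset.sum_congr rfl fun k _ => ?_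
    rw [← integral_sub (iW k (by fun_prop)) (iW k (by fun_prop))]
    congr 1; ext x; simp [rhs]; ring
  -- The two contributions div W |∂ⱼU|², from `s2` and from twice `s3`, cancel.
  rw [s1, s2, s4, s3]
  ring

end Spatial

/-! ### Smooth cutoffs and their primitives. -/

section Cutoff

variable {f : ℝ → ℝ}

theorem IsSmoothCutoff.nonneg (hf : IsSmoothCutoff f) (l : ℝ) : 0 ≤ f l := by
  have := hf.mono (min_le_left l 0)
  rwa [hf.eq_zero _ ((min_le_right l 0).trans (by norm_num))] at this

theorem IsSmoothCutoff.le_one (hf : IsSmoothCutoff f) (l : ℝ) : f l ≤ 1 := by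
  have := hf.mono (le_max_left l 1)
  rwa [hf.eq_one _ (le_max_right l 1)] at this

/-- The cutoff stands on both sides of γ, so the current carries F². Everything below is proved for
a general cutoff and applied to this one. -/
theorem IsSmoothCutoff.sq (hf : IsSmoothCutoff f) : IsSmoothCutoff fun l => f l ^ 2 where
  smooth := hf.smooth.pow 2
  mono := fun a b h => pow_le_pow_left₀ (hf.nonneg a) (hf.mono h) 2
  eq_zero l h := by simp [hf.eq_zero l h]
  eq_one l h := by simp [hf.eq_one l h]

theorem IsSmoothCutoff.deriv_nonneg (hf : IsSmoothCutoff f) (l : ℝ) : 0 ≤ deriv f l :=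
  hf.mono.deriv_nonneg

theorem IsSmoothCutoff.hasDerivAt (hf : IsSmoothCutoff f) (l : ℝ) :
    HasDerivAt f (deriv f l) l :=
  (hf.smooth.differentiable (by simp) l).hasDerivAt

theorem IsSmoothCutoff.smooth_deriv (hf : IsSmoothCutoff f) (n : ℕ) :
    ContDiff ℝ ∞ (deriv^[n] f) :=
  hf.smooth.iterate_deriv n

theorem IsSmoothCutoff.hasDerivAt_iterate (hf : IsSmoothCutoff f) (n : ℕ) (l : ℝ) :
    HasDerivAt (deriv^[n] f) (deriv^[n + 1] f l) l := by
  rw [Function.iterate_succ_apply']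
  exact ((hf.smooth_deriv n).differentiable (by simp) l).hasDerivAt

/-- The derivatives of a cutoff vanish outside of `[1/2, 1]`. -/
theorem IsSmoothCutoff.iterate_eq_zero (hf : IsSmoothCutoff f) (n : ℕ) {l : ℝ}
    (h : l ∉ Icc (1 / 2 : ℝ) 1) : deriv^[n + 1] f l = 0 := by
  have hev : ∀ᶠ x in 𝓝 l, x ∉ Icc (1 / 2 : ℝ) 1 := isClosed_Icc.isOpen_compl.mem_nhds h
  have key : ∀ n, ∀ x ∉ Icc (1 / 2 : ℝ) 1, deriv^[n + 1] f x = 0 := by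
    intro n
    induction n with
    | zero =>
      intro x hx
      rw [zero_add, Function.iterate_one]
      have hx' : ∀ᶠ y in 𝓝 x, y ∉ Icc (1 / 2 : ℝ) 1 := isClosed_Icc.isOpen_compl.mem_nhds hx
      rcases lt_or_ge x (1 / 2) with h1 | h1
      · have : f =ᶠ[𝓝 x] fun _ => 0 := by
          filter_upwards [Iio_mem_nhds h1] with y hy using hf.eq_zero y (le_of_lt hy)
        rw [this.deriv_eq]; simp
      · have h2 : 1 < x := by
          by_contra hc
          exact hx ⟨h1, not_lt.mp hc⟩
        have : f =ᶠ[𝓝 x] fun _ => 1 := by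
          filter_upwards [Ioi_mem_nhds h2] with y hy using hf.eq_one y (le_of_lt hy)
        rw [this.deriv_eq]; simp
    | succ n ih =>
      intro x hx
      rw [Function.iterate_succ_apply']
      have : deriv^[n + 1] f =ᶠ[𝓝 x] fun _ => 0 := by
        filter_upwards [isClosed_Icc.isOpen_compl.mem_nhds hx] with y hy using ih y hy
      rw [this.deriv_eq]; simp
  exact key n l h

/-- A common bound for the first three derivatives of a cutoff. -/
theorem IsSmoothCutoff.exists_bound (hf : IsSmoothCutoff f) :
    ∃ C : ℝ, 0 ≤ C ∧ ∀ n < 3, ∀ l, |deriv^[n + 1] f l| ≤ C := by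
  have h : ∀ n, ∃ C : ℝ, ∀ l, |deriv^[n + 1] f l| ≤ C := by
    intro n
    have hc : HasCompactSupport (deriv^[n + 1] f) :=
      HasCompactSupport.intro isCompact_Icc fun x hx => hf.iterate_eq_zero n hx
    obtain ⟨C, hC⟩ := hc.exists_bound_of_continuous (hf.smooth_deriv (n + 1)).continuous
    exact ⟨C, fun l => hC l⟩
  choose C hC using h
  refine ⟨C 0 ⊔ C 1 ⊔ C 2, ?_, ?_⟩
  · exact (abs_nonneg _).trans ((hC 0 0).trans (by simp))
  · intro n hn l
    refine (hC n l).trans ?_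
    interval_cases n <;> simp

/-- The primitive of a cutoff. -/
def primitive (f : ℝ → ℝ) (l : ℝ) : ℝ := ∫ s in (0 : ℝ)..l, f s

theorem IsSmoothCutoff.hasDerivAt_primitive (hf : IsSmoothCutoff f) (l : ℝ) :
    HasDerivAt (primitive f) (f l) l :=
  intervalIntegral.integral_hasDerivAt_right (hf.smooth.continuous.intervalIntegrable _ _)
    hf.smooth.continuous.aestronglyMeasurable.stronglyMeasurableAtFilter
    hf.smooth.continuous.continuousAt

theorem IsSmoothCutoff.primitive_contDiff (hf : IsSmoothCutoff f) :
    ContDiff ℝ 1 (primitive f) := by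
  rw [contDiff_one_iff_deriv]
  refine ⟨fun l => (hf.hasDerivAt_primitive l).differentiableAt, ?_⟩
  have : deriv (primitive f) = f := funext fun l => (hf.hasDerivAt_primitive l).deriv
  rw [this]; exact hf.smooth.continuous

theorem IsSmoothCutoff.primitive_eq_zero (hf : IsSmoothCutoff f) {l : ℝ} (h : l ≤ 1 / 2) :
    primitive f l = 0 := by
  refine intervalIntegral.integral_zero_ae (.of_forall fun s hs => hf.eq_zero s ?_)
  rcases le_total 0 l with h0 | h0
  · rw [uIoc_of_le h0] at hs; exact hs.2.trans h
  · rw [uIoc_of_ge h0] at hs; exact hs.2.trans (by norm_num)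

theorem IsSmoothCutoff.primitive_nonneg (hf : IsSmoothCutoff f) {l : ℝ} (h : 0 ≤ l) :
    0 ≤ primitive f l :=
  intervalIntegral.integral_nonneg h fun s _ => hf.nonneg s

/-- By monotonicity, f on [0, l] is at most its value at l. Keeping the factor f l, rather than
bounding by l, is what controls the sign of Γ(l) - l f(l) in `primitiveDt`. -/
theorem IsSmoothCutoff.primitive_le (hf : IsSmoothCutoff f) {l : ℝ} (h : 0 ≤ l) :
    primitive f l ≤ l * f l := by
  have := intervalIntegral.integral_mono_on h (hf.smooth.continuous.intervalIntegrable 0 l)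
    (continuous_const.intervalIntegrable (μ := volume) 0 l (u := fun _ => f l))
    fun s hs => hf.mono hs.2
  simpa [primitive] using this

theorem IsSmoothCutoff.le_primitive (hf : IsSmoothCutoff f) {l : ℝ} (h : 0 ≤ l) :
    l - 1 ≤ primitive f l := by
  rcases le_total l 1 with h1 | h1
  · exact (by linarith : l - 1 ≤ 0).trans (hf.primitive_nonneg h)
  · have e : primitive f l = primitive f 1 + ∫ s in (1 : ℝ)..l, f s :=
      (intervalIntegral.integral_add_adjacent_intervals
        (hf.smooth.continuous.intervalIntegrable _ _)
        (hf.smooth.continuous.intervalIntegrable _ _)).symm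
    have e2 : ∫ s in (1 : ℝ)..l, f s = ∫ s in (1 : ℝ)..l, (1 : ℝ) := by
      refine intervalIntegral.integral_congr fun s hs => ?_
      rw [uIcc_of_le h1] at hs
      exact hf.eq_one s hs.1
    rw [e, e2]
    simp [hf.primitive_nonneg zero_le_one]

end Cutoff

/-! ### Calculus of radial functions and radial vector fields. -/

section Radial

/-- `h` vanishes on a neighbourhood of the nonpositive half line. -/
def VanishesNear (h : ℝ → ℝ) : Prop := ∃ δ > 0, ∀ r ≤ δ, h r = 0

/-- The radial vector field `h(|x|) x / |x|`. -/
def radialField (h : ℝ → ℝ) (k : Fin 3) (x : E3) : ℝ := h ‖x‖ * (x k / ‖x‖)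

variable {h : ℝ → ℝ}

theorem VanishesNear.deriv (hv : VanishesNear h) : VanishesNear (deriv h) := by
  obtain ⟨δ, hδ, hz⟩ := hv
  refine ⟨δ / 2, by positivity, fun r hr => ?_⟩
  have : h =ᶠ[𝓝 r] fun _ => 0 := by
    filter_upwards [Iio_mem_nhds (by linarith : r < δ)] with y hy using hz y (le_of_lt hy)
  rw [this.deriv_eq]; simp

theorem VanishesNear.eventually (hv : VanishesNear h) : ∀ᶠ y : E3 in 𝓝 0, h ‖y‖ = 0 := by
  obtain ⟨δ, hδ, hz⟩ := hv
  filter_upwards [Metric.ball_mem_nhds (0 : E3) hδ] with y hy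
  exact hz _ (by simpa using (mem_ball_zero_iff.mp hy).le)

theorem VanishesNear.zero (hv : VanishesNear h) : h 0 = 0 := by
  obtain ⟨δ, hδ, hz⟩ := hv
  exact hz 0 hδ.le

/-- The norm is smooth away from the origin, and near the origin the function is identically zero.
-/
theorem VanishesNear.contDiff_radial (hv : VanishesNear h) {n : WithTop ℕ∞}
    (hh : ContDiff ℝ n h) : ContDiff ℝ n (fun x : E3 => h ‖x‖) := by
  rw [contDiff_iff_contDiffAt]
  intro x
  by_cases hx : x = 0
  · subst hx
    exact (contDiffAt_const (c := (0 : ℝ))).congr_of_eventuallyEq hv.eventually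
  · exact hh.contDiffAt.comp x (contDiffAt_norm ℝ hx)

theorem VanishesNear.div (hv : VanishesNear h) : VanishesNear fun r => h r / r := by
  obtain ⟨δ, hδ, hz⟩ := hv
  exact ⟨δ, hδ, fun r hr => by simp [hz r hr]⟩

theorem VanishesNear.contDiff_div (hv : VanishesNear h) {n : WithTop ℕ∞}
    (hh : ContDiff ℝ n h) : ContDiff ℝ n fun r => h r / r := by
  obtain ⟨δ, hδ, hz⟩ := hv
  rw [contDiff_iff_contDiffAt]
  intro r
  rcases lt_or_ge r δ with hr | hr
  · refine (contDiffAt_const (c := (0 : ℝ))).congr_of_eventuallyEq ?_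
    filter_upwards [Iio_mem_nhds hr] with y hy
    simp [hz y (le_of_lt hy)]
  · exact hh.contDiffAt.div contDiffAt_id (by simp; linarith)

theorem radialField_eq (h : ℝ → ℝ) (k : Fin 3) (x : E3) :
    radialField h k x = (h ‖x‖ / ‖x‖) * x k := by
  rw [radialField]; ring

theorem contDiff_coord {n : WithTop ℕ∞} (k : Fin 3) : ContDiff ℝ n (fun x : E3 => x k) :=
  (EuclideanSpace.proj k : E3 →L[ℝ] ℝ).contDiff

theorem VanishesNear.contDiff_radialField (hv : VanishesNear h) {n : WithTop ℕ∞}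
    (hh : ContDiff ℝ n h) (k : Fin 3) : ContDiff ℝ n (radialField h k) := by
  have : radialField h k = fun x => (h ‖x‖ / ‖x‖) * x k := funext (radialField_eq h k)
  rw [this]
  exact (hv.div.contDiff_radial (hv.contDiff_div hh)).mul (contDiff_coord k)

theorem partialDeriv_coord (j k : Fin 3) (x : E3) :
    partialDeriv j (fun x : E3 => x k) x = if j = k then 1 else 0 := by
  have : HasFDerivAt (fun x : E3 => x k) (EuclideanSpace.proj k : E3 →L[ℝ] ℝ) x :=
    (EuclideanSpace.proj k : E3 →L[ℝ] ℝ).hasFDerivAt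
  rw [partialDeriv, this.fderiv]
  simp [eq_comm]

theorem partialDeriv_norm {x : E3} (hx : x ≠ 0) (j : Fin 3) :
    partialDeriv j (fun x : E3 => ‖x‖) x = x j / ‖x‖ := by
  have hn : ‖x‖ ≠ 0 := norm_ne_zero_iff.mpr hx
  have hd : DifferentiableAt ℝ (fun x : E3 => ‖x‖) x :=
    (contDiffAt_norm ℝ hx (n := 1)).differentiableAt (by norm_num)
  have h1 : HasFDerivAt (fun x : E3 => ‖x‖ ^ 2) (2 • (innerSL ℝ x)) x :=
    (hasStrictFDerivAt_norm_sq x).hasFDerivAt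
  have h2 := hd.hasFDerivAt.pow 2
  have h3 := congrArg (fun L : E3 →L[ℝ] ℝ => L (EuclideanSpace.single j 1)) (h1.unique h2)
  simp [EuclideanSpace.inner_single_right] at h3
  rw [partialDeriv, eq_div_iff hn]
  linarith

theorem VanishesNear.partialDeriv_radial (hv : VanishesNear h) (hh : Differentiable ℝ h)
    (j : Fin 3) (x : E3) :
    partialDeriv j (fun x : E3 => h ‖x‖) x = radialField (_root_.deriv h) j x := by
  by_cases hx : x = 0
  · subst hx
    have : (fun x : E3 => h ‖x‖) =ᶠ[𝓝 0] fun _ => 0 := hv.eventually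
    rw [partialDeriv, this.fderiv_eq]
    simp [radialField, hv.deriv.zero]
  · have hd : DifferentiableAt ℝ (fun x : E3 => ‖x‖) x :=
      (contDiffAt_norm ℝ hx (n := 1)).differentiableAt (by norm_num)
    have := ((hh ‖x‖).hasDerivAt.comp_hasFDerivAt x hd.hasFDerivAt).fderiv
    have h2 := partialDeriv_norm hx j
    rw [partialDeriv] at h2 ⊢
    change fderiv ℝ (h ∘ fun x : E3 => ‖x‖) x _ = _
    rw [this, radialField, ← h2]
    simp

/-- The Jacobian splits into h' times the radial projection and h/r times the tangential one. For h
≥ 0 and h' ≥ 0 it is a nonnegative matrix, which is the source of the positive commutator. -/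
theorem VanishesNear.partialDeriv_radialField (hv : VanishesNear h) (hh : ContDiff ℝ 1 h)
    (j k : Fin 3) (x : E3) :
    partialDeriv j (radialField h k) x
      = _root_.deriv h ‖x‖ * (x j / ‖x‖) * (x k / ‖x‖)
        + h ‖x‖ / ‖x‖ * ((if j = k then 1 else 0) - (x j / ‖x‖) * (x k / ‖x‖)) := by
  have e : radialField h k = fun x => (h ‖x‖ / ‖x‖) * x k := funext (radialField_eq h k)
  have hq := hv.contDiff_div hh
  rw [e, partialDeriv_mul_real
    ((hv.div.contDiff_radial hq).differentiable (by norm_num) x)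
    ((contDiff_coord (n := 1) k).differentiable (by norm_num) x), partialDeriv_coord,
    hv.div.partialDeriv_radial (hq.differentiable (by norm_num)), radialField]
  by_cases hx : x = 0
  -- At the origin both sides vanish, since every term contains a division by ‖0‖ = 0.
  · subst hx; simp
  have hn : ‖x‖ ≠ 0 := norm_ne_zero_iff.mpr hx
  have hd : _root_.deriv (fun r => h r / r) ‖x‖
      = (_root_.deriv h ‖x‖ * ‖x‖ - h ‖x‖) / ‖x‖ ^ 2 := by
    have := ((hh.differentiable (by norm_num) ‖x‖).hasDerivAt.div (hasDerivAt_id ‖x‖) hn).deriv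
    simp only [mul_one, id] at this
    exact this
  rw [hd]
  field_simp
  ring

theorem sum_coord_sq {x : E3} (hx : x ≠ 0) :
    (x 0 / ‖x‖) ^ 2 + (x 1 / ‖x‖) ^ 2 + (x 2 / ‖x‖) ^ 2 = 1 := by
  have hn : ‖x‖ ≠ 0 := norm_ne_zero_iff.mpr hx
  have := EuclideanSpace.norm_sq_eq x
  simp only [Real.norm_eq_abs, sq_abs, Fin.sum_univ_three] at this
  field_simp
  linarith

theorem abs_coord_div_norm_le (x : E3) (k : Fin 3) : |x k / ‖x‖| ≤ 1 := by
  rw [abs_div, abs_norm]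
  exact div_le_one_of_le₀ (by simpa using PiLp.norm_apply_le x k) (norm_nonneg _)

theorem VanishesNear.divergence_radialField (hv : VanishesNear h) (hh : ContDiff ℝ 1 h) (x : E3) :
    divergence (radialField h) x = _root_.deriv h ‖x‖ + 2 * (h ‖x‖ / ‖x‖) := by
  simp only [divergence, hv.partialDeriv_radialField hh, Fin.sum_univ_three, if_true]
  by_cases hx : x = 0
  · subst hx; simp [hv.deriv.zero]
  have := sum_coord_sq hx
  linear_combination (_root_.deriv h ‖x‖ - h ‖x‖ / ‖x‖) * this

theorem VanishesNear.lap_radial (hv : VanishesNear h) (hh : ContDiff ℝ 2 h) (x : E3) :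
    lap (fun x : E3 => h ‖x‖) x
      = _root_.deriv (_root_.deriv h) ‖x‖ + 2 * (_root_.deriv h ‖x‖ / ‖x‖) := by
  have hd1 : ContDiff ℝ 1 (_root_.deriv h) := by
    have := (contDiff_succ_iff_deriv (n := 1) (f := h)).mp (by exact_mod_cast hh)
    exact this.2.2
  rw [← hv.deriv.divergence_radialField hd1]
  simp only [lap, divergence]
  refine Finset.sum_congr rfl fun j _ => ?_
  congr 1
  ext y
  exact hv.partialDeriv_radial (hh.differentiable (by norm_num)) j y

/-- The divergence is d = h' + 2h/r, and the Laplacian of a radial d is d'' + 2d'/r. In dimension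
three the terms in h and h' cancel, leaving only second and third derivatives of h. -/
theorem VanishesNear.lap_divergence (hv : VanishesNear h) {h1 h2 h3 : ℝ → ℝ}
    (hh : ContDiff ℝ ∞ h) (e1 : ∀ r, HasDerivAt h (h1 r) r) (e2 : ∀ r, HasDerivAt h1 (h2 r) r)
    (e3 : ∀ r, HasDerivAt h2 (h3 r) r) (x : E3) :
    lap (divergence (radialField h)) x = h3 ‖x‖ + 4 * (h2 ‖x‖ / ‖x‖) := by
  have d1 : _root_.deriv h = h1 := funext fun r => (e1 r).deriv
  have d2 : _root_.deriv h1 = h2 := funext fun r => (e2 r).deriv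
  have d3 : _root_.deriv h2 = h3 := funext fun r => (e3 r).deriv
  have hv1 : VanishesNear h1 := d1 ▸ hv.deriv
  have hv2 : VanishesNear h2 := d2 ▸ hv1.deriv
  have hv3 : VanishesNear h3 := d3 ▸ hv2.deriv
  have hh1 : ContDiff ℝ ∞ h1 := by
    rw [← d1]; exact (contDiff_infty_iff_deriv.mp hh).2
  let d : ℝ → ℝ := fun r => h1 r + 2 * (h r / r)
  have hdv : VanishesNear d := by
    obtain ⟨δ, hδ, hz⟩ := hv
    obtain ⟨δ', hδ', hz'⟩ := hv1
    refine ⟨min δ δ', lt_min hδ hδ', fun r hr => ?_⟩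
    simp [d, hz r (hr.trans (min_le_left _ _)), hz' r (hr.trans (min_le_right _ _))]
  have hdc : ContDiff ℝ ∞ d := hh1.add (contDiff_const.mul (hv.contDiff_div hh))
  have e : divergence (radialField h) = fun x => d ‖x‖ := by
    ext y
    rw [hv.divergence_radialField (hh.of_le (by norm_cast)), d1]
  rw [e, hdv.lap_radial (hdc.of_le (by norm_cast))]
  by_cases hx : x = 0
  · subst hx
    simp [hdv.deriv.deriv.zero, hv3.zero]
  have hn : ‖x‖ ≠ 0 := norm_ne_zero_iff.mpr hx
  have D1 : ∀ r ≠ 0, HasDerivAt d (h2 r + 2 * ((h1 r * r - h r * 1) / r ^ 2)) r := fun r hr =>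
    (e2 r).add (((e1 r).div (hasDerivAt_id r) hr).const_mul 2)
  have D2 : HasDerivAt (_root_.deriv d) (h3 ‖x‖ + 2 * (((h2 ‖x‖ * ‖x‖ + h1 ‖x‖ * 1
      - h1 ‖x‖ * 1) * ‖x‖ ^ 2 - (h1 ‖x‖ * ‖x‖ - h ‖x‖ * 1) * (2 * ‖x‖)) / (‖x‖ ^ 2) ^ 2)) ‖x‖ := by
    have : _root_.deriv d =ᶠ[𝓝 ‖x‖] fun r => h2 r + 2 * ((h1 r * r - h r * 1) / r ^ 2) := by
      filter_upwards [isOpen_ne.mem_nhds hn] with r hr using (D1 r hr).deriv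
    refine HasDerivAt.congr_of_eventuallyEq ?_ this
    refine (e3 _).add (HasDerivAt.const_mul 2 (HasDerivAt.div ?_ ?_ (pow_ne_zero 2 hn)))
    · exact ((e2 _).mul (hasDerivAt_id _)).sub ((e1 _).mul_const 1)
    · simpa using hasDerivAt_pow 2 ‖x‖
  rw [D2.deriv, (D1 _ hn).deriv]
  field_simp
  ring

theorem radialField_hasCompactSupport {R : ℝ} (hz : ∀ r, R ≤ r → h r = 0) (k : Fin 3) :
    HasCompactSupport (radialField h k) :=
  HasCompactSupport.intro (isCompact_closedBall (0 : E3) R) fun x hx => by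
    rw [radialField, hz _ (not_le.mp (by simpa using hx)).le, zero_mul]

theorem abs_radialField_le {B : ℝ} {x : E3} (hB : |h ‖x‖| ≤ B) (k : Fin 3) :
    |radialField h k x| ≤ B := by
  rw [radialField, abs_mul]
  exact (mul_le_of_le_one_right (abs_nonneg _) (abs_coord_div_norm_le x k)).trans hB

end Radial

/-! ### The window between the scales m and R. -/

section Window

variable {f : ℝ → ℝ} {m R : ℝ}

/-- The `n`-th derivative of the window `f(r / m) - f(r / R)`, a smooth cutoff to
`m ≲ r ≲ R`. -/
def window (f : ℝ → ℝ) (m R : ℝ) (n : ℕ) (r : ℝ) : ℝ :=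
  deriv^[n] f (r / m) / m ^ n - deriv^[n] f (r / R) / R ^ n

theorem IsSmoothCutoff.hasDerivAt_window (hf : IsSmoothCutoff f) (m R : ℝ) (n : ℕ) (r : ℝ) :
    HasDerivAt (window f m R n) (window f m R (n + 1) r) r := by
  have h : ∀ m : ℝ, HasDerivAt (fun r => deriv^[n] f (r / m) / m ^ n)
      (deriv^[n + 1] f (r / m) / m ^ (n + 1)) r := by
    intro m
    have h1 := (hf.hasDerivAt_iterate n (r / m)).comp r ((hasDerivAt_id r).div_const m)
    have h2 := h1.div_const (m ^ n)
    have e : deriv^[n + 1] f (id r / m) * (1 / m) / m ^ n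
        = deriv^[n + 1] f (r / m) / m ^ (n + 1) := by
      rw [pow_succ, id]; field_simp
    exact e ▸ h2
  exact (h m).sub (h R)

theorem IsSmoothCutoff.window_contDiff (hf : IsSmoothCutoff f) (m R : ℝ) (n : ℕ) :
    ContDiff ℝ ∞ (window f m R n) := by
  have h : ∀ m : ℝ, ContDiff ℝ ∞ (fun r => deriv^[n] f (r / m) / m ^ n) := fun m =>
    ((hf.smooth_deriv n).comp (contDiff_id.div_const m)).div_const _
  exact (h m).sub (h R)

theorem window_zero (f : ℝ → ℝ) (m R r : ℝ) : window f m R 0 r = f (r / m) - f (r / R) := by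
  simp [window]

theorem IsSmoothCutoff.window_eq_zero_of_le (hf : IsSmoothCutoff f) (hm : 0 < m) (hR : m ≤ R)
    {r : ℝ} (hr : r ≤ m / 2) : window f m R 0 r = 0 := by
  rw [window_zero, hf.eq_zero, hf.eq_zero, sub_zero]
  · rw [div_le_iff₀ (hm.trans_le hR)]; linarith
  · rw [div_le_iff₀ hm]; linarith

theorem IsSmoothCutoff.window_eq_zero_of_ge (hf : IsSmoothCutoff f) (hm : 0 < m) (hR : m ≤ R)
    {r : ℝ} (hr : R ≤ r) : window f m R 0 r = 0 := by
  rw [window_zero, hf.eq_one, hf.eq_one, sub_self]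
  · rwa [le_div_iff₀ (hm.trans_le hR), one_mul]
  · rw [le_div_iff₀ hm, one_mul]; exact hR.trans hr

theorem IsSmoothCutoff.window_nonneg (hf : IsSmoothCutoff f) (hm : 0 < m) (hR : m ≤ R)
    {r : ℝ} (hr : 0 ≤ r) : 0 ≤ window f m R 0 r := by
  rw [window_zero, sub_nonneg]
  exact hf.mono (div_le_div_of_nonneg_left hr hm hR)

theorem IsSmoothCutoff.window_le_one (hf : IsSmoothCutoff f) (m R r : ℝ) :
    window f m R 0 r ≤ 1 := by
  rw [window_zero]
  linarith [hf.le_one (r / m), hf.nonneg (r / R)]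

theorem IsSmoothCutoff.abs_window_le_one (hf : IsSmoothCutoff f) (hm : 0 < m) (hR : m ≤ R)
    {r : ℝ} (hr : 0 ≤ r) : |window f m R 0 r| ≤ 1 := by
  rw [abs_of_nonneg (hf.window_nonneg hm hR hr)]
  exact hf.window_le_one m R r

theorem IsSmoothCutoff.vanishesNear_window (hf : IsSmoothCutoff f) (hm : 0 < m) (hR : m ≤ R) :
    VanishesNear (window f m R 0) :=
  ⟨m / 2, by positivity, fun _ hr => hf.window_eq_zero_of_le hm hR hr⟩

/-- Each edge contributes C over a power of its scale, and the outer scale R is at least m. -/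
theorem abs_window_le {C : ℝ} (hC : ∀ n < 3, ∀ l, |deriv^[n + 1] f l| ≤ C) (hm : 0 < m)
    (hR : m ≤ R) {n : ℕ} (hn : n < 3) (r : ℝ) :
    |window f m R (n + 1) r| ≤ 2 * C / m ^ (n + 1) := by
  have hC0 : 0 ≤ C := (abs_nonneg _).trans (hC n hn 0)
  have hR0 : 0 < R := hm.trans_le hR
  have h1 : |deriv^[n + 1] f (r / m) / m ^ (n + 1)| ≤ C / m ^ (n + 1) := by
    rw [abs_div, abs_of_pos (pow_pos hm _)]
    gcongr
    exact hC n hn _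
  have h2 : |deriv^[n + 1] f (r / R) / R ^ (n + 1)| ≤ C / m ^ (n + 1) := by
    rw [abs_div, abs_of_pos (pow_pos hR0 _)]
    gcongr
    exact hC n hn _
  calc _ ≤ _ := abs_sub _ _
    _ ≤ C / m ^ (n + 1) + C / m ^ (n + 1) := add_le_add h1 h2
    _ = _ := by ring

theorem IsSmoothCutoff.window_succ_eq_zero (hf : IsSmoothCutoff f) (hm : 0 < m) (hR : m ≤ R)
    (n : ℕ) {r : ℝ} (hr : r < m / 2) : window f m R (n + 1) r = 0 := by
  rw [window, hf.iterate_eq_zero, hf.iterate_eq_zero]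
  · simp
  · intro h
    have := h.1
    rw [le_div_iff₀ (hm.trans_le hR)] at this; linarith
  · intro h
    have := h.1
    rw [le_div_iff₀ hm] at this; linarith

/-- The window vanishes for r ≤ m/2, so w/r ≤ 2/m; the divergence w' + 2w/r is then at most 2C/m +
4/m. -/
theorem IsSmoothCutoff.abs_divergence_window_le (hf : IsSmoothCutoff f) {C : ℝ}
    (hC : ∀ n < 3, ∀ l, |deriv^[n + 1] f l| ≤ C) (hm : 0 < m) (hR : m ≤ R) (x : E3) :
    |divergence (radialField (window f m R 0)) x| ≤ (2 * C + 4) / m := by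
  rw [(hf.vanishesNear_window hm hR).divergence_radialField
    ((hf.window_contDiff m R 0).of_le (by norm_cast)), (hf.hasDerivAt_window m R 0 _).deriv]
  have h1 := abs_window_le hC hm hR (n := 0) (by norm_num) ‖x‖
  have h2 : |window f m R 0 ‖x‖ / ‖x‖| ≤ 2 / m := by
    rcases le_total ‖x‖ (m / 2) with h | h
    · rw [hf.window_eq_zero_of_le hm hR h]; simp; positivity
    · have hx : 0 < ‖x‖ := by linarith
      rw [abs_div, abs_norm, div_le_div_iff₀ hx hm]
      nlinarith [hf.abs_window_le_one hm hR hx.le]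
  calc _ ≤ |window f m R (0 + 1) ‖x‖| + |2 * (window f m R 0 ‖x‖ / ‖x‖)| := abs_add_le _ _
    _ ≤ 2 * C / m ^ (0 + 1) + 2 * (2 / m) := by
        rw [abs_mul, abs_two]; gcongr
    _ = _ := by field_simp; ring

/-- For w''' + 4w''/r, with w'' supported in r ≥ m/2, the count is 2C/m³ + 4 · (2C/m²) · (2/m) =
18C/m³. -/
theorem IsSmoothCutoff.abs_lap_divergence_window_le (hf : IsSmoothCutoff f) {C : ℝ}
    (hC : ∀ n < 3, ∀ l, |deriv^[n + 1] f l| ≤ C) (hm : 0 < m) (hR : m ≤ R) (x : E3) :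
    |lap (divergence (radialField (window f m R 0))) x| ≤ 18 * C / m ^ 3 := by
  have hC0 : 0 ≤ C := (abs_nonneg _).trans (hC 0 (by norm_num) 0)
  rw [(hf.vanishesNear_window hm hR).lap_divergence (hf.window_contDiff m R 0)
    (hf.hasDerivAt_window m R 0) (hf.hasDerivAt_window m R 1) (hf.hasDerivAt_window m R 2)]
  have h1 := abs_window_le hC hm hR (n := 2) (by norm_num) ‖x‖
  have h2 : |window f m R 2 ‖x‖ / ‖x‖| ≤ 2 * C / m ^ 2 * (2 / m) := by
    rcases lt_or_ge ‖x‖ (m / 2) with h | h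
    · rw [hf.window_succ_eq_zero hm hR 1 h]; simp; positivity
    · have hx : 0 < ‖x‖ := by linarith
      rw [abs_div, abs_norm, div_eq_mul_inv]
      have := abs_window_le hC hm hR (n := 1) (by norm_num) ‖x‖
      gcongr
      rw [inv_le_comm₀ hx (by positivity), inv_div]; exact h
  calc _ ≤ |window f m R (2 + 1) ‖x‖| + |4 * (window f m R 2 ‖x‖ / ‖x‖)| := abs_add_le _ _
    _ ≤ 2 * C / m ^ (2 + 1) + 4 * (2 * C / m ^ 2 * (2 / m)) := by
        rw [abs_mul, abs_of_nonneg (by norm_num : (0 : ℝ) ≤ 4)]; gcongr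
    _ = _ := by field_simp; ring

set_option maxHeartbeats 1000000 in
/-- Positivity of the commutator: the contribution of the gradient of the window dominates the
one of its time derivative, up to small errors. -/
theorem IsSmoothCutoff.window_positivity (hf : IsSmoothCutoff f) {C : ℝ}
    (hC : ∀ n < 3, ∀ l, |deriv^[n + 1] f l| ≤ C) (hm : 0 < m) (hR : m ≤ R) (m' : ℝ) (x : E3)
    (ξ : Fin 3 → ℂ) (u : ℂ) :
    -(C * m' ^ 2 / m) * ‖u‖ ^ 2 - 2 * C / R * ∑ j, ‖ξ j‖ ^ 2
      ≤ 2 * (∑ j, ∑ k, partialDeriv j (radialField (window f m R 0) k) x *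
          (ξ j * (starRingEnd ℂ) (ξ k)).re)
        + ∑ k, radialField (fun r => -(deriv f (r / m) * (r * m' / m ^ 2))) k x *
          (ξ k * (starRingEnd ℂ) u).im := by
  have hC0 : 0 ≤ C := (abs_nonneg _).trans (hC 0 (by norm_num) 0)
  have hR0 : 0 < R := hm.trans_le hR
  simp only [(hf.vanishesNear_window hm hR).partialDeriv_radialField
    ((hf.window_contDiff m R 0).of_le (by norm_cast)), (hf.hasDerivAt_window m R 0 _).deriv,
    Fin.sum_univ_three, radialField]
  by_cases hx : x = 0
  · subst hx
    have h0 : window f m R (0 + 1) 0 = 0 := hf.window_succ_eq_zero hm hR 0 (by positivity)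
    have h1 : 0 ≤ C * m' ^ 2 / m * ‖u‖ ^ 2 := by positivity
    have h2 : 0 ≤ 2 * C / R * (‖ξ 0‖ ^ 2 + ‖ξ 1‖ ^ 2 + ‖ξ 2‖ ^ 2) := by positivity
    simp [h0]
    linarith
  have hn1 := sum_coord_sq hx
  set r := ‖x‖
  have hr : 0 < r := norm_pos_iff.mpr hx
  set n0 := x 0 / r
  set n1 := x 1 / r
  set n2 := x 2 / r
  -- the radial derivative
  set z : ℂ := n0 * ξ 0 + n1 * ξ 1 + n2 * ξ 2 with hz
  set w := window f m R 0 r / r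
  have hw : 0 ≤ w := div_nonneg (hf.window_nonneg hm hR hr.le) hr.le
  set A := deriv f (r / m) with hA
  set B := deriv f (r / R)
  have hA0 : 0 ≤ A := hf.deriv_nonneg _
  have hAC : A ≤ C := (le_abs_self _).trans (hC 0 (by norm_num) _)
  have hB0 : 0 ≤ B := hf.deriv_nonneg _
  have hBC : B ≤ C := (le_abs_self _).trans (hC 0 (by norm_num) _)
  have hw1 : window f m R (0 + 1) r = A / m - B / R := by simp [window, A, B]
  have nsq : ∀ y : ℂ, ‖y‖ ^ 2 = y.re ^ 2 + y.im ^ 2 := fun y => by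
    rw [← Complex.normSq_eq_norm_sq, Complex.normSq_apply]; ring
  have hzre : z.re = n0 * (ξ 0).re + n1 * (ξ 1).re + n2 * (ξ 2).re := by simp [hz]
  have hzim : z.im = n0 * (ξ 0).im + n1 * (ξ 1).im + n2 * (ξ 2).im := by simp [hz]
  -- Cauchy–Schwarz against the unit vector x/|x|, so that the radial derivative z is dominated by
  -- the full gradient.
  have cs : ∀ a b c : ℝ, (n0 * a + n1 * b + n2 * c) ^ 2 ≤ a ^ 2 + b ^ 2 + c ^ 2 := by
    intro a b c
    have : a ^ 2 + b ^ 2 + c ^ 2 = (n0 ^ 2 + n1 ^ 2 + n2 ^ 2) * (a ^ 2 + b ^ 2 + c ^ 2) := by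
      rw [hn1, one_mul]
    rw [this]
    nlinarith [sq_nonneg (n0 * b - n1 * a), sq_nonneg (n0 * c - n2 * a),
      sq_nonneg (n1 * c - n2 * b)]
  set S := ‖ξ 0‖ ^ 2 + ‖ξ 1‖ ^ 2 + ‖ξ 2‖ ^ 2 with hS
  have hzS : ‖z‖ ^ 2 ≤ S := by
    rw [hS, nsq, nsq, nsq, nsq, hzre, hzim]
    linarith [cs (ξ 0).re (ξ 1).re (ξ 2).re, cs (ξ 0).im (ξ 1).im (ξ 2).im]
  -- Where A = f'(r/m) is nonzero one has r/m ≤ 1, so the factor r in the time derivative costs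
  -- nothing.
  have hAr : A * (r / m) ≤ A := by
    rcases le_or_gt (r / m) 1 with h | h
    · exact mul_le_of_le_one_right hA0 h
    · have : A = 0 := hf.iterate_eq_zero 0 (fun hh => absurd hh.2 (not_le.mpr h))
      rw [this]; simp
  have hu : |(z * (starRingEnd ℂ) u).im| ≤ ‖z‖ * ‖u‖ := by
    refine (Complex.abs_im_le_norm _).trans ?_
    rw [norm_mul, RCLike.norm_conj]
  -- the time derivative is absorbed
  have hmain : -(C * m' ^ 2 / m) * ‖u‖ ^ 2 ≤ 2 * (A / m * ‖z‖ ^ 2)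
      - A * (r * m' / m ^ 2) * (z * (starRingEnd ℂ) u).im := by
    have h1 : A * (r * m' / m ^ 2) * (z * (starRingEnd ℂ) u).im
        ≤ A / m * (|m'| * (‖z‖ * ‖u‖)) := by
      have e : A * (r * m' / m ^ 2) * (z * (starRingEnd ℂ) u).im
          = (A * (r / m)) / m * (m' * (z * (starRingEnd ℂ) u).im) := by field_simp
      rw [e]
      have h2 : m' * (z * (starRingEnd ℂ) u).im ≤ |m'| * (‖z‖ * ‖u‖) := by
        refine (le_abs_self _).trans ?_
        rw [abs_mul]; gcongr
      calc _ ≤ (A * (r / m)) / m * (|m'| * (‖z‖ * ‖u‖)) := by gcongr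
        _ ≤ _ := by gcongr
    have h3 : A / m * (|m'| * (‖z‖ * ‖u‖)) ≤ 2 * (A / m * ‖z‖ ^ 2) + A / m * (m' ^ 2 * ‖u‖ ^ 2) := by
      -- Young's inequality, with the weight 2 on ‖z‖² that the gradient term makes available.
      have h4 : |m'| * (‖z‖ * ‖u‖) ≤ 2 * ‖z‖ ^ 2 + m' ^ 2 * ‖u‖ ^ 2 := by
        nlinarith [sq_nonneg (‖z‖ - |m'| * ‖u‖), sq_abs m', norm_nonneg z, norm_nonneg u,
          abs_nonneg m', sq_nonneg (‖z‖), sq_nonneg (|m'| * ‖u‖)]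
      have h5 : 0 ≤ A / m := by positivity
      nlinarith
    have h6 : A / m * (m' ^ 2 * ‖u‖ ^ 2) ≤ C * m' ^ 2 / m * ‖u‖ ^ 2 := by
      have e : C * m' ^ 2 / m * ‖u‖ ^ 2 = C / m * (m' ^ 2 * ‖u‖ ^ 2) := by ring
      rw [e]; gcongr
    linarith
  -- The outer edge, where the window decreases, is the only place where the gradient term has the
  -- wrong sign; its size is O(1/R).
  have hBR : B / R * ‖z‖ ^ 2 ≤ C / R * S := by gcongr
  have hwS : 0 ≤ w * (S - ‖z‖ ^ 2) := mul_nonneg hw (by linarith)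
  -- The quadratic form equals w' |z|² plus w/r times the tangential part S - |z|² of the gradient.
  have hfin : -(C * m' ^ 2 / m) * ‖u‖ ^ 2 - 2 * C / R * S
      ≤ 2 * ((A / m - B / R) * ‖z‖ ^ 2 + w * (S - ‖z‖ ^ 2))
      - A * (r * m' / m ^ 2) * (z * (starRingEnd ℂ) u).im := by
    have : 2 * C / R * S = 2 * (C / R * S) := by ring
    rw [this]
    linarith
  refine hfin.trans (le_of_eq ?_)
  rw [hw1]
  simp only [hS, nsq, Complex.mul_re, Complex.mul_im, Complex.conj_re,
    Complex.conj_im, hz, Complex.add_re, Complex.add_im, Complex.ofReal_re,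
    Complex.ofReal_im, if_true, Fin.reduceEq, if_false]
  ring

end Window

/-! ### Time evolution of weighted products. -/

section Evolution

/-- `A` is the time primitive of `A'` on `[s, t]`, with `A'` controlled by an integrable function
of time on the compact set `S`. -/
structure IsPrimitiveOn (A A' : ℝ → E3 → ℂ) (s t : ℝ) (S : Set E3) : Prop where
  cont : ContinuousOn (fun p : ℝ × E3 => A p.1 p.2) (Icc s t ×ˢ univ)
  meas : AEStronglyMeasurable (fun p : ℝ × E3 => A' p.1 p.2)
    ((volume.restrict (Ioc s t)).prod volume)
  meas_slice : ∀ y, AEStronglyMeasurable (fun τ => A' τ y) (volume.restrict (Ioc s t))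
  bound : ∃ j : ℝ → ℝ, IntegrableOn j (Ioc s t) volume ∧
    ∀ᵐ τ ∂volume.restrict (Ioc s t), ∀ y ∈ S, ‖A' τ y‖ ≤ j τ
  eq : ∀ y ∈ S, ∀ r ∈ Icc s t, A r y - A s y = ∫ τ in s..r, A' τ y

variable {A A' B B' : ℝ → E3 → ℂ} {s t : ℝ} {S : Set E3}

theorem IsPrimitiveOn.intervalIntegrable (h : IsPrimitiveOn A A' s t S) (hst : s ≤ t) {y : E3}
    (hy : y ∈ S) : IntervalIntegrable (fun τ => A' τ y) volume s t := by
  obtain ⟨j, hj, hb⟩ := h.bound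
  rw [intervalIntegrable_iff_integrableOn_Ioc_of_le hst]
  exact hj.mono' (h.meas_slice y) (hb.mono fun τ hτ => hτ y hy)

theorem IsPrimitiveOn.conj (h : IsPrimitiveOn A A' s t S) :
    IsPrimitiveOn (fun τ y => (starRingEnd ℂ) (A τ y)) (fun τ y => (starRingEnd ℂ) (A' τ y))
      s t S where
  cont := Complex.continuous_conj.comp_continuousOn h.cont
  meas := Complex.continuous_conj.comp_aestronglyMeasurable h.meas
  meas_slice y := Complex.continuous_conj.comp_aestronglyMeasurable (h.meas_slice y)
  bound := by
    obtain ⟨j, hj, hb⟩ := h.bound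
    exact ⟨j, hj, hb.mono fun τ hτ y hy => by simpa using hτ y hy⟩
  eq y hy r hr := by
    rw [← map_sub, h.eq y hy r hr, intervalIntegral, intervalIntegral, map_sub,
      ← integral_conj, ← integral_conj]

theorem integrable_prod_of_bound {H : ℝ → E3 → ℂ} {j : ℝ → ℝ} (hS : IsCompact S)
    (hm : AEStronglyMeasurable (fun p : ℝ × E3 => H p.1 p.2)
      ((volume.restrict (Ioc s t)).prod volume))
    (hj : IntegrableOn j (Ioc s t) volume)
    (hb : ∀ᵐ τ ∂volume.restrict (Ioc s t), ∀ y ∈ S, ‖H τ y‖ ≤ j τ)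
    (hz : ∀ τ ∈ Ioc s t, ∀ y ∉ S, H τ y = 0) :
    Integrable (fun p : ℝ × E3 => H p.1 p.2) ((volume.restrict (Ioc s t)).prod volume) := by
  have hi : Integrable (S.indicator fun _ => (1 : ℝ)) (volume : Measure E3) :=
    (integrable_indicator_iff hS.measurableSet).mpr (integrableOn_const hS.measure_lt_top.ne)
  refine (Integrable.mul_prod hj hi).mono' hm ?_
  have h2 : ∀ᵐ τ ∂volume.restrict (Ioc s t), ∀ y, ‖H τ y‖ ≤ j τ * S.indicator (fun _ => (1 : ℝ)) y := by
    filter_upwards [hb, ae_restrict_mem measurableSet_Ioc] with τ h1 h2 y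
    by_cases hy : y ∈ S
    · simpa [hy] using h1 y hy
    · simp [hy, hz τ h2 y hy]
  exact Measure.quasiMeasurePreserving_fst.ae h2 |>.mono fun p hp => hp p.2

/-- The product rule in time, integrated in space. -/
theorem weighted_evolution (hst : s ≤ t) (hS : IsCompact S) {k k' : ℝ → E3 → ℂ}
    (hk : ∀ y, ∀ τ ∈ Icc s t, HasDerivAt (fun τ => k τ y) (k' τ y) τ)
    (hkc : ContinuousOn (fun p : ℝ × E3 => k p.1 p.2) (Icc s t ×ˢ univ))
    (hkc' : ContinuousOn (fun p : ℝ × E3 => k' p.1 p.2) (Icc s t ×ˢ univ))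
    (hz : ∀ τ ∈ Icc s t, ∀ y ∉ S, k τ y = 0) (hz' : ∀ τ ∈ Icc s t, ∀ y ∉ S, k' τ y = 0)
    (hA : IsPrimitiveOn A A' s t S) (hB : IsPrimitiveOn B B' s t S) :
    Integrable (fun p : ℝ × E3 => k' p.1 p.2 * A p.1 p.2 * B p.1 p.2
        + k p.1 p.2 * (A' p.1 p.2 * B p.1 p.2 + A p.1 p.2 * B' p.1 p.2))
      ((volume.restrict (Ioc s t)).prod volume) ∧
    (∫ y, k t y * A t y * B t y) - (∫ y, k s y * A s y * B s y)
      = ∫ τ in s..t, ∫ y, (k' τ y * A τ y * B τ y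
        + k τ y * (A' τ y * B τ y + A τ y * B' τ y)) := by
  have hmeas : ∀ {g : ℝ × E3 → ℂ}, ContinuousOn g (Icc s t ×ˢ univ) →
      AEStronglyMeasurable g ((volume.restrict (Ioc s t)).prod volume) := by
    intro g hg
    have : ((volume : Measure ℝ).restrict (Ioc s t)).prod (volume : Measure E3)
        = ((volume : Measure ℝ).prod volume).restrict (Ioc s t ×ˢ univ) := by
      rw [← Measure.prod_restrict, Measure.restrict_univ]
    rw [this]
    exact (hg.mono (prod_mono Ioc_subset_Icc_self subset_rfl)).aestronglyMeasurable
      (measurableSet_Ioc.prod MeasurableSet.univ)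
  have hbd : ∀ {g : ℝ × E3 → ℂ}, ContinuousOn g (Icc s t ×ˢ univ) →
      ∃ C, 0 ≤ C ∧ ∀ τ ∈ Icc s t, ∀ y ∈ S, ‖g (τ, y)‖ ≤ C := by
    intro g hg
    obtain ⟨C, hC⟩ := (isCompact_Icc.prod hS).exists_bound_of_continuousOn
      (hg.mono (prod_mono subset_rfl (subset_univ S)))
    exact ⟨max C 0, le_max_right _ _, fun τ hτ y hy =>
      (hC (τ, y) ⟨hτ, hy⟩).trans (le_max_left _ _)⟩
  have hslice : ∀ {g : ℝ × E3 → ℂ}, ContinuousOn g (Icc s t ×ˢ univ) → ∀ τ ∈ Icc s t,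
      Continuous fun y => g (τ, y) := fun hg τ hτ =>
    hg.comp_continuous (by fun_prop) fun y => ⟨hτ, mem_univ _⟩
  obtain ⟨jA, hjA, hbA⟩ := hA.bound
  obtain ⟨jB, hjB, hbB⟩ := hB.bound
  obtain ⟨Ck, hCk0, hCk⟩ := hbd hkc
  obtain ⟨Ck', hCk0', hCk'⟩ := hbd hkc'
  obtain ⟨CA, hCA0, hCA⟩ := hbd hA.cont
  obtain ⟨CB, hCB0, hCB⟩ := hbd hB.cont
  have hint : Integrable (fun p : ℝ × E3 => k' p.1 p.2 * A p.1 p.2 * B p.1 p.2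
        + k p.1 p.2 * (A' p.1 p.2 * B p.1 p.2 + A p.1 p.2 * B' p.1 p.2))
      ((volume.restrict (Ioc s t)).prod volume) := by
    refine integrable_prod_of_bound (H := fun τ y => k' τ y * A τ y * B τ y
        + k τ y * (A' τ y * B τ y + A τ y * B' τ y))
        (j := fun τ => Ck' * CA * CB + Ck * (jA τ * CB + CA * jB τ)) hS ?_ ?_ ?_ ?_
    · exact (((hmeas hkc').mul (hmeas hA.cont)).mul (hmeas hB.cont)).add
        ((hmeas hkc).mul ((hA.meas.mul (hmeas hB.cont)).add ((hmeas hA.cont).mul hB.meas)))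
    · have hc : IntegrableOn (fun _ : ℝ => Ck' * CA * CB) (Ioc s t) volume :=
        integrableOn_const (by simp)
      exact hc.add (((hjA.mul_const CB).add (hjB.const_mul CA)).const_mul Ck)
    · filter_upwards [hbA, hbB, ae_restrict_mem measurableSet_Ioc] with τ h1 h2 h3 y hy
      have h3' := Ioc_subset_Icc_self h3
      have a1 := hCk τ h3' y hy
      have a2 := hCk' τ h3' y hy
      have a3 := hCA τ h3' y hy
      have a4 := hCB τ h3' y hy
      have a5 := h1 y hy
      have a6 := h2 y hy
      have hjA0 : 0 ≤ jA τ := (norm_nonneg _).trans a5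
      simp only at a1 a2 a3 a4
      calc _ ≤ ‖k' τ y * A τ y * B τ y‖ + ‖k τ y * (A' τ y * B τ y + A τ y * B' τ y)‖ :=
            norm_add_le _ _
        _ ≤ ‖k' τ y‖ * ‖A τ y‖ * ‖B τ y‖
            + ‖k τ y‖ * (‖A' τ y‖ * ‖B τ y‖ + ‖A τ y‖ * ‖B' τ y‖) := by
            rw [norm_mul, norm_mul, norm_mul]
            gcongr
            refine (norm_add_le _ _).trans ?_
            rw [norm_mul, norm_mul]
        _ ≤ _ := by gcongr
    · intro τ hτ y hy
      simp [hz τ (Ioc_subset_Icc_self hτ) y hy, hz' τ (Ioc_subset_Icc_self hτ) y hy]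
  refine ⟨hint, ?_⟩
  have hs : s ∈ Icc s t := ⟨le_rfl, hst⟩
  have ht : t ∈ Icc s t := ⟨hst, le_rfl⟩
  have hI : ∀ τ ∈ Icc s t, Integrable (fun y => k τ y * A τ y * B τ y) volume := by
    intro τ hτ
    refine (((hslice hkc τ hτ).mul (hslice hA.cont τ hτ)).mul
      (hslice hB.cont τ hτ)).integrable_of_hasCompactSupport ?_
    exact HasCompactSupport.intro hS fun y hy => by simp [hz τ hτ y hy]
  rw [← integral_sub (hI t ht) (hI s hs), intervalIntegral.integral_of_le hst]
  -- Fubini reduces the claim to a fixed point y, where the one-dimensional product rule is applied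
  -- to k A and then to (k A) B.
  rw [integral_integral_swap (f := fun τ y => k' τ y * A τ y * B τ y
        + k τ y * (A' τ y * B τ y + A τ y * B' τ y)) hint]
  refine integral_congr_ae (.of_forall fun y => ?_)
  simp only
  rw [← intervalIntegral.integral_of_le hst]
  by_cases hy : y ∈ S
  · have hA1 := hA.intervalIntegrable hst hy
    have hB1 := hB.intervalIntegrable hst hy
    have sub : ∀ {a : ℝ → ℂ}, IntervalIntegrable a volume s t → ∀ r ∈ Icc s t,
        IntervalIntegrable a volume s r := fun h r hr =>
      h.mono_set (by rw [uIcc_of_le hst, uIcc_of_le hr.1]; exact Icc_subset_Icc_right hr.2)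
    have hkcy : ContinuousOn (fun τ => k' τ y) (uIcc s t) := by
      rw [uIcc_of_le hst]
      exact hkc'.comp (f := fun τ => (τ, y)) (by fun_prop) fun τ hτ => ⟨hτ, mem_univ _⟩
    have hk1 : IntervalIntegrable (fun τ => k' τ y) volume s t := hkcy.intervalIntegrable
    have hk2 : ∀ r ∈ Icc s t, k r y - k s y = ∫ τ in s..r, k' τ y := by
      intro r hr
      refine (intervalIntegral.integral_eq_sub_of_hasDerivAt (f := fun τ => k τ y) (fun τ hτ => ?_)
        (sub hk1 r hr)).symm
      rw [uIcc_of_le hr.1] at hτ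
      exact hk y τ ⟨hτ.1, hτ.2.trans hr.2⟩
    have h1 := fun r (hr : r ∈ Icc s t) => integral_mul_add_mul hr.1 (sub hk1 r hr) (sub hA1 r hr)
      (fun r' hr' => hk2 r' ⟨hr'.1, hr'.2.trans hr.2⟩)
      (fun r' hr' => hA.eq y hy r' ⟨hr'.1, hr'.2.trans hr.2⟩)
    have h2 := integral_mul_add_mul (a := fun τ => k τ y * A τ y) hst (h1 t ht).1 hB1
      (fun r hr => (h1 r hr).2) (fun r hr => hB.eq y hy r hr)
    rw [h2.2]
    refine intervalIntegral.integral_congr fun τ _ => ?_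
    ring
  · have e : ∫ τ in s..t, (k' τ y * A τ y * B τ y
        + k τ y * (A' τ y * B τ y + A τ y * B' τ y)) = ∫ τ in s..t, (0 : ℂ) := by
      refine intervalIntegral.integral_congr fun τ hτ => ?_
      rw [uIcc_of_le hst] at hτ
      simp [hz τ hτ y hy, hz' τ hτ y hy]
    rw [e]
    simp [hz t ht y hy, hz s hs y hy]

end Evolution

/-! ### The mollified Schrödinger equation. -/

section Equation

/-- A curve `φ` bounded by `K` in `H¹` and continuous in `L²`, with gradient `D`, solving
`∂ₜ φ = i Δ φ - i J` weakly with a locally integrable source `J`. -/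
structure IsEvolution (φ J : ℝ → E3 → ℂ) (D : ℝ → Fin 3 → E3 → ℂ) (K : ℝ) : Prop where
  isH1 : ∀ t, 0 ≤ t → IsH1 (φ t) (D t) K
  cont : ∀ t, 0 ≤ t → Tendsto (fun s => l2 (fun x => φ s x - φ t x)) (𝓝[Ici 0] t) (𝓝 0)
  meas : StronglyMeasurable (fun p : ℝ × E3 => J p.1 p.2)
  int : ∀ T R, IntegrableOn (fun p : ℝ × E3 => J p.1 p.2)
    (Icc 0 T ×ˢ Metric.closedBall 0 R) volume
  eq : ∀ η, IsTestFunction η → ∀ s t, 0 ≤ s → s ≤ t →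
    (∫ x, φ t x * η x) - (∫ x, φ s x * η x)
      = ∫ τ in s..t, (Complex.I * (∫ x, φ τ x * lap η x) - Complex.I * ∫ x, J τ x * η x)

variable {φ J : ℝ → E3 → ℂ} {D : ℝ → Fin 3 → E3 → ℂ} {K : ℝ}

theorem IsTestFunction.memLp {η : E3 → ℂ} (hη : IsTestFunction η) : MemLp η 2 volume :=
  hη.1.continuous.memLp_of_hasCompactSupport hη.2

theorem norm_smear_le {u η : E3 → ℂ} (hu : MemLp u 2 volume) (hη : IsTestFunction η) (y : E3) :
    ‖smear u η y‖ ≤ l2 u * l2 η := by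
  have e : l2 (fun x => η (y - x)) = l2 η := by
    rw [l2, l2]
    congr 1
    exact eLpNorm_comp_measurePreserving hη.1.continuous.aestronglyMeasurable
      (volume.measurePreserving_sub_left y)
  refine (norm_integral_le_integral_norm _).trans ?_
  simp only [norm_mul]
  rw [← e]
  exact integral_norm_mul_norm_le hu (hη.translate y).memLp

theorem smear_sub {u v η : E3 → ℂ} (hu : MemLp u 2 volume) (hv : MemLp v 2 volume)
    (hη : IsTestFunction η) (y : E3) :
    smear u η y - smear v η y = smear (fun x => u x - v x) η y := by
  simp only [smear]
  rw [← integral_sub (integrable_mul_test (hu.locallyIntegrable (by norm_num)) (hη.translate y))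
    (integrable_mul_test (hv.locallyIntegrable (by norm_num)) (hη.translate y))]
  simp only [sub_mul]

/-- By Cauchy–Schwarz, L² continuity in time gives continuity of the convolution uniformly in the
space variable; continuity in space at the fixed time t does the rest. -/
theorem IsEvolution.continuousOn_smear (h : IsEvolution φ J D K) {η : E3 → ℂ}
    (hη : IsTestFunction η) :
    ContinuousOn (fun p : ℝ × E3 => smear (φ p.1) η p.2) (Ici 0 ×ˢ univ) := by
  rintro ⟨t, y⟩ ⟨ht, -⟩
  have ht : 0 ≤ t := ht
  have hloc := (h.isH1 t ht).memLp.locallyIntegrable (by norm_num)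
  rw [ContinuousWithinAt, tendsto_iff_norm_sub_tendsto_zero]
  have h1 : Tendsto (fun p : ℝ × E3 => l2 (fun x => φ p.1 x - φ t x) * l2 η
      + ‖smear (φ t) η p.2 - smear (φ t) η y‖) (𝓝[Ici 0 ×ˢ univ] (t, y)) (𝓝 0) := by
    have e1 : Tendsto (fun p : ℝ × E3 => l2 (fun x => φ p.1 x - φ t x))
        (𝓝[Ici 0 ×ˢ univ] (t, y)) (𝓝 0) := by
      refine (h.cont t ht).comp ?_
      rw [nhdsWithin_prod_eq]
      exact tendsto_fst
    have e2 : Tendsto (fun p : ℝ × E3 => ‖smear (φ t) η p.2 - smear (φ t) η y‖)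
        (𝓝[Ici 0 ×ˢ univ] (t, y)) (𝓝 0) := by
      rw [← tendsto_iff_norm_sub_tendsto_zero]
      exact (((smear_contDiff hloc hη).continuous.comp
        continuous_snd).tendsto (t, y)).mono_left nhdsWithin_le_nhds
    simpa using (e1.mul_const (l2 η)).add e2
  refine squeeze_zero' (.of_forall fun _ => norm_nonneg _) ?_ h1
  filter_upwards [self_mem_nhdsWithin] with p hp
  have hp : 0 ≤ p.1 := hp.1
  have e : smear (φ p.1) η p.2 - smear (φ t) η y
      = smear (fun x => φ p.1 x - φ t x) η p.2 + (smear (φ t) η p.2 - smear (φ t) η y) := by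
    rw [← smear_sub (h.isH1 _ hp).memLp (h.isH1 t ht).memLp hη]; ring
  rw [e]
  refine (norm_add_le _ _).trans (add_le_add ?_ le_rfl)
  exact norm_smear_le ((h.isH1 _ hp).memLp.sub (h.isH1 t ht).memLp) hη _

theorem IsEvolution.stronglyMeasurable_smear (h : IsEvolution φ J D K) {η : E3 → ℂ}
    (hη : IsTestFunction η) :
    StronglyMeasurable (fun p : ℝ × E3 => smear (J p.1) η p.2) := by
  have : StronglyMeasurable (fun q : (ℝ × E3) × E3 => J q.1.1 q.2 * η (q.1.2 - q.2)) :=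
    (h.meas.comp_measurable (by fun_prop : Measurable fun q : (ℝ × E3) × E3 => (q.1.1, q.2))).mul
      (hη.1.continuous.comp (by fun_prop :
        Continuous fun q : (ℝ × E3) × E3 => q.1.2 - q.2)).stronglyMeasurable
  exact this.integral_prod_right

/-- The mass of the source in the ball of radius `R`. -/
def sourceMass (J : ℝ → E3 → ℂ) (R : ℝ) (τ : ℝ) : ℝ :=
  ∫ x in Metric.closedBall (0 : E3) R, ‖J τ x‖

theorem IsEvolution.integrable_prod (h : IsEvolution φ J D K) (T R : ℝ) :
    Integrable (fun p : ℝ × E3 => J p.1 p.2)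
      ((volume.restrict (Icc 0 T)).prod (volume.restrict (Metric.closedBall 0 R))) := by
  rw [Measure.prod_restrict]
  exact h.int T R

theorem IsEvolution.integrableOn_sourceMass (h : IsEvolution φ J D K) (T R : ℝ) :
    IntegrableOn (sourceMass J R) (Icc 0 T) volume :=
  (h.integrable_prod T R).norm.integral_prod_left

/-- Integer values of T and R exhaust the half space, so countably many applications of Fubini share
one null set of times. -/
theorem ae_locallyIntegrable_slice {J : ℝ → E3 → ℂ} (hint : ∀ T R,
      IntegrableOn (fun p : ℝ × E3 => J p.1 p.2) (Icc 0 T ×ˢ Metric.closedBall 0 R) volume) :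
    ∀ᵐ τ ∂(volume : Measure ℝ), 0 ≤ τ → LocallyIntegrable (J τ) volume := by
  have h1 : ∀ T R : ℕ, ∀ᵐ τ ∂(volume : Measure ℝ), τ ∈ Icc 0 (T : ℝ) →
      IntegrableOn (J τ) (Metric.closedBall 0 (R : ℝ)) volume := fun T R => by
    have := hint T R
    rw [IntegrableOn, Measure.volume_eq_prod, ← Measure.prod_restrict] at this
    exact (ae_restrict_iff' measurableSet_Icc).mp this.prod_right_ae
  filter_upwards [ae_all_iff.mpr fun T => ae_all_iff.mpr (h1 T)] with τ hτ h0
  obtain ⟨T, hT⟩ := exists_nat_ge τ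
  intro x
  obtain ⟨R, hR⟩ := exists_nat_gt ‖x‖
  exact ⟨Metric.closedBall 0 (R : ℝ), Metric.closedBall_mem_nhds_of_mem (by simpa using hR),
    hτ T R ⟨h0, hT⟩⟩

theorem IsEvolution.ae_locallyIntegrable (h : IsEvolution φ J D K) :
    ∀ᵐ τ ∂(volume : Measure ℝ), 0 ≤ τ → LocallyIntegrable (J τ) volume :=
  ae_locallyIntegrable_slice h.int

theorem IsTestFunction.exists_bound {η : E3 → ℂ} (hη : IsTestFunction η) :
    ∃ B ρ : ℝ, 0 ≤ B ∧ 0 ≤ ρ ∧ (∀ x, ‖η x‖ ≤ B) ∧ ∀ x, ρ < ‖x‖ → η x = 0 := by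
  obtain ⟨B, hB⟩ := hη.2.exists_bound_of_continuous hη.1.continuous
  obtain ⟨ρ, hρ⟩ := hη.2.isCompact.isBounded.subset_closedBall 0
  refine ⟨B, max ρ 0, (norm_nonneg _).trans (hB 0), le_max_right _ _, hB, fun x hx => ?_⟩
  by_contra hne
  have := hρ (subset_tsupport η hne)
  rw [mem_closedBall_zero_iff] at this
  exact absurd hx (not_lt.mpr (this.trans (le_max_left _ _)))

theorem norm_smear_le_mass {u η : E3 → ℂ} {B ρ R : ℝ} (hu : LocallyIntegrable u volume)
    (hB : ∀ x, ‖η x‖ ≤ B) (hρ : ∀ x, ρ < ‖x‖ → η x = 0) {y : E3} (hy : ‖y‖ ≤ R) :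
    ‖smear u η y‖ ≤ B * ∫ x in Metric.closedBall (0 : E3) (R + ρ), ‖u x‖ := by
  have hB0 : 0 ≤ B := (norm_nonneg _).trans (hB 0)
  have hi : IntegrableOn (fun x => ‖u x‖) (Metric.closedBall (0 : E3) (R + ρ)) volume :=
    (hu.integrableOn_isCompact (isCompact_closedBall _ _)).norm
  rw [← integral_const_mul, ← integral_indicator measurableSet_closedBall]
  refine norm_integral_le_of_norm_le
    ((integrable_indicator_iff measurableSet_closedBall).mpr (hi.const_mul B))
    (.of_forall fun x => ?_)
  by_cases hx : x ∈ Metric.closedBall (0 : E3) (R + ρ)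
  · rw [indicator_of_mem hx, norm_mul, mul_comm B]
    gcongr
    exact hB _
  · rw [indicator_of_notMem hx, hρ]
    · simp
    · have h1 : R + ρ < ‖x‖ := by simpa using hx
      have h2 := norm_sub_norm_le x y
      rw [norm_sub_rev] at h2
      linarith

/-- The regularised right-hand side, tested against `η`. -/
def smearRhs (φ J : ℝ → E3 → ℂ) (η : E3 → ℂ) (τ : ℝ) (y : E3) : ℂ :=
  Complex.I * smear (φ τ) (lap η) y - Complex.I * smear (J τ) η y

/-- The weak equation tested against x ↦ η (y - x) is exactly an integrated ordinary differential
equation in time for the convolution at y. On a compact set its right-hand side is controlled by the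
L² bound and the local mass of the source. -/
theorem IsEvolution.isPrimitiveOn (h : IsEvolution φ J D K) {η : E3 → ℂ} (hη : IsTestFunction η)
    {s t : ℝ} (hs : 0 ≤ s) {S : Set E3} (hS : IsCompact S) :
    IsPrimitiveOn (fun τ => smear (φ τ) η) (smearRhs φ J η) s t S where
  cont := (h.continuousOn_smear hη).mono
    (prod_mono (fun τ hτ => hs.trans hτ.1) subset_rfl)
  meas := by
    have h1 : ContinuousOn (fun p : ℝ × E3 => smear (φ p.1) (lap η) p.2) (Ioc s t ×ˢ univ) :=
      (h.continuousOn_smear hη.laplacian).mono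
        (prod_mono (fun τ hτ => hs.trans hτ.1.le) subset_rfl)
    have h2 : ((volume : Measure ℝ).restrict (Ioc s t)).prod (volume : Measure E3)
        = ((volume : Measure ℝ).prod volume).restrict (Ioc s t ×ˢ univ) := by
      rw [← Measure.prod_restrict, Measure.restrict_univ]
    refine AEStronglyMeasurable.sub (AEStronglyMeasurable.const_mul ?_ _)
      ((h.stronglyMeasurable_smear hη).aestronglyMeasurable.const_mul _)
    rw [h2]
    exact h1.aestronglyMeasurable (measurableSet_Ioc.prod MeasurableSet.univ)
  meas_slice y := by
    have h1 : ContinuousOn (fun τ : ℝ => smear (φ τ) (lap η) y) (Ioc s t) :=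
      (h.continuousOn_smear hη.laplacian).comp (f := fun τ => (τ, y)) (by fun_prop)
        fun τ hτ => ⟨hs.trans hτ.1.le, mem_univ _⟩
    have h2 : StronglyMeasurable (fun τ : ℝ => smear (J τ) η y) :=
      (h.stronglyMeasurable_smear hη).comp_measurable
        (by fun_prop : Measurable fun τ : ℝ => (τ, y))
    exact ((h1.aestronglyMeasurable measurableSet_Ioc).const_mul _).sub
      (h2.aestronglyMeasurable.const_mul _)
  bound := by
    obtain ⟨B, ρ, hB0, hρ0, hB, hρ⟩ := hη.exists_bound
    obtain ⟨R, hR⟩ := hS.isBounded.subset_closedBall 0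
    refine ⟨fun τ => K * l2 (lap η) + B * sourceMass J (R + ρ) τ, ?_, ?_⟩
    · have h1 : IntegrableOn (fun _ : ℝ => K * l2 (lap η)) (Ioc s t) volume :=
        integrableOn_const (by simp)
      exact h1.add (((h.integrableOn_sourceMass t (R + ρ)).mono_set
        fun τ hτ => ⟨hs.trans hτ.1.le, hτ.2⟩).const_mul B)
    · filter_upwards [ae_restrict_of_ae h.ae_locallyIntegrable,
        ae_restrict_mem measurableSet_Ioc] with τ h1 h2 y hy
      have hτ : 0 ≤ τ := hs.trans h2.1.le
      refine (norm_sub_le _ _).trans (add_le_add ?_ ?_)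
      · rw [norm_mul, Complex.norm_I, one_mul]
        refine (norm_smear_le (h.isH1 τ hτ).memLp hη.laplacian y).trans ?_
        exact mul_le_mul_of_nonneg_right (h.isH1 τ hτ).l2_le (l2_nonneg _)
      · rw [norm_mul, Complex.norm_I, one_mul]
        exact norm_smear_le_mass (h1 hτ) hB hρ (by simpa using hR hy)
  eq y _ r hr := by
    have := h.eq _ (hη.translate y) s r hs hr.1
    simp only [smear, smearRhs]
    rw [this]
    refine intervalIntegral.integral_congr fun τ _ => ?_
    have e : ∀ x, lap (fun x => η (y - x)) x = lap η (y - x) := fun x => by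
      rw [lap, ← laplacian_eq_sum ((hη.translate y).1.of_le (by norm_cast)),
        laplacian_translate hη, lap]
    simp only [e]

end Equation

/-! ### A radial Sobolev bound, uniform in the mollification. -/

section RadialBound

variable {u : E3 → ℂ} {D : Fin 3 → E3 → ℂ} {K ε : ℝ}

/-- The reflection exchanging y and z preserves Lebesgue measure, the radial representative of u and
the radial kernel. -/
theorem moll_eq_of_norm_eq (hu : IsRadial u) {y z : E3} (h : ‖y‖ = ‖z‖) :
    moll ε u y = moll ε u z := by
  obtain ⟨f, hf⟩ := hu
  rw [moll, smear_congr_ae hf]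
  let A : E3 ≃ₗᵢ[ℝ] E3 := (ℝ ∙ (y - z))ᗮ.reflection
  have hA : A y = z := Submodule.reflection_sub h
  simp only [smear]
  rw [← (A.measurePreserving).integral_comp A.toHomeomorph.measurableEmbedding]
  refine integral_congr_ae (.of_forall fun x => ?_)
  have e : ‖y - A x‖ = ‖z - x‖ := by
    have h1 : A (z - x) = y - A x := by
      rw [map_sub, ← hA]
      congr 1
      exact Submodule.reflection_reflection _ y
    rw [← h1, A.norm_map]
  simp only [LinearIsometryEquiv.norm_map]
  rw [mollifier_radial e]

/-- The fundamental theorem of calculus for |g|² compares r with each s in the unit interval; the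
comparison is then averaged over s. -/
theorem sobolev_interval {g g' : ℝ → ℂ} (hg : ∀ r, HasDerivAt g (g' r) r)
    (hc : Continuous g') (r : ℝ) :
    ‖g r‖ ^ 2 ≤ ∫ s in r..(r + 1), (‖g s‖ ^ 2 + 2 * (‖g s‖ * ‖g' s‖)) := by
  have hgc : Continuous g := continuous_iff_continuousAt.mpr fun r => (hg r).continuousAt
  have hd : ∀ s, HasDerivAt (fun s => ‖g s‖ ^ 2) (2 * inner ℝ (g s) (g' s)) s := fun s =>
    (hg s).norm_sq
  have hii : ∀ a b, IntervalIntegrable (fun s => ‖g s‖ * ‖g' s‖) volume a b := fun a b =>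
    (hgc.norm.mul hc.norm).intervalIntegrable a b
  have key : ∀ s ∈ Icc r (r + 1),
      ‖g r‖ ^ 2 ≤ ‖g s‖ ^ 2 + 2 * ∫ σ in r..(r + 1), ‖g σ‖ * ‖g' σ‖ := by
    intro s hs
    have hcd : Continuous fun s => 2 * inner ℝ (g s) (g' s) :=
      continuous_const.mul (hgc.inner hc)
    have h1 := intervalIntegral.integral_eq_sub_of_hasDerivAt (a := r) (b := s)
      (fun σ _ => hd σ) (hcd.intervalIntegrable _ _)
    have h2 : |∫ σ in r..s, 2 * inner ℝ (g σ) (g' σ)| ≤ ∫ σ in r..s, 2 * (‖g σ‖ * ‖g' σ‖) := by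
      refine (intervalIntegral.abs_integral_le_integral_abs hs.1).trans ?_
      refine intervalIntegral.integral_mono_on hs.1 (hcd.abs.intervalIntegrable _ _)
        ((hii _ _).const_mul 2) fun σ _ => ?_
      rw [abs_mul, abs_two]
      gcongr
      exact abs_real_inner_le_norm _ _
    have h3 : ∫ σ in r..s, 2 * (‖g σ‖ * ‖g' σ‖) ≤ 2 * ∫ σ in r..(r + 1), ‖g σ‖ * ‖g' σ‖ := by
      rw [intervalIntegral.integral_const_mul]
      gcongr
      refine intervalIntegral.integral_mono_interval le_rfl hs.1 hs.2
        (.of_forall fun σ => by positivity) (hii _ _)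
    have h4 := (abs_le.mp (h2.trans h3)).1
    rw [h1] at h4
    linarith
  have hi2 : IntervalIntegrable (fun s => ‖g s‖ ^ 2) volume r (r + 1) :=
    (hgc.norm.pow 2).intervalIntegrable _ _
  have hi3 : IntervalIntegrable (fun _ : ℝ => 2 * ∫ σ in r..(r + 1), ‖g σ‖ * ‖g' σ‖)
    volume r (r + 1) := continuous_const.intervalIntegrable _ _
  have h5 := intervalIntegral.integral_mono_on (by linarith : r ≤ r + 1)
    (continuous_const.intervalIntegrable (μ := volume) r (r + 1) (u := fun _ => ‖g r‖ ^ 2))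
    (hi2.add hi3) key
  have e5 : ∫ s in r..(r + 1), (‖g s‖ ^ 2 + 2 * ∫ σ in r..(r + 1), ‖g σ‖ * ‖g' σ‖)
      = (∫ s in r..(r + 1), ‖g s‖ ^ 2) + 2 * ∫ σ in r..(r + 1), ‖g σ‖ * ‖g' σ‖ := by
    rw [intervalIntegral.integral_add hi2 hi3, intervalIntegral.integral_const]
    simp
  rw [intervalIntegral.integral_const] at h5
  rw [intervalIntegral.integral_add hi2 ((hii _ _).const_mul 2),
    intervalIntegral.integral_const_mul, ← e5]
  simpa using h5

/-- The radial Sobolev bound away from the origin, for mollifications of radial `H¹` functions. -/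
theorem exists_radial_bound (K : ℝ) : ∃ C : ℝ, 0 ≤ C ∧ ∀ (u : E3 → ℂ) (D : Fin 3 → E3 → ℂ) (ε : ℝ),
    IsH1 u D K → IsRadial u → 0 < ε → ∀ y : E3, 1 ≤ ‖y‖ → ‖moll ε u y‖ ≤ C := by
  -- The area of the unit sphere, the factor in the polar coordinate formula.
  set c : ℝ := 3 * volume.real (Metric.ball (0 : E3) 1) with hcdef
  have hc : 0 < c := by
    have : 0 < volume.real (Metric.ball (0 : E3) 1) :=
      ENNReal.toReal_pos (Metric.measure_ball_pos _ _ one_pos).ne' measure_ball_lt_top.ne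
    positivity
  refine ⟨Real.sqrt (7 * K ^ 2 / c), Real.sqrt_nonneg _, fun u D ε h hr hε y hy => ?_⟩
  have hK := h.nonneg
  have hM := h.moll hε
  set U := moll ε u with hU
  have hUs : ContDiff ℝ ∞ U := smear_contDiff (h.grad 0).1 (mollifier_isTestFunction hε)
  have hUd : Differentiable ℝ U := hUs.differentiable (by simp)
  let e : E3 := EuclideanSpace.single 0 1
  have he : ‖e‖ = 1 := by simp [e]
  let g : ℝ → ℂ := fun r => U (r • e)
  let g' : ℝ → ℂ := fun r => fderiv ℝ U (r • e) e
  have hline : ∀ (n : E3) (r : ℝ), HasDerivAt (fun r : ℝ => U (r • n)) (fderiv ℝ U (r • n) n) r := by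
    intro n r
    have h1 : HasDerivAt (fun r : ℝ => r • n) n r := by
      simpa using (hasDerivAt_id r).smul_const n
    exact (hUd (r • n)).hasFDerivAt.comp_hasDerivAt r h1
  have hg : ∀ r, HasDerivAt g (g' r) r := hline e
  have hg'c : Continuous g' :=
    ((hUs.continuous_fderiv (by simp)).comp (by fun_prop : Continuous fun r : ℝ => r • e)).clm_apply
      continuous_const
  have hgc : Continuous g := continuous_iff_continuousAt.mpr fun r => (hg r).continuousAt
  have hgU : ∀ x : E3, g ‖x‖ = U x := fun x =>
    moll_eq_of_norm_eq hr (by rw [norm_smul, he]; simp)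
  -- U is radial, so the derivative along the fixed ray through e equals the derivative along the
  -- ray through x, a combination of partial derivatives with coefficients at most 1.
  have hg'U : ∀ x : E3, ‖g' ‖x‖‖ ≤ ∑ j, ‖partialDeriv j U x‖ := by
    intro x
    by_cases hx : x = 0
    · subst hx
      refine le_trans (le_of_eq ?_) (Finset.single_le_sum (f := fun j => ‖partialDeriv j U 0‖)
        (fun j _ => norm_nonneg _) (Finset.mem_univ 0))
      simp [g', partialDeriv, e]
    have hn : ‖x‖ ≠ 0 := norm_ne_zero_iff.mpr hx
    set n : E3 := (1 / ‖x‖) • x with hndef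
    have hnn : ‖n‖ = 1 := by rw [hndef, norm_smul]; simp [hn]
    have h1 : ∀ᶠ r in 𝓝 ‖x‖, U (r • n) = g r := by
      refine .of_forall fun r => ?_
      exact moll_eq_of_norm_eq hr (by rw [norm_smul r n, norm_smul r e, he, hnn])
    have h2 : HasDerivAt g (fderiv ℝ U (‖x‖ • n) n) ‖x‖ :=
      (hline n ‖x‖).congr_of_eventuallyEq (h1.mono fun r hr => hr.symm)
    have h3 : ‖x‖ • n = x := by rw [hndef, smul_smul]; simp [hn]
    rw [(hg ‖x‖).unique h2, h3]
    have h4 : n = ∑ j, n j • (EuclideanSpace.single j (1 : ℝ)) := by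
      ext i; fin_cases i <;> simp [Fin.sum_univ_three]
    rw [h4, map_sum]
    refine (norm_sum_le _ _).trans (Finset.sum_le_sum fun j _ => ?_)
    rw [map_smul, norm_smul]
    have h5 : ‖n j‖ ≤ 1 := by rw [← hnn]; exact PiLp.norm_apply_le n j
    exact mul_le_of_le_one_left (norm_nonneg _) h5
  let F : ℝ → ℝ := fun s => ‖g s‖ ^ 2 + 2 * (‖g s‖ * ‖g' s‖)
  have hFc : Continuous F := by fun_prop
  have hF0 : ∀ s, 0 ≤ F s := fun s => by positivity
  have hFle : ∀ x : E3, F ‖x‖ ≤ ‖U x‖ * ‖U x‖ + ∑ j, 2 * (‖U x‖ * ‖partialDeriv j U x‖) := by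
    intro x
    simp only [F, hgU, ← Finset.mul_sum]
    rw [pow_two]
    gcongr
    exact hg'U x
  have hint : Integrable (fun x : E3 => ‖U x‖ * ‖U x‖ + ∑ j, 2 * (‖U x‖ * ‖partialDeriv j U x‖))
      volume :=
    (integrable_norm_mul_norm hM.memLp hM.memLp).add (integrable_finsetSum _ fun j _ =>
      (integrable_norm_mul_norm hM.memLp (hM.memLp_grad j)).const_mul 2)
  have hFi : Integrable (fun x : E3 => F ‖x‖) volume :=
    hint.mono' (hFc.comp continuous_norm).aestronglyMeasurable
      (.of_forall fun x => by rw [Real.norm_of_nonneg (hF0 _)]; exact hFle x)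
  -- One K² from |U|² and 2K² from each of the three partial derivatives.
  have hI : ∫ x : E3, F ‖x‖ ≤ 7 * K ^ 2 := by
    refine (integral_mono hFi hint hFle).trans ?_
    rw [integral_add (integrable_norm_mul_norm hM.memLp hM.memLp) (integrable_finsetSum _ fun j _ =>
      (integrable_norm_mul_norm hM.memLp (hM.memLp_grad j)).const_mul 2),
      integral_finsetSum _ fun j _ =>
      (integrable_norm_mul_norm hM.memLp (hM.memLp_grad j)).const_mul 2]
    simp only [integral_const_mul]
    have b0 : ∫ x, ‖U x‖ * ‖U x‖ ≤ K * K :=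
      (integral_norm_mul_norm_le hM.memLp hM.memLp).trans
        (mul_le_mul hM.l2_le hM.l2_le (l2_nonneg _) hK)
    have b1 : ∀ j, ∫ x, ‖U x‖ * ‖partialDeriv j U x‖ ≤ K * K := fun j =>
      (integral_norm_mul_norm_le hM.memLp (hM.memLp_grad j)).trans
        (mul_le_mul hM.l2_le (hM.l2_grad_le j) (l2_nonneg _) hK)
    rw [Fin.sum_univ_three]
    nlinarith [b1 0, b1 1, b1 2]
  have hdim : Module.finrank ℝ E3 = 3 := by simp
  have hpolar := integral_fun_norm_addHaar (volume : Measure E3) F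
  have hFi2 := (integrable_fun_norm_addHaar (volume : Measure E3) (f := F)).mp hFi
  rw [hdim] at hpolar hFi2
  have hpos : ‖y‖ ≤ ‖y‖ + 1 := by linarith
  -- The polar weight s² is at least 1 because s ≥ ‖y‖ ≥ 1; this is where the origin has to be
  -- excluded.
  have hsub : ∫ s in ‖y‖..(‖y‖ + 1), F s ≤ ∫ s in Ioi (0 : ℝ), s ^ (3 - 1) • F s := by
    rw [intervalIntegral.integral_of_le hpos]
    have hle : ∫ s in Ioc ‖y‖ (‖y‖ + 1), F s ≤ ∫ s in Ioc ‖y‖ (‖y‖ + 1), s ^ (3 - 1) • F s := by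
      refine setIntegral_mono_on (hFc.integrableOn_Ioc) ?_ measurableSet_Ioc fun s hs => ?_
      · exact Continuous.integrableOn_Ioc (by fun_prop)
      · have h1 : 1 ≤ s := hy.trans hs.1.le
        exact le_mul_of_one_le_left (hF0 s) (one_le_pow₀ h1)
    refine hle.trans (setIntegral_mono_set hFi2 ?_ ?_)
    · filter_upwards [ae_restrict_mem measurableSet_Ioi] with s hs
      have : (0 : ℝ) < s := hs
      exact mul_nonneg (by positivity) (hF0 s)
    · have hss : Ioc ‖y‖ (‖y‖ + 1) ⊆ Ioi 0 := fun s hs =>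
        (lt_of_lt_of_le zero_lt_one hy).trans hs.1
      exact LE.le.eventuallyLE hss
  have hfin := (sobolev_interval hg hg'c ‖y‖).trans hsub
  rw [hgU] at hfin
  refine Real.le_sqrt_of_sq_le (hfin.trans ?_)
  rw [le_div_iff₀ hc]
  refine le_trans (le_of_eq ?_) hI
  rw [hpolar, hcdef]
  simp only [smul_eq_mul, nsmul_eq_mul]
  push_cast
  ring

end RadialBound

/-! ### Source terms under mollification. -/

section Source

variable {u T : E3 → ℂ} {D : Fin 3 → E3 → ℂ} {K ε R : ℝ}

/-- Mollification is a contraction in `L¹`, locally. -/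
theorem integral_norm_moll_le (hT : LocallyIntegrable T volume) (hε : 0 < ε) (hε1 : ε ≤ 1) :
    ∫ y in Metric.closedBall (0 : E3) R, ‖moll ε T y‖
      ≤ ∫ x in Metric.closedBall (0 : E3) (R + 1), ‖T x‖ := by
  have := mollifierMeasure_isProbability hε
  set T1 := (Metric.closedBall (0 : E3) (R + 1)).indicator T with hT1
  have hT1i : Integrable T1 volume := (integrable_indicator_iff measurableSet_closedBall).mpr
    (hT.integrableOn_isCompact (isCompact_closedBall _ _))
  have hc : Continuous (moll ε T) := (smear_contDiff hT (mollifier_isTestFunction hε)).continuous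
  have e1 : ∫ x in Metric.closedBall (0 : E3) (R + 1), ‖T x‖ = (∫⁻ x, ‖T1 x‖ₑ).toReal := by
    rw [← integral_norm_eq_lintegral_enorm hT1i.1, ← integral_indicator measurableSet_closedBall]
    congr 1; ext x; rw [hT1, norm_indicator_eq_indicator_norm]
  rw [e1, integral_norm_eq_lintegral_enorm hc.aestronglyMeasurable]
  refine ENNReal.toReal_mono hT1i.2.ne ?_
  have h1 : ∀ y ∈ Metric.closedBall (0 : E3) R,
      ‖moll ε T y‖ₑ ≤ ∫⁻ z, ‖T1 (y - z)‖ₑ ∂mollifierMeasure ε := by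
    intro y hy
    rw [moll, smear_mollifier_eq hε]
    refine (enorm_integral_le_lintegral_enorm _).trans (le_of_eq (lintegral_congr_ae ?_))
    filter_upwards [mollifierMeasure_ae hε] with z hz
    have : y - z ∈ Metric.closedBall (0 : E3) (R + 1) := by
      rw [mem_closedBall_zero_iff] at hy ⊢
      exact (norm_sub_le _ _).trans (by linarith)
    rw [hT1, indicator_of_mem this]
  calc _ ≤ ∫⁻ y in Metric.closedBall (0 : E3) R, ∫⁻ z, ‖T1 (y - z)‖ₑ ∂mollifierMeasure ε :=
        setLIntegral_mono' measurableSet_closedBall h1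
    _ ≤ ∫⁻ y, ∫⁻ z, ‖T1 (y - z)‖ₑ ∂mollifierMeasure ε := setLIntegral_le_lintegral _ _
    _ = ∫⁻ z, (∫⁻ y, ‖T1 (y - z)‖ₑ) ∂mollifierMeasure ε :=
        lintegral_lintegral_swap (f := fun y z => ‖T1 (y - z)‖ₑ)
          (aestronglyMeasurable_sub_prod hT1i.1).enorm
    _ = ∫⁻ z, (∫⁻ x, ‖T1 x‖ₑ) ∂mollifierMeasure ε := by
        refine lintegral_congr fun z => ?_
        exact lintegral_sub_right_eq_self (fun x => ‖T1 x‖ₑ) z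
    _ = _ := by simp

/-- The weight lives where U is bounded, so the local L¹ mass of T is enough. Since ε ≤ 1,
mollification enlarges the ball by at most 1. -/
theorem abs_source_le {k : E3 → ℝ} {B C : ℝ} (hT : LocallyIntegrable T volume) (hε : 0 < ε)
    (hε1 : ε ≤ 1) (hB : ∀ y, |k y| ≤ B) (hk0 : ∀ y, ‖y‖ < 1 → k y = 0)
    (hkR : ∀ y, R < ‖y‖ → k y = 0) (hC0 : 0 ≤ C) {U : E3 → ℂ}
    (hC : ∀ y : E3, 1 ≤ ‖y‖ → ‖U y‖ ≤ C) :
    |∫ y, k y * (moll ε T y * (starRingEnd ℂ) (U y)).im|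
      ≤ B * C * ∫ x in Metric.closedBall (0 : E3) (R + 1), ‖T x‖ := by
  have hB0 : 0 ≤ B := (abs_nonneg _).trans (hB 0)
  have hc : Continuous (moll ε T) := (smear_contDiff hT (mollifier_isTestFunction hε)).continuous
  refine le_trans ?_ (mul_le_mul_of_nonneg_left (integral_norm_moll_le (R := R) hT hε hε1)
    (mul_nonneg hB0 hC0))
  rw [← integral_const_mul, ← integral_indicator measurableSet_closedBall, ← Real.norm_eq_abs]
  refine norm_integral_le_of_norm_le ((integrable_indicator_iff measurableSet_closedBall).mpr
    ((hc.norm.continuousOn.integrableOn_compact (isCompact_closedBall _ _)).const_mul _))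
    (.of_forall fun y => ?_)
  by_cases hy : y ∈ Metric.closedBall (0 : E3) R
  · rw [indicator_of_mem hy]
    rcases lt_or_ge ‖y‖ 1 with h1 | h1
    · rw [hk0 y h1]; simp; positivity
    · rw [norm_mul, Real.norm_eq_abs, Real.norm_eq_abs]
      have h2 : |(moll ε T y * (starRingEnd ℂ) (U y)).im| ≤ ‖moll ε T y‖ * C := by
        refine (Complex.abs_im_le_norm _).trans ?_
        rw [norm_mul, RCLike.norm_conj]
        gcongr
        exact hC y h1
      calc _ ≤ B * (‖moll ε T y‖ * C) := by gcongr; exact hB y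
        _ = _ := by ring
  · rw [indicator_of_notMem hy, hkR y (by simpa using hy)]
    simp

theorem smear_add {v η : E3 → ℂ} (hu : LocallyIntegrable u volume)
    (hv : LocallyIntegrable v volume) (hη : IsTestFunction η) (y : E3) :
    smear (fun x => u x + v x) η y = smear u η y + smear v η y := by
  simp only [smear]
  rw [← integral_add (integrable_mul_test hu (hη.translate y))
    (integrable_mul_test hv (hη.translate y))]
  simp only [add_mul]

/-- A source which is a real multiple of `u` does not contribute to the mass balance. -/
theorem tendsto_source {k : E3 → ℝ} {C : ℝ} (hT : LocallyIntegrable T volume)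
    (hTm : StronglyMeasurable T) (hu : MemLp u 2 volume)
    (hreal : ∀ᵐ x, (T x * (starRingEnd ℂ) (u x)).im = 0)
    (hkc : Continuous k) (hk0 : ∀ y, ‖y‖ < 1 → k y = 0)
    (hkR : ∀ y, R < ‖y‖ → k y = 0) (hC0 : 0 ≤ C)
    (hC : ∀ ε, 0 < ε → ∀ y : E3, 1 ≤ ‖y‖ → ‖moll ε u y‖ ≤ C) :
    Tendsto (fun ε => ∫ y, k y * (moll ε T y * (starRingEnd ℂ) (moll ε u y)).im)
      (𝓝[>] 0) (𝓝 0) := by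
  have hks : HasCompactSupport k := HasCompactSupport.intro (isCompact_closedBall (0 : E3) R)
    fun y hy => hkR y (by simpa using hy)
  obtain ⟨B, hB⟩ := hks.exists_bound_of_continuous hkc
  have hB0 : 0 ≤ B := (norm_nonneg _).trans (hB 0)
  set S := Metric.closedBall (0 : E3) (R + 1) with hS
  have hTi : IntegrableOn T S volume := hT.integrableOn_isCompact (isCompact_closedBall _ _)
  -- truncation at height `M`
  let P : ℕ → Set E3 := fun M => S ∩ {x | ‖T x‖ ≤ M}
  have hP : ∀ M, MeasurableSet (P M) := fun M =>
    measurableSet_closedBall.inter (measurableSet_le hTm.norm.measurable measurable_const)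
  let G : ℕ → E3 → ℂ := fun M => (P M).indicator T
  have hG2 : ∀ M, MemLp (G M) 2 volume := by
    intro M
    have h1 : MemLp (fun x => G M x) 2 (volume.restrict S) := by
      have : IsFiniteMeasure ((volume : Measure E3).restrict S) :=
        ⟨by rw [Measure.restrict_apply_univ]; exact measure_closedBall_lt_top⟩
      refine MemLp.of_bound (hTm.indicator (hP M)).aestronglyMeasurable (M : ℝ)
        (.of_forall fun x => ?_)
      by_cases hx : x ∈ P M
      · simp only [G, indicator_of_mem hx]; exact hx.2
      · simp [G, indicator_of_notMem hx]
    have h2 := (memLp_indicator_iff_restrict (μ := (volume : Measure E3)) (p := 2)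
      (f := G M) (measurableSet_closedBall (x := (0 : E3)) (ε := R + 1))).mpr h1
    refine h2.congr_norm (hTm.indicator (hP M)).aestronglyMeasurable (.of_forall fun x => ?_)
    by_cases hx : x ∈ S
    · rw [indicator_of_mem hx]
    · have : x ∉ P M := fun h => hx h.1
      rw [indicator_of_notMem hx]; simp [G, this]
  have hGl : ∀ M, LocallyIntegrable (G M) volume := fun M => (hG2 M).locallyIntegrable (by norm_num)
  have hrest : Tendsto (fun M : ℕ => ∫ x in S, ‖T x - G M x‖) atTop (𝓝 0) := by
    have h0 : ∫ x in S, ‖(0 : ℂ)‖ = 0 := by simp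
    rw [← h0]
    refine tendsto_integral_of_dominated_convergence (fun x => ‖T x‖) ?_ hTi.norm ?_ ?_
    · exact fun M => (hTm.sub (hTm.indicator (hP M))).norm.aestronglyMeasurable
    · refine fun M => .of_forall fun x => ?_
      by_cases hx : x ∈ P M
      · simp [G, hx]
      · simp [G, hx]
    · filter_upwards [ae_restrict_mem measurableSet_closedBall] with x hx
      obtain ⟨M0, hM0⟩ := exists_nat_ge ‖T x‖
      refine tendsto_const_nhds.congr' ?_
      filter_upwards [eventually_ge_atTop M0] with M hM
      have : x ∈ P M := ⟨hx, hM0.trans (by exact_mod_cast hM)⟩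
      simp [G, this]
  have hev : ∀ᶠ ε in 𝓝[>] (0 : ℝ), 0 < ε := self_mem_nhdsWithin
  have hev1 : ∀ᶠ ε in 𝓝[>] (0 : ℝ), ε ≤ 1 :=
    mem_nhdsWithin_of_mem_nhds (Iic_mem_nhds one_pos)
  -- The truncated source is in L², so the limit ε → 0 can be taken inside and yields Im(G ū) = 0.
  -- The discarded part is small in L¹ uniformly in ε by `abs_source_le`.
  have hlimG : ∀ M, Tendsto (fun ε => ∫ y, k y * (moll ε (G M) y
      * (starRingEnd ℂ) (moll ε u y)).im) (𝓝[>] 0) (𝓝 0) := by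
    intro M
    have hBae : ∀ᵐ y : E3, |k y| ≤ B := .of_forall hB
    have := tendsto_integral_weight (l := 𝓝[>] (0 : ℝ)) (b := fun x => (k x : ℂ)) (B := B)
      (F := fun ε => moll ε (G M)) (G := fun ε => moll ε u)
      (Complex.continuous_ofReal.comp hkc).aestronglyMeasurable
      (.of_forall fun x => by simpa using hB x) (hG2 M) hu
      (hev.mono fun ε hε => memLp_moll (hG2 M) hε)
      (hev.mono fun ε hε => memLp_moll hu hε) (tendsto_l2_moll (hG2 M)) (tendsto_l2_moll hu)
    have h2 := (Complex.continuous_im.tendsto _).comp this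
    rw [← integral_weight_im hkc.aestronglyMeasurable hBae (hG2 M) hu] at h2
    have h3 : ∫ x, k x * (G M x * (starRingEnd ℂ) (u x)).im = ∫ x : E3, (0 : ℝ) := by
      refine integral_congr_ae ?_
      filter_upwards [hreal] with x hx
      by_cases hxP : x ∈ P M
      · simp only [G, indicator_of_mem hxP]; rw [hx, mul_zero]
      · simp [G, hxP]
    rw [h3, integral_zero] at h2
    refine h2.congr' ?_
    filter_upwards [hev] with ε hε
    simp only [Function.comp]
    rw [integral_weight_im hkc.aestronglyMeasurable hBae (memLp_moll (hG2 M) hε)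
      (memLp_moll hu hε)]
  rw [Metric.tendsto_nhds]
  intro δ hδ
  have hr2 : Tendsto (fun M : ℕ => B * C * ∫ x in S, ‖T x - G M x‖) atTop (𝓝 0) := by
    simpa using hrest.const_mul (B * C)
  obtain ⟨M, hM⟩ := (hr2.eventually (Iio_mem_nhds (half_pos hδ))).exists
  have hM : B * C * ∫ x in S, ‖T x - G M x‖ < δ / 2 := hM
  filter_upwards [hev, hev1, (Metric.tendsto_nhds.mp (hlimG M)) (δ / 2) (half_pos hδ)]
    with ε h0 h1 h2
  rw [dist_zero_right, Real.norm_eq_abs] at h2 ⊢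
  have hTG : LocallyIntegrable (fun x => T x - G M x) volume := hT.sub (hGl M)
  have hη := mollifier_isTestFunction h0
  have c1 : Continuous (moll ε (G M)) := (smear_contDiff (hGl M) hη).continuous
  have c2 : Continuous (moll ε fun x => T x - G M x) := (smear_contDiff hTG hη).continuous
  have c3 : Continuous (moll ε u) :=
    (smear_contDiff (hu.locallyIntegrable (by norm_num)) hη).continuous
  have hsplit : ∫ y, k y * (moll ε T y * (starRingEnd ℂ) (moll ε u y)).im
      = (∫ y, k y * (moll ε (G M) y * (starRingEnd ℂ) (moll ε u y)).im)
        + ∫ y, k y * (moll ε (fun x => T x - G M x) y * (starRingEnd ℂ) (moll ε u y)).im := by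
    rw [← integral_add (integrable_compact_mul hkc hks (by fun_prop))
      (integrable_compact_mul hkc hks (by fun_prop))]
    refine integral_congr_ae (.of_forall fun y => ?_)
    have : moll ε T y = moll ε (G M) y + moll ε (fun x => T x - G M x) y := by
      rw [moll, moll, moll, ← smear_add (hGl M) hTG hη]
      simp
    simp only [this, add_mul, Complex.add_im, mul_add]
  rw [hsplit]
  have h3 := abs_source_le hTG h0 h1 hB hk0 hkR hC0 (hC ε h0)
  calc _ ≤ _ := abs_add_le _ _
    _ < δ / 2 + δ / 2 := add_lt_add_of_lt_of_le h2 (h3.trans hM.le)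
    _ = δ := by ring

end Source

/-! ### Evolution of weighted mass. -/

section MassEvolution

variable {φ J : ℝ → E3 → ℂ} {D : ℝ → Fin 3 → E3 → ℂ} {K ε s t R : ℝ}

/-- The mollifier as a complex test function. -/
abbrev molC (ε : ℝ) : E3 → ℂ := fun x => (mollifier ε x : ℂ)

theorem smearRhs_eq_rhs {η : E3 → ℂ} {τ : ℝ} (hφ : LocallyIntegrable (φ τ) volume)
    (hη : IsTestFunction η) : smearRhs φ J η τ = rhs (smear (φ τ) η) (smear (J τ) η) := by
  ext y
  rw [smearRhs, rhs]
  congr 2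
  exact smear_laplacian hφ hη y

theorem smearRhs_partialDeriv {η : E3 → ℂ} {τ : ℝ} (hφ : LocallyIntegrable (φ τ) volume)
    (hJ : LocallyIntegrable (J τ) volume) (hη : IsTestFunction η) (k : Fin 3) :
    smearRhs φ J (partialDeriv k η) τ
      = partialDeriv k (rhs (smear (φ τ) η) (smear (J τ) η)) := by
  rw [← smearRhs_eq_rhs hφ hη]
  ext y
  have h1 : ContDiff ℝ ∞ (smear (φ τ) (lap η)) := smear_contDiff hφ hη.laplacian
  have hL : IsTestFunction (lap η) := hη.laplacian
  have h2 : ContDiff ℝ ∞ (smear (J τ) η) := smear_contDiff hJ hη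
  have e1 : partialDeriv k (smearRhs φ J η τ) y = Complex.I * partialDeriv k (smear (φ τ) (lap η)) y
      - Complex.I * partialDeriv k (smear (J τ) η) y := by
    have d1 := h1.differentiable (by simp) y
    have d2 := h2.differentiable (by simp) y
    have := ((d1.hasFDerivAt.const_mul Complex.I).sub (d2.hasFDerivAt.const_mul Complex.I)).fderiv
    simp only [partialDeriv]
    change fderiv ℝ (fun y => Complex.I * smear (φ τ) (lap η) y - Complex.I * smear (J τ) η y) y _ = _
    erw [this]
    simp
  rw [e1, partialDeriv_smear hJ hη, partialDeriv_smear hφ hL, smearRhs]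
  congr 3
  ext x
  have h3 : ContDiff ℝ ∞ η := hη.1
  simp only [lap]
  have e2 : partialDeriv k (fun x => ∑ j, partialDeriv j (partialDeriv j η) x) x
      = ∑ j, partialDeriv k (partialDeriv j (partialDeriv j η)) x := by
    rw [partialDeriv, fderiv_fun_sum fun j _ =>
      ((partialDeriv_smooth (partialDeriv_smooth h3 j) j).differentiable (by simp) x),
      _root_.sum_apply]
    rfl
  change _ = partialDeriv k (fun x => ∑ j, partialDeriv j (partialDeriv j η) x) x
  rw [e2]
  refine Finset.sum_congr rfl fun j _ => ?_
  have e3 : partialDeriv k (partialDeriv j η) = partialDeriv j (partialDeriv k η) :=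
    funext fun z => partialDeriv_comm (h3.of_le (by norm_cast)) k j z
  rw [partialDeriv_comm ((partialDeriv_smooth h3 j).of_le (by norm_cast)) k j, e3]

/-- A time dependent weight, compactly supported in space. -/
structure IsWeight (k k' : ℝ → E3 → ℝ) (s t R : ℝ) : Prop where
  deriv : ∀ y, ∀ τ ∈ Icc s t, HasDerivAt (fun τ => k τ y) (k' τ y) τ
  cont : ContinuousOn (fun p : ℝ × E3 => k p.1 p.2) (Icc s t ×ˢ univ)
  cont' : ContinuousOn (fun p : ℝ × E3 => k' p.1 p.2) (Icc s t ×ˢ univ)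
  zero : ∀ τ ∈ Icc s t, ∀ y, R < ‖y‖ → k τ y = 0
  zero' : ∀ τ ∈ Icc s t, ∀ y, R < ‖y‖ → k' τ y = 0

theorem exists_bound_weight {k : ℝ → E3 → ℝ}
    (hc : ContinuousOn (fun p : ℝ × E3 => k p.1 p.2) (Icc s t ×ˢ univ))
    (hz : ∀ τ ∈ Icc s t, ∀ y, R < ‖y‖ → k τ y = 0) :
    ∃ B, 0 ≤ B ∧ ∀ τ ∈ Icc s t, ∀ y, |k τ y| ≤ B := by
  obtain ⟨C, hC⟩ := (isCompact_Icc.prod (isCompact_closedBall (0 : E3) R)).exists_bound_of_continuousOn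
      (hc.mono (prod_mono subset_rfl (subset_univ _)))
  refine ⟨max C 0, le_max_right _ _, fun τ hτ y => ?_⟩
  by_cases hy : R < ‖y‖
  · rw [hz τ hτ y hy]; simp
  · exact (hC (τ, y) ⟨hτ, by simpa using hy⟩).trans (le_max_left _ _)

theorem continuous_slice {k : ℝ → E3 → ℝ}
    (hc : ContinuousOn (fun p : ℝ × E3 => k p.1 p.2) (Icc s t ×ˢ univ)) {τ : ℝ}
    (hτ : τ ∈ Icc s t) : Continuous (k τ) :=
  hc.comp_continuous (f := fun y => (τ, y)) (by fun_prop) fun y => ⟨hτ, mem_univ _⟩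

theorem IsWeight.evolution {k k' : ℝ → E3 → ℝ} (hk : IsWeight k k' s t R) (hst : s ≤ t)
    {A A' B B' : ℝ → E3 → ℂ} (hA : IsPrimitiveOn A A' s t (Metric.closedBall 0 R))
    (hB : IsPrimitiveOn B B' s t (Metric.closedBall 0 R)) :
    IntervalIntegrable (fun τ => ∫ y, ((k' τ y : ℂ) * A τ y * B τ y
        + (k τ y : ℂ) * (A' τ y * B τ y + A τ y * B' τ y))) volume s t ∧
    (∫ y, (k t y : ℂ) * A t y * B t y) - (∫ y, (k s y : ℂ) * A s y * B s y)
      = ∫ τ in s..t, ∫ y, ((k' τ y : ℂ) * A τ y * B τ y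
        + (k τ y : ℂ) * (A' τ y * B τ y + A τ y * B' τ y)) := by
  have h := weighted_evolution (k := fun τ y => (k τ y : ℂ)) (k' := fun τ y => (k' τ y : ℂ)) hst
    (isCompact_closedBall (0 : E3) R) (fun y τ hτ => (hk.deriv y τ hτ).ofReal_comp)
    (Complex.continuous_ofReal.comp_continuousOn hk.cont)
    (Complex.continuous_ofReal.comp_continuousOn hk.cont')
    (fun τ hτ y hy => by
      have := hk.zero τ hτ y (by simpa using hy); simp [this])
    (fun τ hτ y hy => by
      have := hk.zero' τ hτ y (by simpa using hy); simp [this]) hA hB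
  refine ⟨?_, h.2⟩
  rw [intervalIntegrable_iff_integrableOn_Ioc_of_le hst]
  exact h.1.integral_prod_left

/-- The product rule is applied to the mollification and its conjugate, followed by `mass_balance`
at almost every time. The source term does not vanish at this stage, because mollification destroys
the relation Im(J φ̄) = 0. -/
theorem IsEvolution.mass_evolution_moll (h : IsEvolution φ J D K) {k k' : ℝ → E3 → ℝ}
    (hk : IsWeight k k' s t R) (hs : 0 ≤ s) (hst : s ≤ t) (hε : 0 < ε)
    (hk1 : ∀ τ ∈ Icc s t, ContDiff ℝ 1 (k τ)) :
    ∃ H : ℝ → ℝ, IntervalIntegrable H volume s t ∧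
      mass (k t) (moll ε (φ t)) - mass (k s) (moll ε (φ s)) = ∫ τ in s..t, H τ ∧
      ∀ᵐ τ, τ ∈ Icc s t → H τ = mass (k' τ) (moll ε (φ τ))
        + 2 * current (fun j => partialDeriv j (k τ)) (fun j => partialDeriv j (moll ε (φ τ)))
            (moll ε (φ τ))
        + 2 * ∫ y, k τ y * (moll ε (J τ) y * (starRingEnd ℂ) (moll ε (φ τ) y)).im := by
  have hη := mollifier_isTestFunction hε
  have hP := h.isPrimitiveOn hη (t := t) hs (isCompact_closedBall (0 : E3) R)
  obtain ⟨h1, h2⟩ := hk.evolution hst hP hP.conj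
  have hre := Complex.reCLM.intervalIntegral_comp_comm h1
  refine ⟨fun τ => Complex.reCLM (∫ y, ((k' τ y : ℂ) * smear (φ τ) (molC ε) y
      * (starRingEnd ℂ) (smear (φ τ) (molC ε) y)
        + (k τ y : ℂ) * (smearRhs φ J (molC ε) τ y * (starRingEnd ℂ) (smear (φ τ) (molC ε) y)
          + smear (φ τ) (molC ε) y * (starRingEnd ℂ) (smearRhs φ J (molC ε) τ y)))),
    ⟨Complex.reCLM.integrable_comp h1.1, Complex.reCLM.integrable_comp h1.2⟩, ?_, ?_⟩
  · rw [hre, ← h2, map_sub]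
    have e : ∀ τ ∈ Icc s t, mass (k τ) (moll ε (φ τ))
        = Complex.reCLM (∫ y, (k τ y : ℂ) * smear (φ τ) (molC ε) y
          * (starRingEnd ℂ) (smear (φ τ) (molC ε) y)) := by
      intro τ hτ
      obtain ⟨B, -, hB⟩ := exists_bound_weight hk.cont hk.zero
      rw [mass_eq_re (continuous_slice hk.cont hτ).aestronglyMeasurable
        (.of_forall (hB τ hτ)) (memLp_moll (h.isH1 τ (hs.trans hτ.1)).memLp hε)]
      simp only [mul_assoc, Complex.reCLM_apply]
    rw [e t ⟨hst, le_rfl⟩, e s ⟨le_rfl, hst⟩]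
  · filter_upwards [h.ae_locallyIntegrable] with τ hJ hτ
    have hτ0 : 0 ≤ τ := hs.trans hτ.1
    have hJ := hJ hτ0
    have hφ := ((h.isH1 τ hτ0).grad 0).1
    rw [smearRhs_eq_rhs hφ hη]
    set U := smear (φ τ) (molC ε) with hU
    set Q := smear (J τ) (molC ε) with hQ
    have hUs : ContDiff ℝ ∞ U := smear_contDiff hφ hη
    have hQs : ContDiff ℝ ∞ Q := smear_contDiff hJ hη
    have hkc := continuous_slice hk.cont hτ
    have hkc' := continuous_slice hk.cont' hτ
    have hks : HasCompactSupport (k τ) := HasCompactSupport.intro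
      (isCompact_closedBall (0 : E3) R) fun y hy => hk.zero τ hτ y (by simpa using hy)
    have hks' : HasCompactSupport (k' τ) := HasCompactSupport.intro
      (isCompact_closedBall (0 : E3) R) fun y hy => hk.zero' τ hτ y (by simpa using hy)
    have cU := hUs.continuous
    have cl := (lap_contDiff hUs).continuous
    have cQ := hQs.continuous
    have cP := (rhs_contDiff hUs hQs).continuous
    have e1 : (∫ y, ((k' τ y : ℂ) * U y * (starRingEnd ℂ) (U y)
        + (k τ y : ℂ) * (rhs U Q y * (starRingEnd ℂ) (U y)
          + U y * (starRingEnd ℂ) (rhs U Q y))))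
        = ((∫ y, (k' τ y * ‖U y‖ ^ 2
          + k τ y * (2 * (rhs U Q y * (starRingEnd ℂ) (U y)).re)) : ℝ) : ℂ) := by
      rw [← integral_complex_ofReal]
      refine integral_congr_ae (.of_forall fun y => ?_)
      simp only
      push_cast
      have a1 : (U y) * (starRingEnd ℂ) (U y) = ((‖U y‖ : ℝ) : ℂ) ^ 2 := by
        rw [Complex.mul_conj, Complex.normSq_eq_norm_sq]; push_cast; rfl
      have a2 : rhs U Q y * (starRingEnd ℂ) (U y) + U y * (starRingEnd ℂ) (rhs U Q y)
          = 2 * (((rhs U Q y * (starRingEnd ℂ) (U y)).re : ℝ) : ℂ) := by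
        have := Complex.add_conj (rhs U Q y * (starRingEnd ℂ) (U y))
        rw [map_mul, Complex.conj_conj, mul_comm ((starRingEnd ℂ) (rhs U Q y))] at this
        rw [this]; push_cast; rfl
      rw [mul_assoc, a1, a2]
    rw [e1, Complex.reCLM_apply, Complex.ofReal_re,
      integral_add (integrable_compact_mul hkc' hks' (by fun_prop))
      (integrable_compact_mul hkc hks (by fun_prop)),
      mass_balance hUs hQs.continuous (hk1 τ hτ) hks, mass]
    ring

/-- Dominated convergence in time as ε → 0. The source term disappears by `tendsto_source`, which
needs the weight to vanish in the unit ball, where no Sobolev bound is available. -/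
theorem IsEvolution.mass_evolution (h : IsEvolution φ J D K) {k k' : ℝ → E3 → ℝ} {B : ℝ}
    (hk : IsWeight k k' s t R) (hs : 0 ≤ s) (hst : s ≤ t)
    (hk1 : ∀ τ ∈ Icc s t, ContDiff ℝ 1 (k τ)) (hk0 : ∀ τ ∈ Icc s t, ∀ y, ‖y‖ < 1 → k τ y = 0)
    (hB : ∀ τ ∈ Icc s t, ∀ j y, |partialDeriv j (k τ) y| ≤ B)
    (hrad : ∀ τ, 0 ≤ τ → IsRadial (φ τ))
    (hreal : ∀ᵐ τ, 0 ≤ τ → ∀ᵐ x, (J τ x * (starRingEnd ℂ) (φ τ x)).im = 0) :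
    IntervalIntegrable (fun τ => mass (k' τ) (φ τ)
      + 2 * current (fun j => partialDeriv j (k τ)) (D τ) (φ τ)) volume s t ∧
    mass (k t) (φ t) - mass (k s) (φ s) = ∫ τ in s..t, (mass (k' τ) (φ τ)
      + 2 * current (fun j => partialDeriv j (k τ)) (D τ) (φ τ)) := by
  obtain ⟨Bk, hBk0, hBk⟩ := exists_bound_weight hk.cont hk.zero
  obtain ⟨Bk', hBk0', hBk'⟩ := exists_bound_weight hk.cont' hk.zero'
  obtain ⟨C, hC0, hC⟩ := exists_radial_bound K
  have hsI : s ∈ Icc s t := ⟨le_rfl, hst⟩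
  have htI : t ∈ Icc s t := ⟨hst, le_rfl⟩
  have hKm := fun (ε : ℝ) (hε : 0 < ε) => h.mass_evolution_moll hk hs hst hε hk1
  -- along the sequence `ε = 1 / (n + 1)`
  let e : ℕ → ℝ := fun n => 1 / ((n : ℝ) + 1)
  have he0 : ∀ n, 0 < e n := fun n => by positivity
  have he1 : ∀ n, e n ≤ 1 := fun n => by
    rw [div_le_one (by positivity)]; linarith [(Nat.cast_nonneg n : (0 : ℝ) ≤ n)]
  have het : Tendsto e atTop (𝓝[>] 0) :=
    tendsto_nhdsWithin_iff.mpr ⟨tendsto_one_div_add_atTop_nhds_zero_nat, .of_forall he0⟩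
  choose H hHi hHe hHf using fun n => hKm (e n) (he0 n)
  have hcB : ∀ τ ∈ Icc s t, ∀ j, ∀ᵐ y, |partialDeriv j (k τ) y| ≤ B := fun τ hτ j =>
    .of_forall (hB τ hτ j)
  have hcm : ∀ τ ∈ Icc s t, ∀ j, AEStronglyMeasurable (partialDeriv j (k τ)) volume :=
    fun τ hτ j => (partialDeriv_continuous (hk1 τ hτ) j).aestronglyMeasurable
  have hkm : ∀ τ ∈ Icc s t, AEStronglyMeasurable (k τ) volume := fun τ hτ =>
    (continuous_slice hk.cont hτ).aestronglyMeasurable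
  have hkm' : ∀ τ ∈ Icc s t, AEStronglyMeasurable (k' τ) volume := fun τ hτ =>
    (continuous_slice hk.cont' hτ).aestronglyMeasurable
  set L : ℝ → ℝ := fun τ => mass (k' τ) (φ τ)
      + 2 * current (fun j => partialDeriv j (k τ)) (D τ) (φ τ) with hL
  have hlim : ∀ᵐ τ, τ ∈ Icc s t → Tendsto (fun n => H n τ) atTop (𝓝 (L τ)) := by
    filter_upwards [ae_all_iff.mpr hHf, h.ae_locallyIntegrable, hreal] with τ h1 h2 h3 hτ
    have hτ0 : 0 ≤ τ := hs.trans hτ.1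
    have hφ := h.isH1 τ hτ0
    have l1 := (hφ.tendsto_mass (hkm' τ hτ) (.of_forall (hBk' τ hτ))).comp het
    have l2 := (hφ.tendsto_current (hcm τ hτ) (hcB τ hτ)).comp het
    have l3 := (tendsto_source (h2 hτ0) (h.meas.comp_measurable
        (by fun_prop : Measurable fun x : E3 => (τ, x))) hφ.memLp (h3 hτ0)
      (continuous_slice hk.cont hτ) (hk0 τ hτ) (hk.zero τ hτ) hC0
      (fun ε hε y hy => hC _ _ ε hφ (hrad τ hτ0) hε y hy)).comp het
    have l4 := (l1.add (l2.const_mul 2)).add (l3.const_mul 2)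
    simp only [mul_zero, add_zero] at l4
    exact l4.congr fun n => (h1 n hτ).symm
  -- The integrable majorant does not depend on n: the mass and current terms are bounded by K², and
  -- the source term by its local L¹ mass times the Sobolev constant C.
  have hbound : ∀ n, ∀ᵐ τ, τ ∈ Icc s t → ‖H n τ‖
      ≤ Bk' * K ^ 2 + 2 * (3 * B * K ^ 2) + 2 * (Bk * C * sourceMass J (R + 1) τ) := by
    intro n
    filter_upwards [hHf n, h.ae_locallyIntegrable] with τ h1 h2 hτ
    have hτ0 : 0 ≤ τ := hs.trans hτ.1
    have hφ := h.isH1 τ hτ0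
    have hφm := hφ.moll (he0 n)
    rw [h1 hτ, Real.norm_eq_abs]
    have b1 := abs_mass_le (hkm' τ hτ) (.of_forall (hBk' τ hτ)) hφm
    have b2 := abs_current_le (hcm τ hτ) (hcB τ hτ) hφm
    have b3 := abs_source_le (U := moll (e n) (φ τ)) (h2 hτ0) (he0 n) (he1 n) (hBk τ hτ)
      (hk0 τ hτ) (hk.zero τ hτ) hC0
      (fun y hy => hC _ _ (e n) hφ (hrad τ hτ0) (he0 n) y hy)
    refine (abs_add_le _ _).trans (add_le_add ((abs_add_le _ _).trans (add_le_add b1 ?_)) ?_)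
    · rw [abs_mul, abs_two]; gcongr
    · rw [abs_mul, abs_two]; gcongr; exact b3
  have hbi : IntervalIntegrable (fun τ => Bk' * K ^ 2 + 2 * (3 * B * K ^ 2)
      + 2 * (Bk * C * sourceMass J (R + 1) τ)) volume s t := by
    refine intervalIntegrable_const.add (IntervalIntegrable.const_mul
      (IntervalIntegrable.const_mul ?_ _) _)
    rw [intervalIntegrable_iff_integrableOn_Icc_of_le hst]
    exact (h.integrableOn_sourceMass t (R + 1)).mono_set (Icc_subset_Icc_left hs)
  have hmem : ∀ {τ : ℝ}, τ ∈ uIoc s t → τ ∈ Icc s t := fun hτ => by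
    rw [uIoc_of_le hst] at hτ; exact Ioc_subset_Icc_self hτ
  have hHm : ∀ n, AEStronglyMeasurable (H n) (volume.restrict (uIoc s t)) := fun n => by
    rw [uIoc_of_le hst]; exact (hHi n).1.aestronglyMeasurable
  have hconv := intervalIntegral.tendsto_integral_filter_of_dominated_convergence
    (μ := volume) (a := s) (b := t) (F := H) (f := L) (l := atTop) _ (.of_forall hHm)
    (.of_forall fun n => (hbound n).mono fun τ hτ hm => hτ (hmem hm)) hbi
    (hlim.mono fun τ hτ hm => hτ (hmem hm))
  have hLm : AEStronglyMeasurable L (volume.restrict (uIoc s t)) :=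
    aestronglyMeasurable_of_tendsto_ae atTop hHm
      ((ae_restrict_iff' measurableSet_uIoc).mpr (hlim.mono fun τ hτ hm => hτ (hmem hm)))
  refine ⟨?_, ?_⟩
  · refine hbi.mono_fun' hLm ?_
    refine (ae_restrict_iff' measurableSet_uIoc).mpr ?_
    filter_upwards [hlim, ae_all_iff.mpr hbound] with τ h1 h2 hm
    exact le_of_tendsto ((h1 (hmem hm)).norm) (.of_forall fun n => h2 n (hmem hm))
  · have m1 := ((h.isH1 t (hs.trans hst)).tendsto_mass (hkm t htI)
      (.of_forall (hBk t htI))).comp het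
    have m2 := ((h.isH1 s hs).tendsto_mass (hkm s hsI) (.of_forall (hBk s hsI))).comp het
    refine tendsto_nhds_unique (m1.sub m2) (hconv.congr fun n => ?_)
    exact (hHe n).symm

end MassEvolution

/-! ### Momentum balance at a fixed time. -/

section MomentumEvolution

variable {f : ℝ → ℝ} {C K ε c R : ℝ}

/-- The time derivative of the window, when `m` has derivative `m'`. -/
def windowDt (f : ℝ → ℝ) (m m' r : ℝ) : ℝ := -(deriv f (r / m) * (r * m' / m ^ 2))

/-- The denominator max(|y|, 1) never vanishes, which makes joint continuity in time and space
immediate. -/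
theorem radialField_eq_max {h : ℝ → ℝ} (hz : ∀ r ≤ 1, h r = 0) (k : Fin 3) (y : E3) :
    radialField h k y = h ‖y‖ * (y k / max ‖y‖ 1) := by
  rw [radialField]
  rcases le_total ‖y‖ 1 with h1 | h1
  · rw [hz _ h1]; simp
  · rw [max_eq_left h1]

/-- At the endpoint l = 1/2 the cutoff attains its minimum 0, so the derivative vanishes there too.
-/
theorem IsSmoothCutoff.deriv_eq_zero_of_lt (hf : IsSmoothCutoff f) {l : ℝ} (h : l ≤ 1 / 2) :
    deriv f l = 0 := by
  rcases lt_or_eq_of_le h with h1 | h1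
  · exact hf.iterate_eq_zero 0 fun hh => absurd hh.1 (not_le.mpr h1)
  · have hmin : IsLocalMin f l := by
      refine .of_forall fun x => ?_
      rw [hf.eq_zero l h]; exact hf.nonneg x
    exact hmin.deriv_eq_zero

theorem IsSmoothCutoff.windowDt_eq_zero_of_le (hf : IsSmoothCutoff f) {m m' : ℝ} (hm : 2 ≤ m)
    {r : ℝ} (hr : r ≤ 1) : windowDt f m m' r = 0 := by
  rw [windowDt, hf.deriv_eq_zero_of_lt]
  · simp
  · rw [div_le_iff₀ (by linarith)]; linarith

theorem IsSmoothCutoff.isWeight_window (hf : IsSmoothCutoff f) {m m' : ℝ → ℝ} {s t : ℝ}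
    (hm : ∀ τ ∈ Icc s t, HasDerivAt m (m' τ) τ) (hmc : ContinuousOn m' (Icc s t))
    (hm2 : ∀ τ ∈ Icc s t, 2 ≤ m τ) (hmR : ∀ τ ∈ Icc s t, m τ ≤ R) (k : Fin 3) :
    IsWeight (fun τ => radialField (window f (m τ) R 0) k)
      (fun τ => radialField (windowDt f (m τ) (m' τ)) k) s t R where
  deriv y τ hτ := by
    have hm0 : m τ ≠ 0 := by linarith [hm2 τ hτ]
    have h1 : HasDerivAt (fun τ => ‖y‖ / m τ) (-(‖y‖ * m' τ / m τ ^ 2)) τ := by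
      have := (hasDerivAt_const τ ‖y‖).div (hm τ hτ) hm0
      have e : (0 * m τ - ‖y‖ * m' τ) / m τ ^ 2 = -(‖y‖ * m' τ / m τ ^ 2) := by ring
      exact e ▸ this
    have h2 := (hf.hasDerivAt (‖y‖ / m τ)).comp τ h1
    have h3 := (h2.sub_const (f (‖y‖ / R))).mul_const (y k / ‖y‖)
    have e2 : deriv f (‖y‖ / m τ) * (-(‖y‖ * m' τ / m τ ^ 2)) * (y k / ‖y‖)
        = radialField (windowDt f (m τ) (m' τ)) k y := by
      rw [radialField, windowDt]; ring
    rw [← e2]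
    have e3 : (fun τ => radialField (window f (m τ) R 0) k y)
        = fun τ => (f (‖y‖ / m τ) - f (‖y‖ / R)) * (y k / ‖y‖) := by
      ext τ; rw [radialField, window_zero]
    rw [e3]
    exact h3
  cont := by
    have hcm : ContinuousOn m (Icc s t) := fun τ hτ => (hm τ hτ).continuousAt.continuousWithinAt
    have hcm2 : ContinuousOn (fun p : ℝ × E3 => m p.1) (Icc s t ×ˢ univ) :=
      hcm.comp continuousOn_fst fun p hp => hp.1
    have : ContinuousOn (fun p : ℝ × E3 => (f (‖p.2‖ / m p.1) - f (‖p.2‖ / R))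
        * (p.2 k / max ‖p.2‖ 1)) (Icc s t ×ˢ univ) := by
      refine ContinuousOn.mul (ContinuousOn.sub ?_ ?_) ?_
      · exact hf.smooth.continuous.comp_continuousOn (continuous_snd.norm.continuousOn.div hcm2
          fun p hp => by linarith [hm2 p.1 hp.1])
      · exact (hf.smooth.continuous.comp (by fun_prop)).continuousOn
      · refine Continuous.continuousOn (Continuous.div (by fun_prop) (by fun_prop) fun p => ?_)
        exact (lt_of_lt_of_le one_pos (le_max_right _ _)).ne'
    refine this.congr fun p hp => ?_
    have h2 := hm2 p.1 hp.1
    rw [radialField_eq_max (fun r hr => hf.window_eq_zero_of_le (by linarith)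
      (hmR p.1 hp.1) (by linarith)), window_zero]
  cont' := by
    have hcm : ContinuousOn m (Icc s t) := fun τ hτ => (hm τ hτ).continuousAt.continuousWithinAt
    have hcm2 : ContinuousOn (fun p : ℝ × E3 => m p.1) (Icc s t ×ˢ univ) :=
      hcm.comp continuousOn_fst fun p hp => hp.1
    have hcm3 : ContinuousOn (fun p : ℝ × E3 => m' p.1) (Icc s t ×ˢ univ) :=
      hmc.comp continuousOn_fst fun p hp => hp.1
    have hd : Continuous (_root_.deriv f) := (hf.smooth_deriv 1).continuous
    have : ContinuousOn (fun p : ℝ × E3 => (-(_root_.deriv f (‖p.2‖ / m p.1)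
        * (‖p.2‖ * m' p.1 / m p.1 ^ 2))) * (p.2 k / max ‖p.2‖ 1)) (Icc s t ×ˢ univ) := by
      refine ContinuousOn.mul (ContinuousOn.neg (ContinuousOn.mul ?_ ?_)) ?_
      · exact hd.comp_continuousOn (continuous_snd.norm.continuousOn.div hcm2
          fun p hp => by linarith [hm2 p.1 hp.1])
      · exact (continuous_snd.norm.continuousOn.mul hcm3).div (hcm2.pow 2)
          fun p hp => pow_ne_zero 2 (by linarith [hm2 p.1 hp.1])
      · refine Continuous.continuousOn (Continuous.div (by fun_prop) (by fun_prop) fun p => ?_)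
        exact (lt_of_lt_of_le one_pos (le_max_right _ _)).ne'
    refine this.congr fun p hp => ?_
    rw [radialField_eq_max (fun r hr => hf.windowDt_eq_zero_of_le (hm2 p.1 hp.1) hr), windowDt]
  zero τ hτ y hy := by
    rw [radialField, hf.window_eq_zero_of_ge (by linarith [hm2 τ hτ]) (hmR τ hτ) hy.le, zero_mul]
  zero' τ hτ y hy := by
    have hm0 : 0 < m τ := by linarith [hm2 τ hτ]
    have h1 : _root_.deriv f (‖y‖ / m τ) = 0 := by
      refine hf.iterate_eq_zero 0 fun hh => absurd hh.2 (not_le.mpr ?_)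
      rw [lt_div_iff₀ hm0, one_mul]; linarith [hmR τ hτ]
    rw [radialField, windowDt, h1]; simp

variable {u T : E3 → ℂ} {D : Fin 3 → E3 → ℂ} {m m' : ℝ}

/-- A bound of the source by the solution in the exterior region survives mollification. -/
theorem norm_moll_le_of_exterior (hu : MemLp u 2 volume) (hε : 0 < ε) (hεm : ε ≤ m / 4)
    (hc : ∀ᵐ x, m / 4 ≤ ‖x‖ → ‖T x‖ ≤ c * ‖u x‖) {y : E3} (hy : m / 2 ≤ ‖y‖) :
    ‖moll ε T y‖ ≤ c * ‖moll ε (fun x => (‖u x‖ : ℂ)) y‖ := by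
  have hη := mollifier_isTestFunction hε
  have hn : MemLp (fun x => (‖u x‖ : ℂ)) 2 volume := hu.norm.ofReal
  have hi := integrable_mul_test (hn.locallyIntegrable (by norm_num)) (hη.translate y)
  have hi2 : Integrable (fun x => ‖u x‖ * mollifier ε (y - x)) volume := by
    refine hi.re.congr (.of_forall fun x => ?_)
    simp
  have e : moll ε (fun x => (‖u x‖ : ℂ)) y = ((∫ x, ‖u x‖ * mollifier ε (y - x) : ℝ) : ℂ) := by
    rw [moll, smear, ← integral_complex_ofReal]
    push_cast; rfl
  have hpos : 0 ≤ ∫ x, ‖u x‖ * mollifier ε (y - x) :=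
    integral_nonneg fun x => mul_nonneg (norm_nonneg _) (mollifier_nonneg hε _)
  rw [e, Complex.norm_real, Real.norm_of_nonneg hpos, ← integral_const_mul]
  refine norm_integral_le_of_norm_le (hi2.const_mul c) ?_
  filter_upwards [hc] with x hx
  rw [norm_mul, Complex.norm_real, Real.norm_of_nonneg (mollifier_nonneg hε _), ← mul_assoc]
  by_cases h1 : m / 4 ≤ ‖x‖
  · exact mul_le_mul_of_nonneg_right (hx h1) (mollifier_nonneg hε _)
  · have h2 := norm_sub_norm_le y x
    rw [mollifier_eq_zero hε (by linarith)]; simp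

theorem abs_integral_source_le {d : E3 → ℝ} {g : E3 → ℂ} {B : ℝ} (hu : MemLp u 2 volume)
    (huK : l2 u ≤ K) (hg : MemLp g 2 volume) (hgK : l2 g ≤ K) (hc0 : 0 ≤ c)
    (hε : 0 < ε) (hεm : ε ≤ m / 4)
    (hc : ∀ᵐ x, m / 4 ≤ ‖x‖ → ‖T x‖ ≤ c * ‖u x‖) (hB0 : 0 ≤ B) (hB : ∀ y, |d y| ≤ B)
    (hd : ∀ y, ‖y‖ < m / 2 → d y = 0) :
    |∫ y, d y * (moll ε T y * (starRingEnd ℂ) (g y)).re| ≤ B * c * K ^ 2 := by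
  have hn : MemLp (fun x => (‖u x‖ : ℂ)) 2 volume := hu.norm.ofReal
  have hK : 0 ≤ K := (l2_nonneg u).trans huK
  have hnl : l2 (fun x => (‖u x‖ : ℂ)) = l2 u := by
    rw [l2, l2]; congr 1; exact eLpNorm_congr_norm_ae (.of_forall fun x => by simp)
  have hm := memLp_moll hn hε
  rw [← Real.norm_eq_abs]
  refine (norm_integral_le_of_norm_le ((integrable_norm_mul_norm hm hg).const_mul (B * c))
    (.of_forall fun y => ?_)).trans ?_
  · rcases lt_or_ge ‖y‖ (m / 2) with h1 | h1
    · rw [hd y h1, zero_mul, norm_zero]; positivity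
    · rw [norm_mul, Real.norm_eq_abs, Real.norm_eq_abs]
      have h2 : |(moll ε T y * (starRingEnd ℂ) (g y)).re|
          ≤ (c * ‖moll ε (fun x => (‖u x‖ : ℂ)) y‖) * ‖g y‖ := by
        refine (Complex.abs_re_le_norm _).trans ?_
        rw [norm_mul, RCLike.norm_conj]
        gcongr
        exact norm_moll_le_of_exterior hu hε hεm hc h1
      calc _ ≤ B * ((c * ‖moll ε (fun x => (‖u x‖ : ℂ)) y‖) * ‖g y‖) := by gcongr; exact hB y
        _ = _ := by ring
  · rw [integral_const_mul, pow_two]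
    refine mul_le_mul_of_nonneg_left ((integral_norm_mul_norm_le hm hg).trans ?_) (by positivity)
    refine mul_le_mul ?_ hgK (l2_nonneg _) hK
    exact (l2_moll_le hn hε).trans (hnl ▸ huK)

/-- The total error in the momentum balance. -/
def momentumError (C K c R m m' : ℝ) : ℝ :=
  (C * m' ^ 2 / m + 6 * C / R + 9 * C / m ^ 3 + (2 * C + 4) / m * c + 6 * c) * K ^ 2

/-- The momentum balance is bounded below using `window_positivity`. The terms of `momentumError`
come from the motion of the window, its outer edge (three components times 2C/R), half of 18C/m³ for
the Laplacian of the divergence, and the source paired with div W and with the three components of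
2W. -/
theorem IsSmoothCutoff.momentum_slice (hf : IsSmoothCutoff f)
    (hC : ∀ n < 3, ∀ l, |deriv^[n + 1] f l| ≤ C) (hm : 2 ≤ m) (hR : m ≤ R) (m' : ℝ)
    (h : IsH1 u D K) (hT : LocallyIntegrable T volume) (hε : 0 < ε) (hεm : ε ≤ m / 4)
    (hc0 : 0 ≤ c) (hc : ∀ᵐ x, m / 4 ≤ ‖x‖ → ‖T x‖ ≤ c * ‖u x‖) :
    -momentumError C K c R m m' ≤
      ∑ k, ∫ y, (radialField (windowDt f m m') k y *
          (partialDeriv k (moll ε u) y * (starRingEnd ℂ) (moll ε u y)).im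
        + radialField (window f m R 0) k y *
          (partialDeriv k (rhs (moll ε u) (moll ε T)) y * (starRingEnd ℂ) (moll ε u y)
            + partialDeriv k (moll ε u) y
              * (starRingEnd ℂ) (rhs (moll ε u) (moll ε T) y)).im) := by
  have hm0 : 0 < m := by linarith
  have hR0 : 0 < R := by linarith
  have hC0 : 0 ≤ C := (abs_nonneg _).trans (hC 0 (by norm_num) 0)
  have hη := mollifier_isTestFunction hε
  have hUH := h.moll hε
  set U := moll ε u with hU
  set Q := moll ε T with hQ
  have hUs : ContDiff ℝ ∞ U := smear_contDiff (h.grad 0).1 hη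
  have hQs : ContDiff ℝ ∞ Q := smear_contDiff hT hη
  have hU1 : ContDiff ℝ 1 U := hUs.of_le (by norm_cast)
  have c0 := hUs.continuous
  have c1 : ∀ j, Continuous (partialDeriv j U) := fun j => partialDeriv_continuous hU1 j
  have cl := (lap_contDiff hUs).continuous
  have cQ := hQs.continuous
  have cP := (rhs_contDiff hUs hQs).continuous
  have hP1 : ContDiff ℝ 1 (rhs U Q) := (rhs_contDiff hUs hQs).of_le (by norm_cast)
  have cP1 := fun k => partialDeriv_continuous hP1 k
  have hv := hf.vanishesNear_window (R := R) hm0 hR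
  set W := radialField (window f m R 0) with hW
  have hWs : ∀ k, ContDiff ℝ ∞ (W k) := hv.contDiff_radialField (hf.window_contDiff m R 0)
  have hWc : ∀ k, HasCompactSupport (W k) :=
    radialField_hasCompactSupport fun r hr => hf.window_eq_zero_of_ge hm0 hR hr
  -- the time derivative as a weight
  have hwt := fun k => hf.isWeight_window (R := R) (m := fun τ => m + m' * τ) (m' := fun _ => m')
    (s := 0) (t := 0) (fun τ _ => by simpa using ((hasDerivAt_id τ).const_mul m').const_add m)
    continuousOn_const (fun τ hτ => by
      have : τ = 0 := by simpa using hτ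
      simp [this, hm])
    (fun τ hτ => by
      have : τ = 0 := by simpa using hτ
      simp [this, hR]) k
  have h00 : (0 : ℝ) ∈ Icc (0 : ℝ) 0 := by simp
  set V := radialField (windowDt f m m') with hV
  have hVc : ∀ k, Continuous (V k) := fun k => by
    have := continuous_slice
      (k := fun τ => radialField (windowDt f (m + m' * τ) m') k) (hwt k).cont' h00
    simpa using this
  have hVs : ∀ k, HasCompactSupport (V k) := fun k =>
    HasCompactSupport.intro (isCompact_closedBall (0 : E3) R) fun y hy => by
      have := (hwt k).zero' 0 h00 y (by simpa using hy)
      simpa using this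
  have iV : ∀ k {g : E3 → ℝ}, Continuous g → Integrable (fun x => V k x * g x) volume :=
    fun k g hg => integrable_compact_mul (hVc k) (hVs k) hg
  have iW : ∀ k {g : E3 → ℝ}, Continuous g → Integrable (fun x => W k x * g x) volume :=
    fun k g hg => integrable_compact_mul (hWs k).continuous (hWc k) hg
  have iW1 : ∀ j k {g : E3 → ℝ}, Continuous g →
      Integrable (fun x => partialDeriv j (W k) x * g x) volume :=
    fun j k g hg => integrable_compact_mul
      (partialDeriv_continuous ((hWs k).of_le (by norm_cast)) j)
      (partialDeriv_hasCompactSupport (hWc k) j) hg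
  have e1 : ∑ k, ∫ y, (V k y * (partialDeriv k U y * (starRingEnd ℂ) (U y)).im
        + W k y * (partialDeriv k (rhs U Q) y * (starRingEnd ℂ) (U y)
            + partialDeriv k U y * (starRingEnd ℂ) (rhs U Q y)).im)
      = (∑ k, ∫ y, V k y * (partialDeriv k U y * (starRingEnd ℂ) (U y)).im)
        + ∑ k, ∫ y, W k y * (partialDeriv k (rhs U Q) y * (starRingEnd ℂ) (U y)
            + partialDeriv k U y * (starRingEnd ℂ) (rhs U Q y)).im := by
    rw [← Finset.sum_add_distrib]
    exact Finset.sum_congr rfl fun k _ => integral_add (iV k (by fun_prop)) (iW k (by fun_prop))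
  rw [e1, momentum_balance hUs hQs hWs hWc]
  -- the positive part
  have p1 : -(C * m' ^ 2 / m) * K ^ 2 - 6 * C / R * K ^ 2 ≤
      2 * (∑ j, ∑ k, ∫ x, partialDeriv j (W k) x *
          (partialDeriv j U x * (starRingEnd ℂ) (partialDeriv k U x)).re)
      + ∑ k, ∫ y, V k y * (partialDeriv k U y * (starRingEnd ℂ) (U y)).im := by
    have i1 : ∀ j, Integrable (fun x => ‖partialDeriv j U x‖ ^ 2) volume := fun j =>
      (hUH.memLp_grad j).integrable_norm_pow (by norm_num)
    have i0 : Integrable (fun x => ‖U x‖ ^ 2) volume := hUH.memLp.integrable_norm_pow (by norm_num)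
    have e2 : 2 * (∑ j, ∑ k, ∫ x, partialDeriv j (W k) x *
          (partialDeriv j U x * (starRingEnd ℂ) (partialDeriv k U x)).re)
        + ∑ k, ∫ y, V k y * (partialDeriv k U y * (starRingEnd ℂ) (U y)).im
        = ∫ x, (2 * (∑ j, ∑ k, partialDeriv j (W k) x *
          (partialDeriv j U x * (starRingEnd ℂ) (partialDeriv k U x)).re)
          + ∑ k, V k x * (partialDeriv k U x * (starRingEnd ℂ) (U x)).im) := by
      have hjk : ∀ j k, Integrable (fun x => partialDeriv j (W k) x *
          (partialDeriv j U x * (starRingEnd ℂ) (partialDeriv k U x)).re) volume :=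
        fun j k => iW1 j k (by fun_prop)
      rw [integral_add ((integrable_finsetSum _ fun j _ =>
        integrable_finsetSum _ fun k _ => hjk j k).const_mul 2)
        (integrable_finsetSum _ fun k _ => iV k (by fun_prop)), integral_const_mul,
        integral_finsetSum _ fun j _ => integrable_finsetSum _ fun k _ => hjk j k,
        integral_finsetSum _ fun k _ => iV k (by fun_prop)]
      congr 2
      exact Finset.sum_congr rfl fun j _ => (integral_finsetSum _ fun k _ => hjk j k).symm
    rw [e2]
    have i2 : Integrable (fun x => -(C * m' ^ 2 / m) * ‖U x‖ ^ 2
        - 2 * C / R * ∑ j, ‖partialDeriv j U x‖ ^ 2) volume :=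
      (i0.const_mul _).sub ((integrable_finsetSum _ fun j _ => i1 j).const_mul _)
    have i3 : Integrable (fun x => (2 * (∑ j, ∑ k, partialDeriv j (W k) x *
          (partialDeriv j U x * (starRingEnd ℂ) (partialDeriv k U x)).re)
          + ∑ k, V k x * (partialDeriv k U x * (starRingEnd ℂ) (U x)).im)) volume :=
      ((integrable_finsetSum _ fun j _ => integrable_finsetSum _ fun k _ =>
        iW1 j k (by fun_prop)).const_mul 2).add
        (integrable_finsetSum _ fun k _ => iV k (by fun_prop))
    refine le_trans ?_ (integral_mono i2 i3 fun x => hf.window_positivity hC hm0 hR m' x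
      (fun j => partialDeriv j U x) (U x))
    rw [integral_sub (i0.const_mul _) ((integrable_finsetSum _ fun j _ => i1 j).const_mul _),
      integral_const_mul, integral_const_mul, integral_finsetSum _ fun j _ => i1 j,
      integral_norm_sq hUH.memLp]
    simp only [integral_norm_sq (hUH.memLp_grad _)]
    have q0 : l2 U ^ 2 ≤ K ^ 2 := pow_le_pow_left₀ (l2_nonneg _) hUH.l2_le 2
    have q1 : ∑ j, l2 (partialDeriv j U) ^ 2 ≤ 3 * K ^ 2 := by
      refine (Finset.sum_le_sum fun j _ => pow_le_pow_left₀ (l2_nonneg _)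
        (hUH.l2_grad_le j) 2).trans ?_
      simp
    have q2 : C * m' ^ 2 / m * l2 U ^ 2 ≤ C * m' ^ 2 / m * K ^ 2 := by gcongr
    have q3 : 2 * C / R * ∑ j, l2 (partialDeriv j U) ^ 2 ≤ 2 * C / R * (3 * K ^ 2) := by gcongr
    have q4 : 2 * C / R * (3 * K ^ 2) = 6 * C / R * K ^ 2 := by ring
    linarith
  have hd := divergence_contDiff hWs
  have hdc := divergence_hasCompactSupport hWc
  -- the error terms
  have p2 : |∫ x, lap (divergence W) x * ‖U x‖ ^ 2| ≤ 18 * C / m ^ 3 * K ^ 2 :=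
    abs_mass_le (lap_contDiff hd).continuous.aestronglyMeasurable
      (.of_forall (hf.abs_lap_divergence_window_le hC hm0 hR)) hUH
  have hW0 : ∀ k y, ‖y‖ < m / 2 → W k y = 0 := fun k y hy => by
    rw [hW, radialField, hf.window_eq_zero_of_le hm0 hR hy.le, zero_mul]
  have hd0 : ∀ y, ‖y‖ < m / 2 → divergence W y = 0 := by
    intro y hy
    rw [hW, hv.divergence_radialField ((hf.window_contDiff m R 0).of_le (by norm_cast)),
      (hf.hasDerivAt_window m R 0 _).deriv, hf.window_eq_zero_of_le hm0 hR hy.le,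
      hf.window_succ_eq_zero hm0 hR 0 hy]
    simp
  have p3 : |∫ x, divergence W x * (Q x * (starRingEnd ℂ) (U x)).re|
      ≤ (2 * C + 4) / m * c * K ^ 2 :=
    abs_integral_source_le h.memLp h.l2_le hUH.memLp hUH.l2_le hc0 hε hεm hc (by positivity)
      (hf.abs_divergence_window_le hC hm0 hR) hd0
  have p4 : ∀ k, |∫ x, W k x * (Q x * (starRingEnd ℂ) (partialDeriv k U x)).re|
      ≤ 1 * c * K ^ 2 := fun k =>
    abs_integral_source_le h.memLp h.l2_le (hUH.memLp_grad k) (hUH.l2_grad_le k) hc0 hε hεm hc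
      zero_le_one (fun y => abs_radialField_le (hf.abs_window_le_one hm0 hR (norm_nonneg _)) k)
      (hW0 k)
  have p5 : |∑ k, ∫ x, W k x * (Q x * (starRingEnd ℂ) (partialDeriv k U x)).re|
      ≤ 3 * (c * K ^ 2) := by
    refine (Finset.abs_sum_le_sum_abs _ _).trans ((Finset.sum_le_sum fun k _ => p4 k).trans ?_)
    simp
  have a2 := (abs_le.mp p2).2
  have a3 := (abs_le.mp p3).1
  have a5 := (abs_le.mp p5).1
  have e3 : momentumError C K c R m m' = C * m' ^ 2 / m * K ^ 2 + 6 * C / R * K ^ 2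
      + 1 / 2 * (18 * C / m ^ 3 * K ^ 2) + (2 * C + 4) / m * c * K ^ 2 + 6 * (c * K ^ 2) := by
    rw [momentumError]; ring
  rw [e3]
  linarith

end MomentumEvolution

/-! ### Almost monotonicity of the exterior current. -/

section MomentumMonotonicity

variable {φ J : ℝ → E3 → ℂ} {D : ℝ → Fin 3 → E3 → ℂ} {f m m' c E : ℝ → ℝ} {C K ε s t R : ℝ}

theorem IsEvolution.momentum_moll (h : IsEvolution φ J D K) (hf : IsSmoothCutoff f)
    (hC : ∀ n < 3, ∀ l, |deriv^[n + 1] f l| ≤ C) (hs : 0 ≤ s) (hst : s ≤ t)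
    (hm : ∀ τ ∈ Icc s t, HasDerivAt m (m' τ) τ) (hmc : ContinuousOn m' (Icc s t))
    (hm2 : ∀ τ ∈ Icc s t, 2 ≤ m τ) (hmR : ∀ τ ∈ Icc s t, m τ ≤ R)
    (hc0 : ∀ τ ∈ Icc s t, 0 ≤ c τ)
    (hc : ∀ᵐ τ, τ ∈ Icc s t → ∀ᵐ x, m τ / 4 ≤ ‖x‖ → ‖J τ x‖ ≤ c τ * ‖φ τ x‖)
    (hE : IntervalIntegrable E volume s t)
    (hEm : ∀ τ ∈ Icc s t, momentumError C K (c τ) R (m τ) (m' τ) ≤ E τ)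
    (hε : 0 < ε) (hε1 : ε ≤ 1 / 2) :
    -∫ τ in s..t, E τ ≤
      current (radialField (window f (m t) R 0)) (fun j => partialDeriv j (moll ε (φ t)))
          (moll ε (φ t))
        - current (radialField (window f (m s) R 0)) (fun j => partialDeriv j (moll ε (φ s)))
          (moll ε (φ s)) := by
  have hη := mollifier_isTestFunction hε
  have hS := isCompact_closedBall (0 : E3) R
  have hP := h.isPrimitiveOn hη (t := t) hs hS
  have hPk := fun k => h.isPrimitiveOn (hη.partialDeriv k) (t := t) hs hS
  have hk := fun k => hf.isWeight_window hm hmc hm2 hmR k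
  have hev := fun k => (hk k).evolution hst (hPk k) hP.conj
  set G : Fin 3 → ℝ → ℂ := fun k τ =>
    ∫ y, ((radialField (windowDt f (m τ) (m' τ)) k y : ℂ)
        * smear (φ τ) (partialDeriv k (molC ε)) y * (starRingEnd ℂ) (smear (φ τ) (molC ε) y)
        + (radialField (window f (m τ) R 0) k y : ℂ)
          * (smearRhs φ J (partialDeriv k (molC ε)) τ y
              * (starRingEnd ℂ) (smear (φ τ) (molC ε) y)
            + smear (φ τ) (partialDeriv k (molC ε)) y
              * (starRingEnd ℂ) (smearRhs φ J (molC ε) τ y))) with hG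
  have hGi : ∀ k, IntervalIntegrable (G k) volume s t := fun k => (hev k).1
  have hGe : ∀ k, _ = ∫ τ in s..t, G k τ := fun k => (hev k).2
  have hcur : ∀ τ ∈ Icc s t, current (radialField (window f (m τ) R 0))
      (fun j => partialDeriv j (moll ε (φ τ))) (moll ε (φ τ))
      = ∑ k, (∫ y, (radialField (window f (m τ) R 0) k y : ℂ)
        * smear (φ τ) (partialDeriv k (molC ε)) y
          * (starRingEnd ℂ) (smear (φ τ) (molC ε) y)).im := by
    intro τ hτ
    have hH := (h.isH1 τ (hs.trans hτ.1)).moll hε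
    refine Finset.sum_congr rfl fun k _ => ?_
    have hm0 : 0 < m τ := by linarith [hm2 τ hτ]
    have cW : Continuous (radialField (window f (m τ) R 0) k) := 
    continuous_slice (k := fun τ => radialField (window f (m τ) R 0) k)
      (hk k).cont hτ
    change ∫ x, radialField (window f (m τ) R 0) k x * (partialDeriv k (moll ε (φ τ)) x
      * (starRingEnd ℂ) (moll ε (φ τ) x)).im = _
    rw [integral_weight_im cW.aestronglyMeasurable (.of_forall fun y => abs_radialField_le
        (hf.abs_window_le_one hm0 (hmR τ hτ) (norm_nonneg _)) k) (hH.memLp_grad k) hH.memLp]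
    simp only [mul_assoc, moll,
      partialDeriv_smear ((h.isH1 τ (hs.trans hτ.1)).grad 0).1 hη]
  have hGim : ∀ k, IntervalIntegrable (fun τ => (G k τ).im) volume s t := fun k =>
    ⟨Complex.imCLM.integrable_comp (hGi k).1, Complex.imCLM.integrable_comp (hGi k).2⟩
  have hint : IntervalIntegrable (fun τ => ∑ k, (G k τ).im) volume s t := by
    have e : (fun τ => ∑ k, (G k τ).im) = ∑ k, fun τ => (G k τ).im := by
      ext τ; rw [Finset.sum_apply]
    rw [e]
    exact IntervalIntegrable.sum Finset.univ fun k _ => hGim k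
  have hdiff : current (radialField (window f (m t) R 0))
      (fun j => partialDeriv j (moll ε (φ t))) (moll ε (φ t))
      - current (radialField (window f (m s) R 0))
      (fun j => partialDeriv j (moll ε (φ s))) (moll ε (φ s))
      = ∫ τ in s..t, ∑ k, (G k τ).im := by
    rw [hcur t ⟨hst, le_rfl⟩, hcur s ⟨le_rfl, hst⟩, ← Finset.sum_sub_distrib,
      intervalIntegral.integral_finsetSum fun k _ => hGim k]
    refine Finset.sum_congr rfl fun k _ => ?_
    have := Complex.imCLM.intervalIntegral_comp_comm (hGi k)
    simp only [Complex.imCLM_apply] at this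
    rw [this, ← hGe k, Complex.sub_im]
  rw [hdiff, ← intervalIntegral.integral_neg]
  refine intervalIntegral.integral_mono_ae_restrict hst hE.neg hint ?_
  refine (ae_restrict_iff' measurableSet_Icc).mpr ?_
  filter_upwards [h.ae_locallyIntegrable, hc] with τ hJ hcτ hτ
  have hτ0 : 0 ≤ τ := hs.trans hτ.1
  have hJ := hJ hτ0
  have hH := h.isH1 τ hτ0
  have hφ := (hH.grad 0).1
  have h2 := hm2 τ hτ
  -- From ε ≤ 1/2 and m τ ≥ 2 follows ε ≤ m τ / 4, so points with |y| ≥ m/2 only see the source in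
  -- |x| ≥ m/4.
  have key := hf.momentum_slice hC h2 (hmR τ hτ) (m' τ) hH hJ hε (by linarith) (hc0 τ hτ)
    (hcτ hτ)
  refine (neg_le_neg (hEm τ hτ)).trans (key.trans_eq ?_)
  refine Finset.sum_congr rfl fun k _ => ?_
  have hUs : ContDiff ℝ ∞ (moll ε (φ τ)) := smear_contDiff hφ hη
  have hQs : ContDiff ℝ ∞ (moll ε (J τ)) := smear_contDiff hJ hη
  have c0 := hUs.continuous
  have c1 := partialDeriv_continuous (hUs.of_le (by norm_cast)) k
  have c2 := (rhs_contDiff hUs hQs).continuous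
  have c3 := partialDeriv_continuous ((rhs_contDiff hUs hQs).of_le (by norm_cast)) k
  have cW : Continuous (radialField (window f (m τ) R 0) k) := 
    continuous_slice (k := fun τ => radialField (window f (m τ) R 0) k)
      (hk k).cont hτ
  have cV : Continuous (radialField (windowDt f (m τ) (m' τ)) k) :=
    continuous_slice (k := fun τ => radialField (windowDt f (m τ) (m' τ)) k) (hk k).cont' hτ
  have sW : HasCompactSupport (radialField (window f (m τ) R 0) k) := HasCompactSupport.intro hS
    fun y hy => (hk k).zero τ hτ y (by simpa using hy)
  have sV : HasCompactSupport (radialField (windowDt f (m τ) (m' τ)) k) :=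
    HasCompactSupport.intro hS fun y hy => (hk k).zero' τ hτ y (by simpa using hy)
  have eG : G k τ = ∫ y, ((radialField (windowDt f (m τ) (m' τ)) k y : ℂ)
        * (partialDeriv k (moll ε (φ τ)) y * (starRingEnd ℂ) (moll ε (φ τ) y))
        + (radialField (window f (m τ) R 0) k y : ℂ)
          * (partialDeriv k (rhs (moll ε (φ τ)) (moll ε (J τ))) y
              * (starRingEnd ℂ) (moll ε (φ τ) y)
            + partialDeriv k (moll ε (φ τ)) y
              * (starRingEnd ℂ) (rhs (moll ε (φ τ)) (moll ε (J τ)) y))) := by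
    rw [hG]
    simp only [smearRhs_partialDeriv hφ hJ hη, smearRhs_eq_rhs hφ hη, mul_assoc, moll,
      partialDeriv_smear hφ hη]
  have hi : Integrable (fun y => ((radialField (windowDt f (m τ) (m' τ)) k y : ℂ)
        * (partialDeriv k (moll ε (φ τ)) y * (starRingEnd ℂ) (moll ε (φ τ) y))
        + (radialField (window f (m τ) R 0) k y : ℂ)
          * (partialDeriv k (rhs (moll ε (φ τ)) (moll ε (J τ))) y
              * (starRingEnd ℂ) (moll ε (φ τ) y)
            + partialDeriv k (moll ε (φ τ)) y
              * (starRingEnd ℂ) (rhs (moll ε (φ τ)) (moll ε (J τ)) y)))) volume := by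
    refine Continuous.integrable_of_hasCompactSupport (by fun_prop) ?_
    refine HasCompactSupport.intro hS fun y hy => ?_
    have hy : R < ‖y‖ := by simpa using hy
    rw [(hk k).zero τ hτ y hy, (hk k).zero' τ hτ y hy]; simp
  have := Complex.imCLM.integral_comp_comm hi
  simp only [Complex.imCLM_apply] at this
  rw [eG, ← this]
  refine integral_congr_ae (.of_forall fun y => ?_)
  simp only [Complex.add_im, Complex.im_ofReal_mul]

/-- The lower bound for mollifications is already free of ε, so only the currents at the two end
times have to converge. -/
theorem IsEvolution.momentum_window (h : IsEvolution φ J D K) (hf : IsSmoothCutoff f)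
    (hC : ∀ n < 3, ∀ l, |deriv^[n + 1] f l| ≤ C) (hs : 0 ≤ s) (hst : s ≤ t)
    (hm : ∀ τ ∈ Icc s t, HasDerivAt m (m' τ) τ) (hmc : ContinuousOn m' (Icc s t))
    (hm2 : ∀ τ ∈ Icc s t, 2 ≤ m τ) (hmR : ∀ τ ∈ Icc s t, m τ ≤ R)
    (hc0 : ∀ τ ∈ Icc s t, 0 ≤ c τ)
    (hc : ∀ᵐ τ, τ ∈ Icc s t → ∀ᵐ x, m τ / 4 ≤ ‖x‖ → ‖J τ x‖ ≤ c τ * ‖φ τ x‖)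
    (hE : IntervalIntegrable E volume s t)
    (hEm : ∀ τ ∈ Icc s t, momentumError C K (c τ) R (m τ) (m' τ) ≤ E τ) :
    -∫ τ in s..t, E τ ≤ current (radialField (window f (m t) R 0)) (D t) (φ t)
        - current (radialField (window f (m s) R 0)) (D s) (φ s) := by
  have hl : ∀ τ ∈ Icc s t, Tendsto (fun ε => current (radialField (window f (m τ) R 0))
      (fun j => partialDeriv j (moll ε (φ τ))) (moll ε (φ τ))) (𝓝[>] 0)
      (𝓝 (current (radialField (window f (m τ) R 0)) (D τ) (φ τ))) := fun τ hτ =>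
    (h.isH1 τ (hs.trans hτ.1)).tendsto_current (B := 1)
      (fun k => (continuous_slice (k := fun τ => radialField (window f (m τ) R 0) k)
        (hf.isWeight_window hm hmc hm2 hmR k).cont hτ).aestronglyMeasurable)
      fun k => .of_forall fun y => abs_radialField_le
        (hf.abs_window_le_one (by linarith [hm2 τ hτ]) (hmR τ hτ) (norm_nonneg _)) k
  refine ge_of_tendsto ((hl t ⟨hst, le_rfl⟩).sub (hl s ⟨le_rfl, hst⟩)) ?_
  filter_upwards [Ioc_mem_nhdsGT (show (0 : ℝ) < 1 / 2 by norm_num)] with ε hε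
  exact h.momentum_moll hf hC hs hst hm hmc hm2 hmR hc0 hc hE hEm hε.1 hε.2

theorem tendsto_current_of_pointwise {ι : Type*} {l : Filter ι} [l.IsCountablyGenerated]
    {u : E3 → ℂ} {D : Fin 3 → E3 → ℂ} {V : ι → Fin 3 → E3 → ℝ} {W : Fin 3 → E3 → ℝ} {B : ℝ}
    (h : IsH1 u D K) (hV : ∀ᶠ i in l, ∀ k, AEStronglyMeasurable (V i k) volume)
    (hB : ∀ᶠ i in l, ∀ k x, |V i k x| ≤ B)
    (hlim : ∀ k x, Tendsto (fun i => V i k x) l (𝓝 (W k x))) :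
    Tendsto (fun i => current (V i) D u) l (𝓝 (current W D u)) := by
  refine tendsto_finsetSum _ fun k _ => ?_
  refine tendsto_integral_filter_of_dominated_convergence
    (fun x => B * (‖D k x‖ * ‖u x‖)) ?_ ?_
    ((integrable_norm_mul_norm (h.memLp_grad k) h.memLp).const_mul B)
    (.of_forall fun x => (hlim k x).mul_const _)
  · filter_upwards [hV] with i hi
    exact (hi k).mul (Complex.continuous_im.comp_aestronglyMeasurable
      ((h.memLp_grad k).1.mul (Complex.continuous_conj.comp_aestronglyMeasurable h.memLp.1)))
  · filter_upwards [hB] with i hi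
    refine .of_forall fun x => ?_
    rw [norm_mul, Real.norm_eq_abs, Real.norm_eq_abs]
    have : |(D k x * (starRingEnd ℂ) (u x)).im| ≤ ‖D k x‖ * ‖u x‖ := by
      refine (Complex.abs_im_le_norm _).trans ?_
      rw [norm_mul, RCLike.norm_conj]
    exact mul_le_mul (hi k x) this (abs_nonneg _) ((abs_nonneg _).trans (hi k x))

/-- The exterior current `∑ₖ ∫ f(|x| / μ) (xₖ / |x|) Im (∂ₖu ū)`. -/
def exteriorCurrent (f : ℝ → ℝ) (μ : ℝ) (D : Fin 3 → E3 → ℂ) (u : E3 → ℂ) : ℝ :=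
  current (radialField fun r => f (r / μ)) D u

theorem measurable_radialField {g : ℝ → ℝ} (hg : Continuous g) (k : Fin 3) :
    AEStronglyMeasurable (radialField g k) volume := by
  have : Measurable (radialField g k) := by
    refine (hg.measurable.comp measurable_norm).mul (Measurable.div ?_ measurable_norm)
    exact (by fun_prop : Continuous fun x : E3 => x k).measurable
  exact this.aestronglyMeasurable

/-- At each point the outer factor f(|x|/R) is zero once R ≥ 2|x|, so the window increases to the
full exterior cutoff. -/
theorem IsSmoothCutoff.tendsto_current_window (hf : IsSmoothCutoff f) {μ : ℝ} (hμ : 0 < μ)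
    {u : E3 → ℂ} {D : Fin 3 → E3 → ℂ} (h : IsH1 u D K) :
    Tendsto (fun R => current (radialField (window f μ R 0)) D u) atTop
      (𝓝 (exteriorCurrent f μ D u)) := by
  refine tendsto_current_of_pointwise (B := 1) h (.of_forall fun R k =>
    measurable_radialField (hf.window_contDiff μ R 0).continuous k) ?_ fun k x => ?_
  · filter_upwards [eventually_ge_atTop μ] with R hR k x
    exact abs_radialField_le (hf.abs_window_le_one hμ hR (norm_nonneg _)) k
  · refine tendsto_const_nhds.congr' ?_
    filter_upwards [eventually_ge_atTop (2 * ‖x‖), eventually_gt_atTop 0] with R hR hR0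
    rw [radialField, radialField, window_zero, hf.eq_zero (‖x‖ / R), sub_zero]
    rw [div_le_iff₀ hR0]; linarith

/-- Almost monotonicity of the exterior current. -/
theorem IsEvolution.exteriorCurrent_sub_ge (h : IsEvolution φ J D K) (hf : IsSmoothCutoff f)
    (hC : ∀ n < 3, ∀ l, |deriv^[n + 1] f l| ≤ C) (hs : 0 ≤ s) (hst : s ≤ t)
    (hm : ∀ τ ∈ Icc s t, HasDerivAt m (m' τ) τ) (hmc : ContinuousOn m' (Icc s t))
    (hm2 : ∀ τ ∈ Icc s t, 2 ≤ m τ) (hc0 : ∀ τ ∈ Icc s t, 0 ≤ c τ)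
    (hc : ∀ᵐ τ, τ ∈ Icc s t → ∀ᵐ x, m τ / 4 ≤ ‖x‖ → ‖J τ x‖ ≤ c τ * ‖φ τ x‖)
    (hE : IntervalIntegrable E volume s t)
    (hEm : ∀ τ ∈ Icc s t, (C * m' τ ^ 2 / m τ + 9 * C / m τ ^ 3 + (2 * C + 4) / m τ * c τ
      + 6 * c τ) * K ^ 2 ≤ E τ) :
    -∫ τ in s..t, E τ ≤ exteriorCurrent f (m t) (D t) (φ t)
      - exteriorCurrent f (m s) (D s) (φ s) := by
  have htI : t ∈ Icc s t := ⟨hst, le_rfl⟩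
  have hsI : s ∈ Icc s t := ⟨le_rfl, hst⟩
  have hl : ∀ τ ∈ Icc s t, _ := fun τ hτ =>
    hf.tendsto_current_window (by linarith [hm2 τ hτ] : 0 < m τ) (h.isH1 τ (hs.trans hτ.1))
  obtain ⟨M, hM⟩ := isCompact_Icc.exists_bound_of_continuousOn (s := Icc s t) (f := m)
    fun τ hτ => (hm τ hτ).continuousAt.continuousWithinAt
  -- The outer-edge error 6CK²/R is constant in time and disappears as R → ∞ on the fixed interval.
  have l0 : Tendsto (fun R : ℝ => -(∫ τ in s..t, E τ) - (t - s) * (6 * C * K ^ 2 * R⁻¹)) atTop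
      (𝓝 (-∫ τ in s..t, E τ)) := by
    have := ((tendsto_inv_atTop_zero (𝕜 := ℝ)).const_mul (6 * C * K ^ 2)).const_mul (t - s)
    simpa using tendsto_const_nhds.sub this
  refine le_of_tendsto_of_tendsto l0 ((hl t htI).sub (hl s hsI)) ?_
  filter_upwards [eventually_ge_atTop M, eventually_gt_atTop 0] with R hR hR0
  have key := h.momentum_window (R := R) (E := fun τ => E τ + 6 * C * K ^ 2 * R⁻¹) hf hC hs hst
    hm hmc hm2 (fun τ hτ => (le_abs_self _).trans ((hM τ hτ).trans hR)) hc0 hc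
    (hE.add intervalIntegrable_const) fun τ hτ => by
      have e : momentumError C K (c τ) R (m τ) (m' τ) = (C * m' τ ^ 2 / m τ + 9 * C / m τ ^ 3
        + (2 * C + 4) / m τ * c τ + 6 * c τ) * K ^ 2 + 6 * C * K ^ 2 * R⁻¹ := by
        rw [momentumError]; ring
      rw [e]; linarith [hEm τ hτ]
  rw [intervalIntegral.integral_add hE intervalIntegrable_const,
    intervalIntegral.integral_const, smul_eq_mul] at key
  linarith

end MomentumMonotonicity

/-! ### Truncated first moments. -/

section Moment

variable {φ J : ℝ → E3 → ℂ} {D : ℝ → Fin 3 → E3 → ℂ} {f m m' : ℝ → ℝ} {C K s t R μ r : ℝ}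

/-- The truncation at radius `R` of the smoothed modulus `μ Γ(r / μ)`, `Γ' = f`. -/
def cutPrimitive (f : ℝ → ℝ) (μ R r : ℝ) : ℝ := μ * primitive f (r / μ) * (1 - f (r / R))

/-- The derivative of `μ Γ(r / μ)` in `μ`. -/
def primitiveDt (f : ℝ → ℝ) (l : ℝ) : ℝ := primitive f l - l * f l

theorem IsSmoothCutoff.cutPrimitive_eq_zero_of_le (hf : IsSmoothCutoff f) (hμ : 2 ≤ μ)
    (hr : r ≤ 1) : cutPrimitive f μ R r = 0 := by
  rw [cutPrimitive, hf.primitive_eq_zero]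
  · simp
  · rw [div_le_iff₀ (by linarith)]; linarith

theorem IsSmoothCutoff.cutPrimitive_eq_zero_of_ge (hf : IsSmoothCutoff f) (hR : 0 < R)
    (hr : R ≤ r) : cutPrimitive f μ R r = 0 := by
  rw [cutPrimitive, hf.eq_one (r / R)]
  · simp
  · rwa [one_le_div hR]

theorem IsSmoothCutoff.mul_primitive_nonneg (hf : IsSmoothCutoff f) (hμ : 0 < μ) (hr : 0 ≤ r) :
    0 ≤ μ * primitive f (r / μ) :=
  mul_nonneg hμ.le (hf.primitive_nonneg (by positivity))

theorem IsSmoothCutoff.mul_primitive_le (hf : IsSmoothCutoff f) (hμ : 0 < μ) (hr : 0 ≤ r) :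
    μ * primitive f (r / μ) ≤ r := by
  have h1 := hf.primitive_le (l := r / μ) (by positivity)
  have h2 : r / μ * f (r / μ) ≤ r / μ :=
    mul_le_of_le_one_right (by positivity) (hf.le_one _)
  calc μ * primitive f (r / μ) ≤ μ * (r / μ) := by gcongr; exact h1.trans h2
    _ = r := by field_simp

theorem IsSmoothCutoff.sub_le_mul_primitive (hf : IsSmoothCutoff f) (hμ : 0 < μ) (hr : 0 ≤ r) :
    r - μ ≤ μ * primitive f (r / μ) := by
  have h1 := hf.le_primitive (l := r / μ) (by positivity)
  calc r - μ = μ * (r / μ - 1) := by field_simp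
    _ ≤ _ := by gcongr

/-- From l - 1 ≤ Γ(l) ≤ l f(l) ≤ l. Hence moving the scale μ changes the smoothed moment at rate at
most |μ'| times the mass. -/
theorem IsSmoothCutoff.abs_primitiveDt_le (hf : IsSmoothCutoff f) {l : ℝ} (hl : 0 ≤ l) :
    |primitiveDt f l| ≤ 1 := by
  have h1 := hf.primitive_le hl
  have h2 := hf.le_primitive hl
  have h3 : l * f l ≤ l := mul_le_of_le_one_right hl (hf.le_one _)
  rw [primitiveDt, abs_le]
  constructor <;> linarith

theorem IsSmoothCutoff.hasDerivAt_cutPrimitive (hf : IsSmoothCutoff f) (hμ : μ ≠ 0) (r : ℝ) :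
    HasDerivAt (cutPrimitive f μ R) (f (r / μ) * (1 - f (r / R))
      - μ * primitive f (r / μ) * (deriv f (r / R) / R)) r := by
  have h1 : HasDerivAt (fun r => primitive f (r / μ)) (f (r / μ) * (1 / μ)) r :=
    HasDerivAt.comp (h₂ := primitive f) r (hf.hasDerivAt_primitive (r / μ)) ((hasDerivAt_id r).div_const μ)
  have h2 : HasDerivAt (fun r => f (r / R)) (deriv f (r / R) * (1 / R)) r :=
    (hf.hasDerivAt (r / R)).comp r ((hasDerivAt_id r).div_const R)
  have h3 := (h1.const_mul μ).mul (h2.const_sub 1)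
  refine h3.congr_deriv ?_
  field_simp
  ring

theorem IsSmoothCutoff.cutPrimitive_contDiff (hf : IsSmoothCutoff f) (μ R : ℝ) :
    ContDiff ℝ 1 (cutPrimitive f μ R) := by
  have h1 : ContDiff ℝ 1 f := hf.smooth.of_le (by norm_cast)
  have h2 : ContDiff ℝ 1 (fun r => primitive f (r / μ)) :=
    hf.primitive_contDiff.comp (contDiff_id.div_const μ)
  have h3 : ContDiff ℝ 1 (fun r => f (r / R)) := h1.comp (contDiff_id.div_const R)
  exact (contDiff_const.mul h2).mul (contDiff_const.sub h3)

theorem IsSmoothCutoff.vanishesNear_cutPrimitive (hf : IsSmoothCutoff f) (hμ : 2 ≤ μ) :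
    VanishesNear (cutPrimitive f μ R) :=
  ⟨1, one_pos, fun _ hr => hf.cutPrimitive_eq_zero_of_le hμ hr⟩

/-- The truncation contributes f'(r/R)/R, supported in r ≤ R, where μΓ(r/μ) ≤ r ≤ R. The bound is
therefore uniform in both μ and R. -/
theorem IsSmoothCutoff.abs_deriv_cutPrimitive_le (hf : IsSmoothCutoff f)
    (hC : ∀ n < 3, ∀ l, |deriv^[n + 1] f l| ≤ C) (hμ : 0 < μ) (hR : 0 < R) (hr : 0 ≤ r) :
    |deriv (cutPrimitive f μ R) r| ≤ 1 + C := by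
  rw [(hf.hasDerivAt_cutPrimitive hμ.ne' r).deriv]
  have hC0 : 0 ≤ C := (abs_nonneg _).trans (hC 0 (by norm_num) 0)
  have a1 : |f (r / μ) * (1 - f (r / R))| ≤ 1 := by
    rw [abs_mul, abs_of_nonneg (hf.nonneg _),
      abs_of_nonneg (by linarith [hf.le_one (r / R)])]
    exact mul_le_one₀ (hf.le_one _) (by linarith [hf.le_one (r / R)])
      (by linarith [hf.nonneg (r / R)])
  have a2 : |μ * primitive f (r / μ) * (deriv f (r / R) / R)| ≤ C := by
    rcases le_or_gt r R with h | h
    · rw [abs_mul, abs_of_nonneg (hf.mul_primitive_nonneg hμ hr), abs_div, abs_of_pos hR]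
      have h1 := hf.mul_primitive_le hμ hr
      calc _ ≤ R * (C / R) := by
            gcongr
            · exact h1.trans h
            · exact hC 0 (by norm_num) _
        _ = C := by field_simp
    · have : deriv f (r / R) = 0 := hf.iterate_eq_zero 0 fun hh =>
        absurd hh.2 (not_le.mpr (by rw [lt_div_iff₀ hR]; linarith))
      rw [this]; simpa using hC0
  refine (abs_sub _ _).trans (add_le_add a1 a2)

theorem IsSmoothCutoff.isWeight_cutPrimitive (hf : IsSmoothCutoff f)
    (hm : ∀ τ ∈ Icc s t, HasDerivAt m (m' τ) τ) (hmc : ContinuousOn m' (Icc s t))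
    (hm2 : ∀ τ ∈ Icc s t, 2 ≤ m τ) (hR : 0 < R) :
    IsWeight (fun τ y => cutPrimitive f (m τ) R ‖y‖)
      (fun τ y => primitiveDt f (‖y‖ / m τ) * m' τ * (1 - f (‖y‖ / R))) s t R := by
  have hcm : ContinuousOn (fun p : ℝ × E3 => m p.1) (Icc s t ×ˢ univ) :=
    ContinuousOn.comp (t := Icc s t)
      (fun τ hτ => (hm τ hτ).continuousAt.continuousWithinAt) continuousOn_fst fun p hp => hp.1
  have hcm' : ContinuousOn (fun p : ℝ × E3 => m' p.1) (Icc s t ×ˢ univ) :=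
    hmc.comp continuousOn_fst fun p hp => hp.1
  have hcl : ContinuousOn (fun p : ℝ × E3 => ‖p.2‖ / m p.1) (Icc s t ×ˢ univ) :=
    continuous_snd.norm.continuousOn.div hcm fun p hp => by linarith [hm2 p.1 hp.1]
  have hcp := hf.primitive_contDiff.continuous.comp_continuousOn hcl
  have hcf := hf.smooth.continuous.comp_continuousOn hcl
  have hcR : ContinuousOn (fun p : ℝ × E3 => 1 - f (‖p.2‖ / R)) (Icc s t ×ˢ univ) :=
    (continuous_const.sub (hf.smooth.continuous.comp
      (by fun_prop : Continuous fun p : ℝ × E3 => ‖p.2‖ / R))).continuousOn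
  refine ⟨fun y τ hτ => ?_, (hcm.mul hcp).mul hcR, ((hcp.sub (hcl.mul hcf)).mul hcm').mul hcR,
    fun τ hτ y hy => hf.cutPrimitive_eq_zero_of_ge hR hy.le, fun τ hτ y hy => ?_⟩
  · have hm0 : m τ ≠ 0 := by linarith [hm2 τ hτ]
    have h1 : HasDerivAt (fun τ => ‖y‖ / m τ) ((0 * m τ - ‖y‖ * m' τ) / m τ ^ 2) τ :=
      (hasDerivAt_const τ ‖y‖).div (hm τ hτ) hm0
    have h2 : HasDerivAt (fun τ => primitive f (‖y‖ / m τ)) _ τ :=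
      HasDerivAt.comp (h₂ := primitive f) τ (hf.hasDerivAt_primitive (‖y‖ / m τ)) h1
    have h3 := ((hm τ hτ).mul h2).mul_const (1 - f (‖y‖ / R))
    refine h3.congr_deriv ?_
    rw [primitiveDt]
    field_simp
    ring
  · rw [hf.eq_one (‖y‖ / R) (by rw [one_le_div hR]; exact hy.le)]; simp

/-- The smoothed first moment `∫ μ Γ(|x| / μ) |u|²`. -/
def smoothMoment (f : ℝ → ℝ) (μ : ℝ) (u : E3 → ℂ) : ℝ :=
  mass (fun x => μ * primitive f (‖x‖ / μ)) u

theorem IsSmoothCutoff.tendsto_cutPrimitive (hf : IsSmoothCutoff f) (g r : ℝ) :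
    ∀ᶠ R in atTop, g * (1 - f (r / R)) = g := by
  filter_upwards [eventually_ge_atTop (2 * r), eventually_gt_atTop 0] with R hR hR0
  rw [hf.eq_zero (r / R), sub_zero, mul_one]
  rw [div_le_iff₀ hR0]; linarith

/-- This is `mass_evolution` for a compactly supported weight. The condition m ≥ 2 makes the weight
vanish in the unit ball. -/
theorem IsEvolution.cutMoment_evolution (h : IsEvolution φ J D K) (hf : IsSmoothCutoff f)
    (hC : ∀ n < 3, ∀ l, |deriv^[n + 1] f l| ≤ C) (hs : 0 ≤ s) (hst : s ≤ t)
    (hm : ∀ τ ∈ Icc s t, HasDerivAt m (m' τ) τ) (hmc : ContinuousOn m' (Icc s t))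
    (hm2 : ∀ τ ∈ Icc s t, 2 ≤ m τ) (hR : 0 < R)
    (hrad : ∀ τ, 0 ≤ τ → IsRadial (φ τ))
    (hreal : ∀ᵐ τ, 0 ≤ τ → ∀ᵐ x, (J τ x * (starRingEnd ℂ) (φ τ x)).im = 0) :
    IntervalIntegrable (fun τ =>
      mass (fun y => primitiveDt f (‖y‖ / m τ) * m' τ * (1 - f (‖y‖ / R))) (φ τ)
      + 2 * current (radialField (deriv (cutPrimitive f (m τ) R))) (D τ) (φ τ)) volume s t ∧
    mass (fun y => cutPrimitive f (m t) R ‖y‖) (φ t)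
        - mass (fun y => cutPrimitive f (m s) R ‖y‖) (φ s)
      = ∫ τ in s..t,
        (mass (fun y => primitiveDt f (‖y‖ / m τ) * m' τ * (1 - f (‖y‖ / R))) (φ τ)
        + 2 * current (radialField (deriv (cutPrimitive f (m τ) R))) (D τ) (φ τ)) := by
  have hp : ∀ τ ∈ Icc s t, ∀ j y, partialDeriv j (fun y => cutPrimitive f (m τ) R ‖y‖) y
      = radialField (deriv (cutPrimitive f (m τ) R)) j y := fun τ hτ j y =>
    (hf.vanishesNear_cutPrimitive (hm2 τ hτ)).partialDeriv_radial
      ((hf.cutPrimitive_contDiff _ _).differentiable (by norm_num)) j y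
  have key := h.mass_evolution (B := 1 + C) (hf.isWeight_cutPrimitive hm hmc hm2 hR) hs hst
    (fun τ hτ => (hf.vanishesNear_cutPrimitive (hm2 τ hτ)).contDiff_radial
      (hf.cutPrimitive_contDiff _ _))
    (fun τ hτ y hy => hf.cutPrimitive_eq_zero_of_le (hm2 τ hτ) hy.le)
    (fun τ hτ j y => by
      rw [hp τ hτ]
      exact abs_radialField_le (hf.abs_deriv_cutPrimitive_le hC (by linarith [hm2 τ hτ]) hR
        (norm_nonneg _)) j) hrad hreal
  have e : EqOn (fun τ =>
      mass (fun y => primitiveDt f (‖y‖ / m τ) * m' τ * (1 - f (‖y‖ / R))) (φ τ)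
      + 2 * current (fun j => partialDeriv j (fun y => cutPrimitive f (m τ) R ‖y‖)) (D τ) (φ τ))
      (fun τ =>
      mass (fun y => primitiveDt f (‖y‖ / m τ) * m' τ * (1 - f (‖y‖ / R))) (φ τ)
      + 2 * current (radialField (deriv (cutPrimitive f (m τ) R))) (D τ) (φ τ)) (Icc s t) := by
    intro τ hτ
    have : (fun j => partialDeriv j (fun y => cutPrimitive f (m τ) R ‖y‖))
        = radialField (deriv (cutPrimitive f (m τ) R)) := by
      ext j y; exact hp τ hτ j y
    simp only [this]
  refine ⟨key.1.congr fun τ hτ => e ?_, key.2.trans (intervalIntegral.integral_congr ?_)⟩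
  · rw [uIoc_of_le hst] at hτ; exact Ioc_subset_Icc_self hτ
  · rw [uIcc_of_le hst]; exact e

theorem IsSmoothCutoff.abs_current_cutPrimitive_le (hf : IsSmoothCutoff f)
    (hC : ∀ n < 3, ∀ l, |deriv^[n + 1] f l| ≤ C) (hμ : 0 < μ) (hR : 0 < R) {u : E3 → ℂ}
    {D : Fin 3 → E3 → ℂ} (h : IsH1 u D K) :
    |current (radialField (deriv (cutPrimitive f μ R))) D u| ≤ 3 * (1 + C) * K ^ 2 :=
  abs_current_le (fun k => measurable_radialField
      ((hf.cutPrimitive_contDiff μ R).continuous_deriv (by norm_num)) k)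
    (fun k => .of_forall fun y => abs_radialField_le
      (hf.abs_deriv_cutPrimitive_le hC hμ hR (norm_nonneg _)) k) h

theorem IsSmoothCutoff.tendsto_current_cutPrimitive (hf : IsSmoothCutoff f)
    (hC : ∀ n < 3, ∀ l, |deriv^[n + 1] f l| ≤ C) (hμ : 0 < μ) {u : E3 → ℂ}
    {D : Fin 3 → E3 → ℂ} (h : IsH1 u D K) :
    Tendsto (fun R => current (radialField (deriv (cutPrimitive f μ R))) D u) atTop
      (𝓝 (exteriorCurrent f μ D u)) := by
  refine tendsto_current_of_pointwise (B := 1 + C) h (.of_forall fun R k =>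
    measurable_radialField ((hf.cutPrimitive_contDiff μ R).continuous_deriv (by norm_num)) k)
    ?_ fun k x => ?_
  · filter_upwards [eventually_gt_atTop 0] with R hR k x
    exact abs_radialField_le (hf.abs_deriv_cutPrimitive_le hC hμ hR (norm_nonneg _)) k
  · refine tendsto_const_nhds.congr' ?_
    filter_upwards [eventually_ge_atTop (2 * ‖x‖), eventually_gt_atTop 0] with R hR hR0
    have hl : ‖x‖ / R ≤ 1 / 2 := by rw [div_le_iff₀ hR0]; linarith
    rw [radialField, radialField, (hf.hasDerivAt_cutPrimitive hμ.ne' _).deriv,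
      hf.eq_zero _ hl, hf.deriv_eq_zero_of_lt hl]
    simp

end Moment

/-! ### Finiteness and evolution of the first moment. -/

section MomentEvolution

variable {φ J : ℝ → E3 → ℂ} {D : ℝ → Fin 3 → E3 → ℂ} {f m m' : ℝ → ℝ} {C K s t R μ : ℝ}

/-- Fatou's lemma; it turns bounds on truncated moments, uniform in the truncation, into finiteness
of the moment. -/
theorem integrable_of_tendsto_of_integral_le {α : Type*} [MeasurableSpace α] {ν : Measure α}
    {G : ℕ → α → ℝ} {g : α → ℝ} {A : ℝ} (hG : ∀ n, Integrable (G n) ν)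
    (h0 : ∀ n x, 0 ≤ G n x) (hA : ∀ n, ∫ x, G n x ∂ν ≤ A)
    (hlim : ∀ x, Tendsto (fun n => G n x) atTop (𝓝 (g x))) : Integrable g ν := by
  refine ⟨aestronglyMeasurable_of_tendsto_ae atTop (fun n => (hG n).1) (.of_forall hlim), ?_⟩
  have h1 : ∫⁻ x, ‖g x‖ₑ ∂ν ≤ liminf (fun n => ∫⁻ x, ‖G n x‖ₑ ∂ν) atTop := by
    have e : ∀ x, ‖g x‖ₑ = liminf (fun n => ‖G n x‖ₑ) atTop := fun x =>
      ((hlim x).enorm.liminf_eq).symm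
    simp only [e]
    exact lintegral_liminf_le' fun n => (hG n).1.aemeasurable.enorm
  have h2 : ∀ n, ∫⁻ x, ‖G n x‖ₑ ∂ν ≤ ENNReal.ofReal A := fun n => by
    have e : ∀ x, ‖G n x‖ₑ = ENNReal.ofReal (G n x) := fun x => by
      rw [← ofReal_norm, Real.norm_of_nonneg (h0 n x)]
    simp only [e]
    rw [← ofReal_integral_eq_lintegral_ofReal (hG n) (.of_forall (h0 n))]
    exact ENNReal.ofReal_le_ofReal (hA n)
  have h3 : liminf (fun n => ∫⁻ x, ‖G n x‖ₑ ∂ν) atTop ≤ ENNReal.ofReal A :=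
    liminf_le_of_frequently_le' (.of_forall h2)
  exact (h1.trans h3).trans_lt ENNReal.ofReal_lt_top

theorem integrable_mass {w : E3 → ℝ} {u : E3 → ℂ} {B : ℝ} (hw : AEStronglyMeasurable w volume)
    (hB : ∀ x, |w x| ≤ B) (hu : MemLp u 2 volume) :
    Integrable (fun x => w x * ‖u x‖ ^ 2) volume := by
  refine ((hu.integrable_norm_pow (by norm_num)).const_mul B).mono'
    (hw.mul (hu.1.norm.pow 2)) (.of_forall fun x => ?_)
  rw [norm_mul, Real.norm_eq_abs, Real.norm_of_nonneg (by positivity)]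
  exact mul_le_mul_of_nonneg_right (hB x) (by positivity)

theorem IsSmoothCutoff.cutPrimitive_nonneg (hf : IsSmoothCutoff f) (hμ : 0 < μ) {r : ℝ}
    (hr : 0 ≤ r) : 0 ≤ cutPrimitive f μ R r :=
  mul_nonneg (hf.mul_primitive_nonneg hμ hr) (by linarith [hf.le_one (r / R)])

theorem IsSmoothCutoff.cutPrimitive_le (hf : IsSmoothCutoff f) (hμ : 0 < μ) {r : ℝ}
    (hr : 0 ≤ r) : cutPrimitive f μ R r ≤ r :=
  (mul_le_of_le_one_right (hf.mul_primitive_nonneg hμ hr) (by linarith [hf.nonneg (r / R)])).trans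
    (hf.mul_primitive_le hμ hr)

theorem IsSmoothCutoff.abs_cutPrimitive_le (hf : IsSmoothCutoff f) (hμ : 0 < μ) (hR : 0 < R)
    {r : ℝ} (hr : 0 ≤ r) : |cutPrimitive f μ R r| ≤ R := by
  rw [abs_of_nonneg (hf.cutPrimitive_nonneg hμ hr)]
  rcases le_total r R with h | h
  · exact (hf.cutPrimitive_le hμ hr).trans h
  · rw [hf.cutPrimitive_eq_zero_of_ge hR h]; exact hR.le

theorem IsSmoothCutoff.integrable_smoothMoment (hf : IsSmoothCutoff f) (hμ : 0 < μ) {u : E3 → ℂ}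
    (hu : Integrable (fun x => ‖x‖ * ‖u x‖ ^ 2) volume) (hu2 : MemLp u 2 volume) :
    Integrable (fun x => μ * primitive f (‖x‖ / μ) * ‖u x‖ ^ 2) volume := by
  refine hu.mono' ?_ (.of_forall fun x => ?_)
  · refine Continuous.aestronglyMeasurable ?_ |>.mul (hu2.1.norm.pow 2)
    exact continuous_const.mul (hf.primitive_contDiff.continuous.comp (by fun_prop))
  · have := hf.mul_primitive_nonneg hμ (norm_nonneg x)
    rw [Real.norm_of_nonneg (by positivity)]
    exact mul_le_mul_of_nonneg_right (hf.mul_primitive_le hμ (norm_nonneg x)) (by positivity)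

theorem IsSmoothCutoff.smoothMoment_le (hf : IsSmoothCutoff f) (hμ : 0 < μ) {u : E3 → ℂ}
    (hu : Integrable (fun x => ‖x‖ * ‖u x‖ ^ 2) volume) (hu2 : MemLp u 2 volume) :
    smoothMoment f μ u ≤ ∫ x, ‖x‖ * ‖u x‖ ^ 2 :=
  integral_mono (hf.integrable_smoothMoment hμ hu hu2) hu fun x =>
    mul_le_mul_of_nonneg_right (hf.mul_primitive_le hμ (norm_nonneg x)) (by positivity)

/-- Since r ≤ μΓ(r/μ) + μ. Together with `smoothMoment_le` it shows that smoothed moments for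
different cutoffs and scales differ by at most K² times a scale. -/
theorem IsSmoothCutoff.le_smoothMoment (hf : IsSmoothCutoff f) (hμ : 0 < μ) {u : E3 → ℂ}
    {D : Fin 3 → E3 → ℂ}
    (hu : Integrable (fun x => ‖x‖ * ‖u x‖ ^ 2) volume) (h : IsH1 u D K) :
    ∫ x, ‖x‖ * ‖u x‖ ^ 2 ≤ smoothMoment f μ u + μ * K ^ 2 := by
  have i2 : Integrable (fun x => ‖u x‖ ^ 2) volume := h.memLp.integrable_norm_pow (by norm_num)
  have i1 := hf.integrable_smoothMoment hμ hu h.memLp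
  have h1 : ∫ x, ‖u x‖ ^ 2 ≤ K ^ 2 := by
    rw [integral_norm_sq h.memLp]
    exact pow_le_pow_left₀ (l2_nonneg _) h.l2_le 2
  have h2 : ∫ x, ‖x‖ * ‖u x‖ ^ 2
      ≤ ∫ x, (μ * primitive f (‖x‖ / μ) * ‖u x‖ ^ 2 + μ * ‖u x‖ ^ 2) := by
    refine integral_mono hu (i1.add (i2.const_mul μ)) fun x => ?_
    have := hf.sub_le_mul_primitive hμ (norm_nonneg x)
    have h3 : 0 ≤ ‖u x‖ ^ 2 := by positivity
    simp only
    nlinarith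
  rw [integral_add i1 (i2.const_mul μ), integral_const_mul] at h2
  refine h2.trans (add_le_add le_rfl ?_)
  gcongr

theorem IsSmoothCutoff.tendsto_mass_cutPrimitive (hf : IsSmoothCutoff f) (hμ : 0 < μ)
    {u : E3 → ℂ} (hu : Integrable (fun x => ‖x‖ * ‖u x‖ ^ 2) volume) (hu2 : MemLp u 2 volume) :
    Tendsto (fun R => mass (fun x => cutPrimitive f μ R ‖x‖) u) atTop
      (𝓝 (smoothMoment f μ u)) := by
  refine tendsto_integral_filter_of_dominated_convergence (fun x => ‖x‖ * ‖u x‖ ^ 2)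
    (.of_forall fun R => ?_) (.of_forall fun R => .of_forall fun x => ?_) hu
    (.of_forall fun x => ?_)
  · exact (((hf.cutPrimitive_contDiff μ R).continuous.comp continuous_norm).aestronglyMeasurable).mul
      (hu2.1.norm.pow 2)
  · have := hf.cutPrimitive_nonneg (R := R) hμ (norm_nonneg x)
    rw [Real.norm_of_nonneg (by positivity)]
    exact mul_le_mul_of_nonneg_right (hf.cutPrimitive_le hμ (norm_nonneg x)) (by positivity)
  · refine Tendsto.mul_const _ (tendsto_const_nhds.congr' ?_)
    exact (hf.tendsto_cutPrimitive _ _).mono fun R hR => hR.symm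

theorem IsSmoothCutoff.tendsto_mass_primitiveDt (hf : IsSmoothCutoff f) (hμ : 0 < μ) (μ' : ℝ)
    {u : E3 → ℂ} (hu2 : MemLp u 2 volume) :
    Tendsto (fun R => mass (fun y => primitiveDt f (‖y‖ / μ) * μ' * (1 - f (‖y‖ / R))) u) atTop
      (𝓝 (mass (fun y => primitiveDt f (‖y‖ / μ) * μ') u)) := by
  have i2 : Integrable (fun x => ‖u x‖ ^ 2) volume := hu2.integrable_norm_pow (by norm_num)
  have hc := hf.smooth.continuous
  have hp : Continuous (primitiveDt f) :=
    hf.primitive_contDiff.continuous.sub (continuous_id.mul hc)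
  refine tendsto_integral_filter_of_dominated_convergence (fun x => |μ'| * ‖u x‖ ^ 2)
    (.of_forall fun R => ?_) (.of_forall fun R => .of_forall fun x => ?_) (i2.const_mul _)
    (.of_forall fun x => ?_)
  · refine (Continuous.aestronglyMeasurable ?_).mul (hu2.1.norm.pow 2)
    exact ((hp.comp (by fun_prop)).mul continuous_const).mul
      (continuous_const.sub (hc.comp (by fun_prop)))
  · have h1 := hf.abs_primitiveDt_le (l := ‖x‖ / μ) (by positivity)
    have h2 : |1 - f (‖x‖ / R)| ≤ 1 := by
      rw [abs_le]; constructor <;> linarith [hf.le_one (‖x‖ / R), hf.nonneg (‖x‖ / R)]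
    rw [norm_mul, norm_mul, norm_mul, norm_pow, norm_norm]
    simp only [Real.norm_eq_abs]
    gcongr
    calc |primitiveDt f (‖x‖ / μ)| * |μ'| * |1 - f (‖x‖ / R)| ≤ 1 * |μ'| * 1 := by gcongr
      _ = |μ'| := by ring
  · refine Tendsto.mul_const _ (tendsto_const_nhds.congr' ?_)
    exact (hf.tendsto_cutPrimitive _ _).mono fun R hR => hR.symm

theorem IsSmoothCutoff.abs_mass_primitiveDt_le (hf : IsSmoothCutoff f) (hμ : 0 < μ) (μ' : ℝ)
    {u : E3 → ℂ} {D : Fin 3 → E3 → ℂ} (h : IsH1 u D K) :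
    |mass (fun y => primitiveDt f (‖y‖ / μ) * μ') u| ≤ |μ'| * K ^ 2 := by
  have hp : Continuous (primitiveDt f) :=
    hf.primitive_contDiff.continuous.sub (continuous_id.mul hf.smooth.continuous)
  refine abs_mass_le ?_ (.of_forall fun x => ?_) h
  · exact ((hp.comp (by fun_prop)).mul continuous_const).aestronglyMeasurable
  · rw [abs_mul]
    exact mul_le_of_le_one_left (abs_nonneg _) (hf.abs_primitiveDt_le (by positivity))

theorem IsSmoothCutoff.abs_mass_cut_primitiveDt_le (hf : IsSmoothCutoff f) (hμ : 0 < μ) (μ' R : ℝ)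
    {u : E3 → ℂ} {D : Fin 3 → E3 → ℂ} (h : IsH1 u D K) :
    |mass (fun y => primitiveDt f (‖y‖ / μ) * μ' * (1 - f (‖y‖ / R))) u| ≤ |μ'| * K ^ 2 := by
  have hc := hf.smooth.continuous
  have hp : Continuous (primitiveDt f) :=
    hf.primitive_contDiff.continuous.sub (continuous_id.mul hc)
  refine abs_mass_le ?_ (.of_forall fun x => ?_) h
  · exact (((hp.comp (by fun_prop)).mul continuous_const).mul
      (continuous_const.sub (hc.comp (by fun_prop)))).aestronglyMeasurable
  · have h1 := hf.abs_primitiveDt_le (l := ‖x‖ / μ) (by positivity)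
    have h2 : |1 - f (‖x‖ / R)| ≤ 1 := by
      rw [abs_le]; constructor <;> linarith [hf.le_one (‖x‖ / R), hf.nonneg (‖x‖ / R)]
    rw [abs_mul, abs_mul]
    calc |primitiveDt f (‖x‖ / μ)| * |μ'| * |1 - f (‖x‖ / R)| ≤ 1 * |μ'| * 1 := by gcongr
      _ = |μ'| := by ring

/-- The first moment stays finite. -/
theorem IsEvolution.integrable_moment (h : IsEvolution φ J D K) (hf : IsSmoothCutoff f)
    (hrad : ∀ τ, 0 ≤ τ → IsRadial (φ τ))
    (hreal : ∀ᵐ τ, 0 ≤ τ → ∀ᵐ x, (J τ x * (starRingEnd ℂ) (φ τ x)).im = 0)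
    (h0 : Integrable (fun x => ‖x‖ * ‖φ 0 x‖ ^ 2) volume) (ht : 0 ≤ t) :
    Integrable (fun x => ‖x‖ * ‖φ t x‖ ^ 2) volume := by
  obtain ⟨C, hC0, hC⟩ := hf.exists_bound
  have hH := h.isH1 t ht
  have hc : ∀ R, AEStronglyMeasurable (fun x : E3 => cutPrimitive f 2 R ‖x‖) volume := fun R =>
    ((hf.cutPrimitive_contDiff 2 R).continuous.comp continuous_norm).aestronglyMeasurable
  -- At the fixed scale 2 nothing moves, and the current is bounded uniformly in R; the truncated
  -- moment grows at most linearly in time, independently of R.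
  have hmass : ∀ R, 0 < R → mass (fun x => cutPrimitive f 2 R ‖x‖) (φ t)
      ≤ (∫ x, ‖x‖ * ‖φ 0 x‖ ^ 2) + t * (2 * (3 * (1 + C) * K ^ 2)) := by
    intro R hR
    obtain ⟨h1, h2⟩ := h.cutMoment_evolution (m := fun _ => 2) (m' := fun _ => 0) hf hC le_rfl ht
      (fun τ _ => hasDerivAt_const τ 2) continuousOn_const (fun _ _ => le_rfl) hR hrad hreal
    have h3 : mass (fun x => cutPrimitive f 2 R ‖x‖) (φ 0) ≤ ∫ x, ‖x‖ * ‖φ 0 x‖ ^ 2 :=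
      integral_mono (integrable_mass (hc R)
        (fun x => hf.abs_cutPrimitive_le two_pos hR (norm_nonneg x)) (h.isH1 0 le_rfl).memLp) h0
        fun x => mul_le_mul_of_nonneg_right (hf.cutPrimitive_le two_pos (norm_nonneg x))
          (by positivity)
    have h4 := intervalIntegral.integral_mono_on (g := fun _ => 2 * (3 * (1 + C) * K ^ 2)) ht h1
      intervalIntegrable_const fun τ hτ => by
        have h5 := (abs_le.mp (hf.abs_current_cutPrimitive_le hC two_pos hR (h.isH1 τ hτ.1))).2
        simp only [mul_zero, zero_mul, mass, integral_zero, zero_add]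
        linarith
    rw [intervalIntegral.integral_const, smul_eq_mul, sub_zero] at h4
    linarith
  have key : Integrable (fun x => 2 * primitive f (‖x‖ / 2) * ‖φ t x‖ ^ 2) volume := by
    refine integrable_of_tendsto_of_integral_le
      (G := fun n x => cutPrimitive f 2 ((n : ℝ) + 1) ‖x‖ * ‖φ t x‖ ^ 2)
      (fun n => integrable_mass (hc _)
        (fun x => hf.abs_cutPrimitive_le two_pos (by positivity) (norm_nonneg x)) hH.memLp)
      (fun n x => mul_nonneg (hf.cutPrimitive_nonneg two_pos (norm_nonneg x)) (by positivity))
      (fun n => hmass _ (by positivity)) fun x => ?_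
    refine Tendsto.mul_const _ (tendsto_const_nhds.congr' ?_)
    have l : Tendsto (fun n : ℕ => (n : ℝ) + 1) atTop atTop :=
      tendsto_atTop_add_const_right _ _ tendsto_natCast_atTop_atTop
    exact (l.eventually (hf.tendsto_cutPrimitive _ _)).mono fun n hn => hn.symm
  have i2 : Integrable (fun x => ‖φ t x‖ ^ 2) volume := hH.memLp.integrable_norm_pow (by norm_num)
  refine (key.add (i2.const_mul 2)).mono'
    (continuous_norm.aestronglyMeasurable.mul (hH.memLp.1.norm.pow 2)) (.of_forall fun x => ?_)
  have h3 := hf.sub_le_mul_primitive two_pos (norm_nonneg x)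
  have h4 : 0 ≤ ‖φ t x‖ ^ 2 := by positivity
  rw [Real.norm_of_nonneg (by positivity), Pi.add_apply]
  nlinarith

/-- The truncation radius is sent to infinity. The derivative of the truncated weight tends
pointwise to f(r/m), so the current becomes the exterior one, and finiteness of the moment handles
the end times. -/
theorem IsEvolution.smoothMoment_evolution (h : IsEvolution φ J D K) (hf : IsSmoothCutoff f)
    (hs : 0 ≤ s) (hst : s ≤ t)
    (hm : ∀ τ ∈ Icc s t, HasDerivAt m (m' τ) τ) (hmc : ContinuousOn m' (Icc s t))
    (hm2 : ∀ τ ∈ Icc s t, 2 ≤ m τ)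
    (hrad : ∀ τ, 0 ≤ τ → IsRadial (φ τ))
    (hreal : ∀ᵐ τ, 0 ≤ τ → ∀ᵐ x, (J τ x * (starRingEnd ℂ) (φ τ x)).im = 0)
    (h0 : Integrable (fun x => ‖x‖ * ‖φ 0 x‖ ^ 2) volume) :
    IntervalIntegrable (fun τ => mass (fun y => primitiveDt f (‖y‖ / m τ) * m' τ) (φ τ)
      + 2 * exteriorCurrent f (m τ) (D τ) (φ τ)) volume s t ∧
    smoothMoment f (m t) (φ t) - smoothMoment f (m s) (φ s)
      = ∫ τ in s..t, (mass (fun y => primitiveDt f (‖y‖ / m τ) * m' τ) (φ τ)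
        + 2 * exteriorCurrent f (m τ) (D τ) (φ τ)) := by
  obtain ⟨C, hC0, hC⟩ := hf.exists_bound
  obtain ⟨M, hM⟩ := isCompact_Icc.exists_bound_of_continuousOn hmc
  have hpos : ∀ τ ∈ Icc s t, 0 < m τ := fun τ hτ => by linarith [hm2 τ hτ]
  have hcut := fun (n : ℕ) => h.cutMoment_evolution hf hC hs hst hm hmc hm2
    (by positivity : 0 < (n : ℝ) + 1) hrad hreal
  have l : Tendsto (fun n : ℕ => (n : ℝ) + 1) atTop atTop :=
    tendsto_atTop_add_const_right _ _ tendsto_natCast_atTop_atTop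
  set H : ℕ → ℝ → ℝ := fun n τ =>
    mass (fun y => primitiveDt f (‖y‖ / m τ) * m' τ * (1 - f (‖y‖ / ((n : ℝ) + 1)))) (φ τ)
      + 2 * current (radialField (deriv (cutPrimitive f (m τ) ((n : ℝ) + 1)))) (D τ) (φ τ) with hH
  have hlim : ∀ τ ∈ Icc s t, Tendsto (fun n => H n τ) atTop
      (𝓝 (mass (fun y => primitiveDt f (‖y‖ / m τ) * m' τ) (φ τ)
      + 2 * exteriorCurrent f (m τ) (D τ) (φ τ))) := fun τ hτ =>
    ((hf.tendsto_mass_primitiveDt (hpos τ hτ) (m' τ) (h.isH1 τ (hs.trans hτ.1)).memLp).comp l).add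
      (((hf.tendsto_current_cutPrimitive hC (hpos τ hτ) (h.isH1 τ (hs.trans hτ.1))).comp
        l).const_mul 2)
  have hbound : ∀ n, ∀ τ ∈ Icc s t, ‖H n τ‖ ≤ M * K ^ 2 + 2 * (3 * (1 + C) * K ^ 2) := by
    intro n τ hτ
    have hτH := h.isH1 τ (hs.trans hτ.1)
    have b1 := hf.abs_mass_cut_primitiveDt_le (hpos τ hτ) (m' τ) ((n : ℝ) + 1) hτH
    have b2 := hf.abs_current_cutPrimitive_le hC (hpos τ hτ)
      (by positivity : 0 < (n : ℝ) + 1) hτH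
    have b3 := hM τ hτ
    rw [Real.norm_eq_abs] at b3 ⊢
    refine (abs_add_le _ _).trans (add_le_add (b1.trans (by gcongr)) ?_)
    rw [abs_mul, abs_two]; gcongr
  have hmem : ∀ {τ : ℝ}, τ ∈ uIoc s t → τ ∈ Icc s t := fun hτ => by
    rw [uIoc_of_le hst] at hτ; exact Ioc_subset_Icc_self hτ
  have hHm : ∀ n, AEStronglyMeasurable (H n) (volume.restrict (uIoc s t)) := fun n => by
    rw [uIoc_of_le hst]; exact (hcut n).1.1.aestronglyMeasurable
  have hconv := intervalIntegral.tendsto_integral_filter_of_dominated_convergence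
    (μ := volume) (a := s) (b := t) (F := H) (l := atTop)
    (fun _ => M * K ^ 2 + 2 * (3 * (1 + C) * K ^ 2)) (.of_forall hHm)
    (.of_forall fun n => .of_forall fun τ hm => hbound n τ (hmem hm)) intervalIntegrable_const
    (.of_forall fun τ hm => hlim τ (hmem hm))
  refine ⟨?_, ?_⟩
  · refine (intervalIntegrable_const (c := M * K ^ 2 + 2 * (3 * (1 + C) * K ^ 2))).mono_fun'
      (aestronglyMeasurable_of_tendsto_ae atTop hHm
        ((ae_restrict_iff' measurableSet_uIoc).mpr (.of_forall fun τ hm => hlim τ (hmem hm)))) ?_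
    refine (ae_restrict_iff' measurableSet_uIoc).mpr (.of_forall fun τ hm => ?_)
    exact le_of_tendsto ((hlim τ (hmem hm)).norm) (.of_forall fun n => hbound n τ (hmem hm))
  · have hmo : ∀ τ ∈ Icc s t, Tendsto (fun n : ℕ =>
        mass (fun x => cutPrimitive f (m τ) ((n : ℝ) + 1) ‖x‖) (φ τ)) atTop
        (𝓝 (smoothMoment f (m τ) (φ τ))) := fun τ hτ =>
      (hf.tendsto_mass_cutPrimitive (hpos τ hτ)
        (h.integrable_moment hf hrad hreal h0 (hs.trans hτ.1))
        (h.isH1 τ (hs.trans hτ.1)).memLp).comp l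
    refine tendsto_nhds_unique ((hmo t ⟨hst, le_rfl⟩).sub (hmo s ⟨le_rfl, hst⟩))
      (hconv.congr fun n => ?_)
    exact (hcut n).2.symm

end MomentEvolution

/-! ### From solutions to abstract evolutions. -/

section Solution

variable {N : ℝ → ℝ → ℝ → ℝ} {φ₀ : E3 → ℂ} {φ : ℝ → E3 → ℂ} {u : E3 → ℂ}

/-- The weak gradient. -/
abbrev weakGrad (u : E3 → ℂ) : Fin 3 → E3 → ℂ := fun j => weakDeriv j u

theorem hasWeakDeriv_weakDeriv {j : Fin 3} (h : ∃ v, HasWeakDeriv j u v) :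
    HasWeakDeriv j u (weakDeriv j u) := by
  rw [weakDeriv, dif_pos h]; exact h.choose_spec

theorem sq_le_h1Norm_sq (u : E3 → ℂ) :
    h1Norm u ^ 2 = eLpNorm u 2 volume ^ 2 + ∑ j, eLpNorm (weakDeriv j u) 2 volume ^ 2 := by
  rw [h1Norm, ← ENNReal.rpow_natCast, ← ENNReal.rpow_mul]
  norm_num

theorem MemH1.isH1 (h : MemH1 u) {M : ℝ≥0∞} (hM : M < ⊤) (hu : h1Norm u ≤ M) :
    IsH1 u (weakGrad u) M.toReal := by
  have h2 : ∀ {a : ℝ≥0∞}, a ^ 2 ≤ h1Norm u ^ 2 → a ≤ M := fun ha =>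
    ((ENNReal.pow_le_pow_left_iff two_ne_zero).mp ha).trans hu
  have e := sq_le_h1Norm_sq u
  have h0 : eLpNorm u 2 volume ≤ M := h2 (e ▸ le_self_add)
  have h1 : ∀ j, eLpNorm (weakDeriv j u) 2 volume ≤ M := fun j => h2 <| by
    rw [e]
    exact (Finset.single_le_sum (f := fun j => eLpNorm (weakDeriv j u) 2 volume ^ 2)
      (fun _ _ => zero_le) (Finset.mem_univ j)).trans le_add_self
  have hw : ∀ j, HasWeakDeriv j u (weakDeriv j u) := fun j =>
    hasWeakDeriv_weakDeriv ⟨_, (h.2 j).choose_spec.1⟩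
  exact ⟨h.1, hw, fun j => ⟨(hw j).2.1.aestronglyMeasurable, (h1 j).trans_lt hM⟩,
    ENNReal.toReal_mono hM.ne h0, fun j => ENNReal.toReal_mono hM.ne (h1 j)⟩

theorem im_interaction_mul_conj (N : ℝ → ℝ → ℝ → ℝ) (φ : ℝ → E3 → ℂ) (τ : ℝ) (x : E3) :
    (interaction N φ τ x * (starRingEnd ℂ) (φ τ x)).im = 0 := by
  rw [interaction, mul_assoc, Complex.mul_conj, ← Complex.ofReal_mul, Complex.ofReal_im]

/-- A solution bounded in `H¹` is an evolution with a measurable source. -/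
theorem IsGlobalSolution.exists_evolution (hφ : IsGlobalSolution N φ₀ φ)
    (hbound : (⨆ t ∈ Ici (0 : ℝ), h1Norm (φ t)) < ⊤) :
    ∃ (J : ℝ → E3 → ℂ) (K : ℝ), IsEvolution φ J (fun t => weakGrad (φ t)) K ∧
      ∀ᵐ τ, 0 ≤ τ → J τ =ᵐ[volume] interaction N φ τ := by
  have hm : AEStronglyMeasurable (fun z : ℝ × E3 => interaction N φ z.1 z.2)
      (volume.restrict (Ici (0 : ℝ) ×ˢ (univ : Set E3))) := hφ.integrable.aestronglyMeasurable
  -- A strongly measurable representative of the interaction, so that its convolutions are jointly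
  -- measurable in time and space.
  set J : ℝ → E3 → ℂ := fun t x => hm.mk _ (t, x) with hJ
  have hae : ∀ᵐ z : ℝ × E3 ∂volume.restrict (Ici (0 : ℝ) ×ˢ (univ : Set E3)),
      interaction N φ z.1 z.2 = J z.1 z.2 := hm.ae_eq_mk
  have hslice : ∀ᵐ τ, 0 ≤ τ → J τ =ᵐ[volume] interaction N φ τ := by
    rw [Measure.volume_eq_prod, ← Measure.prod_restrict, Measure.restrict_univ] at hae
    have := Measure.ae_ae_of_ae_prod hae
    rw [ae_restrict_iff' measurableSet_Ici] at this
    filter_upwards [this] with τ h1 h2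
    exact (h1 h2).mono fun x hx => hx.symm
  have hH : ∀ t, 0 ≤ t → IsH1 (φ t) (weakGrad (φ t))
      (⨆ t ∈ Ici (0 : ℝ), h1Norm (φ t)).toReal := fun t ht =>
    (hφ.memH1 t ht).isH1 hbound (le_iSup₂ (f := fun t (_ : t ∈ Ici (0 : ℝ)) => h1Norm (φ t)) t ht)
  have hint : ∀ T R, IntegrableOn (fun p : ℝ × E3 => J p.1 p.2)
      (Icc 0 T ×ˢ Metric.closedBall 0 R) volume := by
    intro T R
    have hsub : Icc 0 T ×ˢ Metric.closedBall (0 : E3) R ⊆ Ici 0 ×ˢ univ :=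
      prod_mono Icc_subset_Ici_self (subset_univ _)
    exact (hφ.integrable.integrableOn_compact_subset hsub
      (isCompact_Icc.prod (isCompact_closedBall _ _))).congr
      (ae_mono (Measure.restrict_mono hsub le_rfl) hae)
  have hloc := ae_locallyIntegrable_slice hint
  refine ⟨J, _, ⟨hH, fun t ht => ?_, hm.stronglyMeasurable_mk, hint, fun η hη s t hs hst => ?_⟩,
    hslice⟩
  · have := (ENNReal.tendsto_toReal (by simp)).comp (hφ.continuous t ht)
    rwa [ENNReal.toReal_zero] at this
  · have h1 := hφ.equation η hη s t hs hst
    have h2 : (∫ x, φ t x * η x) - ∫ x, φ s x * η x = -Complex.I * (∫ τ in s..t, ∫ x,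
          (interaction N φ τ x * η x - φ τ x * Laplacian.laplacian η x)) := by
      rw [← h1, ← mul_assoc]; simp
    rw [h2, ← intervalIntegral.integral_const_mul]
    refine intervalIntegral.integral_congr_ae ?_
    filter_upwards [hslice, hloc] with τ h3 h4 hτ
    rw [uIoc_of_le hst] at hτ
    have hτ0 : 0 ≤ τ := hs.trans hτ.1.le
    have e1 : ∫ x, (interaction N φ τ x * η x - φ τ x * Laplacian.laplacian η x)
        = ∫ x, (J τ x * η x - φ τ x * lap η x) := by
      refine integral_congr_ae ?_
      filter_upwards [h3 hτ0] with x hx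
      rw [hx, laplacian_eq_sum (hη.1.of_le (by norm_cast))]; rfl
    have hL : IsTestFunction (lap η) := hη.laplacian
    rw [e1, integral_sub (integrable_mul_test (h4 hτ0) hη)
      (integrable_mul_test ((hH τ hτ0).grad 0).1 hL)]
    ring

theorem IsGlobalSolution.integrable_initial (hφ : IsGlobalSolution N φ₀ φ)
    (hφ₀ : MemLp (fun x => ((‖x‖ ^ (1 / 2 : ℝ) : ℝ) : ℂ) * φ₀ x) 2 volume) :
    Integrable (fun x => ‖x‖ * ‖φ 0 x‖ ^ 2) volume := by
  refine (hφ₀.integrable_norm_pow (by norm_num)).congr ?_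
  filter_upwards [hφ.initial] with x hx
  rw [hx, norm_mul, mul_pow, Complex.norm_real, Real.norm_of_nonneg (by positivity)]
  congr 1
  rw [← Real.rpow_natCast, ← Real.rpow_mul (norm_nonneg _)]
  norm_num

/-- The cutoff equals 1 where |x| ≥ τ^α, and for τ ≥ 1 the exponent -β₀ can be relaxed to -3/2. -/
theorem exists_exterior_bound {J : ℝ → E3 → ℂ}
    (hJ : ∀ᵐ τ, 0 ≤ τ → J τ =ᵐ[volume] interaction N φ τ) {F : ℝ → ℝ} (hF : IsSmoothCutoff F)
    {α β₀ C : ℝ} (hβ : 3 / 2 ≤ β₀) (h : ExteriorDecay N φ F α β₀ C) :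
    ∀ᵐ τ : ℝ, 1 ≤ τ → ∀ᵐ x, τ ^ α ≤ ‖x‖ → ‖J τ x‖ ≤ |C| * τ ^ (-(3 / 2) : ℝ) * ‖φ τ x‖ := by
  filter_upwards [hJ] with τ h1 hτ
  filter_upwards [h1 (by linarith), h τ hτ] with x hx h2 h3
  rw [hx, interaction, norm_mul, Complex.norm_real, Real.norm_eq_abs]
  refine mul_le_mul_of_nonneg_right ?_ (norm_nonneg _)
  have hp : 0 < τ ^ α := by positivity
  rw [hF.eq_one _ ((one_le_div hp).mpr h3), one_mul] at h2
  refine h2.trans ((mul_le_mul_of_nonneg_right (le_abs_self C) (by positivity)).trans ?_)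
  exact mul_le_mul_of_nonneg_left (Real.rpow_le_rpow_of_exponent_le hτ (by linarith))
    (abs_nonneg C)

end Solution

/-! ### Uniqueness, product rule and integration by parts for weak derivatives. -/

section ProductRule

variable {u v : E3 → ℂ} {D : Fin 3 → E3 → ℂ} {K : ℝ}

/-- Needed because `weakDeriv` is an arbitrary choice: it identifies the chosen derivatives inside
`gammaOp` with those given by the product rule. -/
theorem HasWeakDeriv.ae_unique {j : Fin 3} {v' : E3 → ℂ} (h : HasWeakDeriv j u v)
    (h' : HasWeakDeriv j u v') : v =ᵐ[volume] v' := by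
  have hz := ae_eq_zero_of_integral_contDiff_smul_eq_zero (h.2.1.sub h'.2.1) fun g hg hc => by
    have ht : IsTestFunction fun x => (g x : ℂ) :=
      ⟨Complex.ofRealCLM.contDiff.comp hg, hc.comp_left (g := fun r : ℝ => (r : ℂ)) (by simp)⟩
    have e1 := h.2.2 _ ht
    have e2 := h'.2.2 _ ht
    have e3 : ∀ x, g x • (v - v') x = v x * (g x : ℂ) - v' x * (g x : ℂ) := fun x => by
      rw [Complex.real_smul, Pi.sub_apply]; ring
    simp only [e3]
    rw [integral_sub (integrable_mul_test h.2.1 ht) (integrable_mul_test h'.2.1 ht), sub_eq_zero]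
    exact neg_injective (e1.symm.trans e2)
  exact hz.mono fun x hx => sub_eq_zero.mp hx

theorem HasWeakDeriv.smooth_mul {j : Fin 3} (h : HasWeakDeriv j u v) {χ : E3 → ℝ}
    (hχ : ContDiff ℝ ∞ χ) :
    HasWeakDeriv j (fun x => (χ x : ℂ) * u x)
      (fun x => (χ x : ℂ) * v x + ((partialDeriv j χ x : ℝ) : ℂ) * u x) := by
  have hc : ContDiff ℝ ∞ fun x => (χ x : ℂ) := Complex.ofRealCLM.contDiff.comp hχ
  have hd : ContDiff ℝ ∞ fun x => ((partialDeriv j χ x : ℝ) : ℂ) :=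
    Complex.ofRealCLM.contDiff.comp (partialDeriv_smooth hχ j)
  have l : ∀ {g w : E3 → ℂ}, Continuous g → LocallyIntegrable w volume →
      LocallyIntegrable (fun x => g x * w x) volume := fun hg hw => hw.continuous_smul hg
  refine ⟨l hc.continuous h.1, (l hc.continuous h.2.1).add (l hd.continuous h.1),
    fun ψ hψ => ?_⟩
  have t1 : IsTestFunction fun x => (χ x : ℂ) * ψ x := ⟨hc.mul hψ.1, hψ.2.mul_left⟩
  have t2 : IsTestFunction fun x => ((partialDeriv j χ x : ℝ) : ℂ) * ψ x :=
    ⟨hd.mul hψ.1, hψ.2.mul_left⟩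
  have e : ∀ x, partialDeriv j (fun x => (χ x : ℂ) * ψ x) x
      = ((partialDeriv j χ x : ℝ) : ℂ) * ψ x + (χ x : ℂ) * partialDeriv j ψ x := fun x => by
    rw [partialDeriv_mul (hc.differentiable (by simp) x) (hψ.1.differentiable (by simp) x),
      partialDeriv_ofReal (hχ.differentiable (by simp) x)]
  have i1 := integrable_mul_test h.1 (t1.partialDeriv j)
  have i2 := integrable_mul_test h.1 t2
  have i3 := integrable_mul_test h.2.1 t1
  have e1 : ∫ x, (χ x : ℂ) * u x * partialDeriv j ψ x
      = (∫ x, u x * partialDeriv j (fun x => (χ x : ℂ) * ψ x) x)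
        - ∫ x, u x * (((partialDeriv j χ x : ℝ) : ℂ) * ψ x) := by
    rw [← integral_sub i1 i2]
    refine integral_congr_ae (.of_forall fun x => ?_)
    simp only [e]; ring
  have e2 : ∫ x, ((χ x : ℂ) * v x + ((partialDeriv j χ x : ℝ) : ℂ) * u x) * ψ x
      = (∫ x, v x * ((χ x : ℂ) * ψ x))
        + ∫ x, u x * (((partialDeriv j χ x : ℝ) : ℂ) * ψ x) := by
    rw [← integral_add i3 i2]
    refine integral_congr_ae (.of_forall fun x => ?_)
    simp only; ring
  rw [e1, e2, h.2.2 _ t1]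
  ring

/-- Twice the real part of D_j u ū is ∂ⱼ|u|²; this is verified on mollifications and passed to the
limit. It supplies the cancellation that makes the γ-expectation real. -/
theorem IsH1.integral_parts {w : E3 → ℝ} {B B' : ℝ} (h : IsH1 u D K) (hw : ContDiff ℝ 1 w)
    (j : Fin 3) (hB : ∀ x, |w x| ≤ B) (hB' : ∀ x, |partialDeriv j w x| ≤ B') :
    2 * (∫ x, (w x : ℂ) * (D j x * (starRingEnd ℂ) (u x))).re = -mass (partialDeriv j w) u := by
  have hwm : AEStronglyMeasurable w volume := hw.continuous.aestronglyMeasurable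
  have hwm' : AEStronglyMeasurable (partialDeriv j w) volume :=
    (partialDeriv_continuous hw j).aestronglyMeasurable
  have hev : ∀ᶠ ε in 𝓝[>] (0 : ℝ), 0 < ε := self_mem_nhdsWithin
  have l1 := tendsto_integral_weight (l := 𝓝[>] (0 : ℝ)) (b := fun x => (w x : ℂ)) (B := B)
    (F := fun ε => GammaLimit.moll ε (D j)) (G := fun ε => GammaLimit.moll ε u)
    (Complex.continuous_ofReal.comp_aestronglyMeasurable hwm)
    (.of_forall fun x => by simpa using hB x) (h.memLp_grad j) h.memLp
    (hev.mono fun ε hε => memLp_moll (h.memLp_grad j) hε)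
    (hev.mono fun ε hε => memLp_moll h.memLp hε)
    (tendsto_l2_moll (h.memLp_grad j)) (tendsto_l2_moll h.memLp)
  have l2 := ((Complex.continuous_re.tendsto _).comp l1).const_mul 2
  refine tendsto_nhds_unique l2 (((h.tendsto_mass hwm' (.of_forall hB')).neg).congr' ?_)
  filter_upwards [hev] with ε hε
  have hH := h.moll hε
  have hU : ContDiff ℝ 1 (GammaLimit.moll ε u) := (smear_contDiff (h.grad j).1
    (mollifier_isTestFunction hε)).of_le (by norm_cast)
  simp only [Function.comp]
  rw [← h.partialDeriv_moll hε, ← integral_weight_re hwm (.of_forall hB) (hH.memLp_grad j)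
    hH.memLp]
  set U := GammaLimit.moll ε u with hUdef
  have hg : ContDiff ℝ 1 (fun x => (U x * (starRingEnd ℂ) (U x)).re) :=
    Complex.reCLM.contDiff.comp (contDiff_mul_conj hU hU)
  have eg : ∀ x, partialDeriv j (fun x => (U x * (starRingEnd ℂ) (U x)).re) x
      = 2 * (partialDeriv j U x * (starRingEnd ℂ) (U x)).re := fun x => by
    rw [partialDeriv_re_mul_conj hU hU]
    simp only [Complex.mul_re, Complex.conj_re, Complex.conj_im]
    ring
  have ig : ∀ x, (U x * (starRingEnd ℂ) (U x)).re = ‖U x‖ ^ 2 := fun x => by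
    rw [Complex.mul_conj, Complex.ofReal_re, Complex.normSq_eq_norm_sq]
  have i1 : Integrable (fun x => partialDeriv j w x * (U x * (starRingEnd ℂ) (U x)).re) volume := by
    simp only [ig]; exact integrable_mass hwm' hB' hH.memLp
  have i2 : Integrable (fun x => w x * (U x * (starRingEnd ℂ) (U x)).re) volume := by
    simp only [ig]; exact integrable_mass hwm hB hH.memLp
  have i3 : Integrable (fun x => w x * partialDeriv j
      (fun x => (U x * (starRingEnd ℂ) (U x)).re) x) volume := by
    have := (integrable_real_weight_mul hwm (.of_forall hB) (hH.memLp_grad j) hH.memLp).re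
    refine (this.const_mul 2).congr (.of_forall fun x => ?_)
    simp only [eg, RCLike.re_eq_complex_re, Complex.re_ofReal_mul]
    ring
  have key := integral_mul_fderiv_eq_neg_fderiv_mul_of_integrable (μ := (volume : Measure E3))
    (v := EuclideanSpace.single j 1) i1 i3 i2
    (fun x _ => hw.differentiable (by norm_num) x) (fun x _ => hg.differentiable (by norm_num) x)
  change ∫ x, w x * partialDeriv j (fun x => (U x * (starRingEnd ℂ) (U x)).re) x
    = -∫ x, partialDeriv j w x * (U x * (starRingEnd ℂ) (U x)).re at key
  rw [show partialDeriv j (fun x => (U x * (starRingEnd ℂ) (U x)).re)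
    = fun x => 2 * (partialDeriv j U x * (starRingEnd ℂ) (U x)).re from funext eg] at key
  simp only [ig] at key
  rw [mass, ← key, ← integral_const_mul]
  refine integral_congr_ae (.of_forall fun x => ?_)
  simp only; ring

end ProductRule

/-! ### The γ-expectation as an exterior current. -/

section Gamma

variable {a F : ℝ → ℝ} {μ K : ℝ} {u : E3 → ℂ} {D : Fin 3 → E3 → ℂ}

theorem smoothedModulus_of_two_le {r : ℝ} (h : 2 ≤ r) : smoothedModulus a r = r := by
  simp [smoothedModulus, h]

theorem IsProfile.smoothedModulus_le_two (ha : IsProfile a) {r : ℝ} (h : r ≤ 2) :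
    smoothedModulus a r ≤ 2 := by
  have hp : ∀ {r : ℝ}, 1 ≤ r → 0 ≤ ∫ s in (1 : ℝ)..r, ∫ τ in (1 : ℝ)..s, a τ := fun h1 =>
    intervalIntegral.integral_nonneg h1 fun s hs =>
      intervalIntegral.integral_nonneg hs.1 fun τ _ => ha.nonneg τ
  rcases lt_or_eq_of_le h with h2 | h2
  · simp only [smoothedModulus, not_le.mpr h2, if_false]
    have hi : ∀ x y : ℝ, IntervalIntegrable a volume x y := fun x y =>
      ha.smooth.continuous.intervalIntegrable x y
    have hcont : Continuous fun s : ℝ => ∫ τ in (1 : ℝ)..s, a τ :=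
      intervalIntegral.continuous_primitive hi 1
    split_ifs with h3
    · have e := intervalIntegral.integral_add_adjacent_intervals
        (hcont.intervalIntegrable (μ := volume) 1 r) (hcont.intervalIntegrable r 2)
      have h4 : 0 ≤ ∫ s in r..2, ∫ τ in (1 : ℝ)..s, a τ :=
        intervalIntegral.integral_nonneg h fun s hs =>
          intervalIntegral.integral_nonneg (h3.trans hs.1) fun τ _ => ha.nonneg τ
      linarith
    · linarith [hp (show (1 : ℝ) ≤ 2 by norm_num)]
  · rw [h2, smoothedModulus_of_two_le le_rfl]

/-- For |x| ≥ 2 the two moduli agree. For |x| ≤ 2 both are at most 2 ≤ μ/2, where the cutoff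
vanishes. -/
theorem IsSmoothCutoff.apply_bracket (hF : IsSmoothCutoff F) (ha : IsProfile a) (hμ : 4 ≤ μ)
    (x : E3) : F (bracket a x / μ) = F (‖x‖ / μ) := by
  rcases le_total 2 ‖x‖ with h | h
  · rw [bracket, smoothedModulus_of_two_le h]
  · have hμ0 : 0 < μ := by linarith
    rw [hF.eq_zero (‖x‖ / μ) (by rw [div_le_iff₀ hμ0]; linarith), hF.eq_zero]
    rw [div_le_iff₀ hμ0, bracket]
    linarith [ha.smoothedModulus_le_two h]

theorem IsSmoothCutoff.partialDeriv_bracket_mul (hF : IsSmoothCutoff F) (hμ : 4 ≤ μ) (j : Fin 3)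
    (x : E3) :
    partialDeriv j (bracket a) x * F (‖x‖ / μ) = radialField (fun r => F (r / μ)) j x := by
  have hμ0 : 0 < μ := by linarith
  rcases lt_or_ge 2 ‖x‖ with h | h
  · have hev : bracket a =ᶠ[𝓝 x] fun y => ‖y‖ := by
      filter_upwards [continuous_norm.continuousAt.eventually (lt_mem_nhds h)] with y hy
      exact smoothedModulus_of_two_le (le_of_lt hy)
    have hx : x ≠ 0 := fun h0 => by rw [h0, norm_zero] at h; linarith
    rw [partialDeriv, hev.fderiv_eq, ← partialDeriv, partialDeriv_norm hx, radialField, mul_comm]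
  · rw [radialField, hF.eq_zero (‖x‖ / μ) (by rw [div_le_iff₀ hμ0]; linarith)]; simp

theorem IsSmoothCutoff.vanishesNear_dilate (hF : IsSmoothCutoff F) (hμ : 0 < μ) :
    VanishesNear fun r => F (r / μ) :=
  ⟨μ / 2, by positivity, fun r hr => hF.eq_zero _ (by rw [div_le_iff₀ hμ]; linarith)⟩

theorem IsSmoothCutoff.dilate_contDiff (hF : IsSmoothCutoff F) (μ : ℝ) :
    ContDiff ℝ ∞ fun r => F (r / μ) := hF.smooth.comp (contDiff_id.div_const μ)

theorem IsSmoothCutoff.exists_bound_partialDeriv_dilate (hF : IsSmoothCutoff F) (hμ : 0 < μ)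
    (j k : Fin 3) : ∃ B, ∀ x, |partialDeriv j (radialField (fun r => F (r / μ)) k) x| ≤ B := by
  obtain ⟨C, hC0, hC⟩ := hF.exists_bound
  have hd : ∀ r, deriv (fun r => F (r / μ)) r = deriv F (r / μ) * (1 / μ) := fun r =>
    (HasDerivAt.comp (h₂ := F) r (hF.hasDerivAt (r / μ)) ((hasDerivAt_id r).div_const μ)).deriv
  have hq : ∀ r, 0 ≤ r → |F (r / μ) / r| ≤ 2 / μ := fun r hr => by
    rcases lt_or_ge r (μ / 2) with h | h
    · rw [hF.eq_zero _ (by rw [div_le_iff₀ hμ]; linarith)]; simp; positivity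
    · have hr0 : 0 < r := by linarith
      rw [abs_div, abs_of_nonneg (hF.nonneg _), abs_of_pos hr0, div_le_div_iff₀ hr0 hμ]
      nlinarith [hF.le_one (r / μ)]
  refine ⟨C * (1 / μ) * 1 * 1 + 2 / μ * (1 + 1 * 1), fun x => ?_⟩
  rw [(hF.vanishesNear_dilate hμ).partialDeriv_radialField
    ((hF.dilate_contDiff μ).of_le (by norm_cast)), hd]
  refine (abs_add_le _ _).trans (add_le_add ?_ ?_)
  · rw [abs_mul, abs_mul, abs_mul, abs_of_pos (by positivity : 0 < 1 / μ)]
    gcongr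
    · exact hC 0 (by norm_num) _
    · exact abs_coord_div_norm_le x j
    · exact abs_coord_div_norm_le x k
  · rw [abs_mul]
    refine mul_le_mul (hq _ (norm_nonneg x)) ((abs_sub _ _).trans (add_le_add ?_ ?_))
      (abs_nonneg _) (by positivity)
    · split_ifs <;> simp
    · rw [abs_mul]
      exact mul_le_mul (abs_coord_div_norm_le x j) (abs_coord_div_norm_le x k) (abs_nonneg _)
        zero_le_one

/-- The cutoff turns ∇⟨x⟩ into the smooth field F x/|x|. The product rule on both halves of γ then
gives W · D + ½ (div W) u with W = F² x/|x|. -/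
theorem IsH1.gammaOp_cutoff (h : IsH1 u D K) (hF : IsSmoothCutoff F) (hμ : 4 ≤ μ) :
    ∀ᵐ x, (F (‖x‖ / μ) : ℂ) * gammaOp a (fun x => (F (‖x‖ / μ) : ℂ) * u x) x
      = -Complex.I * ∑ j, ((radialField (fun r => F (r / μ) ^ 2) j x : ℂ) * D j x
        + 1 / 2 * ((partialDeriv j (radialField (fun r => F (r / μ) ^ 2) j) x : ℝ) : ℂ) * u x) := by
  have hμ0 : 0 < μ := by linarith
  have hv := hF.vanishesNear_dilate hμ0
  have hχ : ContDiff ℝ ∞ (fun x : E3 => F (‖x‖ / μ)) := hv.contDiff_radial (hF.dilate_contDiff μ)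
  have hG : ∀ j, ContDiff ℝ ∞ (radialField (fun r => F (r / μ)) j) :=
    hv.contDiff_radialField (hF.dilate_contDiff μ)
  have w1 := fun j => (h.grad j).smooth_mul hχ
  have w2 := fun j => (h.grad j).smooth_mul (hG j)
  have e1 := fun j => (hasWeakDeriv_weakDeriv ⟨_, w1 j⟩).ae_unique (w1 j)
  have e2 := fun j => (hasWeakDeriv_weakDeriv ⟨_, w2 j⟩).ae_unique (w2 j)
  have e3 : ∀ j, (fun y => ((partialDeriv j (bracket a) y : ℝ) : ℂ) * ((F (‖y‖ / μ) : ℂ) * u y))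
      = fun y => (radialField (fun r => F (r / μ)) j y : ℂ) * u y := fun j => by
    ext y
    rw [← mul_assoc, ← Complex.ofReal_mul, hF.partialDeriv_bracket_mul hμ]
  filter_upwards [ae_all_iff.mpr e1, ae_all_iff.mpr e2] with x h1 h2
  rw [gammaOp]
  simp only [e3, h1, h2, Finset.mul_sum]
  refine Finset.sum_congr rfl fun j _ => ?_
  have p1 : radialField (fun r => F (r / μ) ^ 2) j
      = fun x => F (‖x‖ / μ) * radialField (fun r => F (r / μ)) j x := by
    ext x; simp only [radialField]; ring
  have p2 : partialDeriv j (radialField (fun r => F (r / μ) ^ 2) j) x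
      = partialDeriv j (fun x : E3 => F (‖x‖ / μ)) x * radialField (fun r => F (r / μ)) j x
        + F (‖x‖ / μ) * partialDeriv j (radialField (fun r => F (r / μ)) j) x := by
    rw [p1, partialDeriv_mul_real (hχ.differentiable (by simp) x)
      ((hG j).differentiable (by simp) x)]
  rw [p2]
  simp only [p1]
  rw [← hF.partialDeriv_bracket_mul (a := a) hμ j x]
  push_cast
  ring

theorem IsH1.gammaExpectation_eq (h : IsH1 u D K) (ha : IsProfile a) (hF : IsSmoothCutoff F)
    {α t : ℝ} (hμ : 4 ≤ t ^ α) :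
    gammaExpectation a F α t u = (exteriorCurrent (fun l => F l ^ 2) (t ^ α) D u : ℂ) := by
  set μ := t ^ α with hμdef
  have hμ0 : 0 < μ := by linarith
  set W : Fin 3 → E3 → ℝ := radialField (fun r => F (r / μ) ^ 2) with hW
  have hWs : ∀ j, ContDiff ℝ 1 (W j) := fun j =>
    ((hF.sq.vanishesNear_dilate hμ0).contDiff_radialField (hF.sq.dilate_contDiff μ) j).of_le
      (by norm_cast)
  have hWm : ∀ j, AEStronglyMeasurable (W j) volume := fun j =>
    (hWs j).continuous.aestronglyMeasurable
  have hWm' : ∀ j, AEStronglyMeasurable (partialDeriv j (W j)) volume := fun j =>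
    (partialDeriv_continuous (hWs j) j).aestronglyMeasurable
  have hW1 : ∀ j x, |W j x| ≤ 1 := fun j x => abs_radialField_le (by
    rw [abs_of_nonneg (hF.sq.nonneg _)]; exact hF.sq.le_one _) j
  choose B hB using fun j => hF.sq.exists_bound_partialDeriv_dilate hμ0 j j
  have hcut : ∀ w : E3 → ℂ, cutoffMul a F α t w = fun x => (F (‖x‖ / μ) : ℂ) * w x := fun w => by
    ext x; rw [cutoffMul, hF.apply_bracket ha hμ]
  have i1 : ∀ j, Integrable (fun x => (W j x : ℂ) * (D j x * (starRingEnd ℂ) (u x))) volume :=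
    fun j => integrable_real_weight_mul (hWm j) (.of_forall (hW1 j)) (h.memLp_grad j) h.memLp
  have i2 : ∀ j, Integrable (fun x => partialDeriv j (W j) x * ‖u x‖ ^ 2) volume := fun j =>
    integrable_mass (hWm' j) (hB j) h.memLp
  have e1 : gammaExpectation a F α t u = ∫ x, ∑ j,
      (Complex.I * (starRingEnd ℂ) ((W j x : ℂ) * (D j x * (starRingEnd ℂ) (u x)))
        + Complex.I / 2 * ((partialDeriv j (W j) x * ‖u x‖ ^ 2 : ℝ) : ℂ)) := by
    rw [gammaExpectation, hcut u, hcut]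
    refine integral_congr_ae ?_
    filter_upwards [h.gammaOp_cutoff (a := a) hF hμ] with x hx
    simp only [hx]
    rw [map_mul, map_sum, Finset.mul_sum, Finset.mul_sum]
    refine Finset.sum_congr rfl fun j _ => ?_
    have hn : u x * (starRingEnd ℂ) (u x) = ((‖u x‖ : ℝ) : ℂ) ^ 2 := by
      rw [Complex.mul_conj, Complex.normSq_eq_norm_sq]; push_cast; rfl
    simp only [map_add, map_mul, map_neg, Complex.conj_I, Complex.conj_ofReal, Complex.conj_conj,
      map_div₀, map_one, map_ofNat]
    push_cast
    rw [← hn]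
    ring
  have i3 : ∀ j, Integrable (fun x => Complex.I * (starRingEnd ℂ)
      ((W j x : ℂ) * (D j x * (starRingEnd ℂ) (u x)))) volume := fun j =>
    (Complex.conjCLE.toContinuousLinearMap.integrable_comp (i1 j)).const_mul _
  have i4 : ∀ j, Integrable (fun x => Complex.I / 2 *
      ((partialDeriv j (W j) x * ‖u x‖ ^ 2 : ℝ) : ℂ)) volume := fun j =>
    (i2 j).ofReal.const_mul _
  have i5 : ∀ j, Integrable (fun x => Complex.I * (starRingEnd ℂ)
      ((W j x : ℂ) * (D j x * (starRingEnd ℂ) (u x))) + Complex.I / 2 *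
      ((partialDeriv j (W j) x * ‖u x‖ ^ 2 : ℝ) : ℂ)) volume := fun j => (i3 j).add (i4 j)
  rw [e1, integral_finsetSum _ fun j _ => i5 j, exteriorCurrent, current,
    Complex.ofReal_sum]
  refine Finset.sum_congr rfl fun j _ => ?_
  rw [integral_add (i3 j) (i4 j), integral_const_mul, integral_const_mul, integral_conj,
    integral_complex_ofReal, integral_weight_im (hWm j) (.of_forall (hW1 j)) (h.memLp_grad j)
    h.memLp]
  have hp := h.integral_parts (hWs j) j (hW1 j) (hB j)
  rw [mass] at hp
  set z := ∫ x, (W j x : ℂ) * (D j x * (starRingEnd ℂ) (u x)) with hz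
  -- With z the integral of W_j D_j u ū, each summand becomes i (z̄ - Re z) = Im z.
  have e2 : ∫ x, partialDeriv j (W j) x * ‖u x‖ ^ 2 = -(2 * z.re) := by rw [hp]; ring
  rw [e2]
  apply Complex.ext <;> simp

end Gamma

/-! ### Limits of the current and growth of the moment. -/

section Asymptotics

/-- A radial evolution of finite first moment, with a real potential decaying like `t ^ (-3/2)` in
every exterior region `|x| ≥ t ^ α`, `1/3 < α < 1`. -/
structure IsDecayingEvolution (φ J : ℝ → E3 → ℂ) (D : ℝ → Fin 3 → E3 → ℂ) (K : ℝ) : Prop where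
  toIsEvolution : IsEvolution φ J D K
  radial : ∀ t, 0 ≤ t → IsRadial (φ t)
  real : ∀ᵐ τ, 0 ≤ τ → ∀ᵐ x, (J τ x * (starRingEnd ℂ) (φ τ x)).im = 0
  moment : Integrable (fun x => ‖x‖ * ‖φ 0 x‖ ^ 2) volume
  exterior : ∀ α ∈ Ioo (1 / 3 : ℝ) 1, ∃ c : ℝ, 0 ≤ c ∧ ∀ᵐ τ : ℝ, 1 ≤ τ → ∀ᵐ x,
    τ ^ α ≤ ‖x‖ → ‖J τ x‖ ≤ c * τ ^ (-(3 / 2) : ℝ) * ‖φ τ x‖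

variable {φ J : ℝ → E3 → ℂ} {D : ℝ → Fin 3 → E3 → ℂ} {f : ℝ → ℝ} {K α δ s t : ℝ}

theorem hasDerivAt_rpow_of_pos (α : ℝ) {τ : ℝ} (hτ : 0 < τ) :
    HasDerivAt (fun τ : ℝ => τ ^ α) (α * τ ^ (α - 1)) τ :=
  Real.hasDerivAt_rpow_const (Or.inl hτ.ne')

theorem continuousOn_rpow_deriv (α : ℝ) (hs : 0 < s) :
    ContinuousOn (fun τ : ℝ => α * τ ^ (α - 1)) (Icc s t) := fun τ hτ =>
  ((Real.continuousAt_rpow_const τ _ (Or.inl (by linarith [hτ.1]))).const_mul α).continuousWithinAt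

theorem intervalIntegrable_rpow_of_pos (r : ℝ) (hs : 0 < s) (hst : s ≤ t) :
    IntervalIntegrable (fun τ : ℝ => τ ^ r) volume s t :=
  intervalIntegral.intervalIntegrable_rpow (Or.inr fun h => by
    rw [uIcc_of_le hst] at h; linarith [h.1])

theorem integral_rpow_of_pos {r : ℝ} (hr : r ≠ 0) (hs : 0 < s) (hst : s ≤ t) :
    ∫ τ in s..t, τ ^ (r - 1) = (t ^ r - s ^ r) / r := by
  rw [integral_rpow (Or.inr ⟨fun h => hr (by linarith), fun h => by
    rw [uIcc_of_le hst] at h; linarith [h.1]⟩), sub_add_cancel]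

theorem IsH1.abs_exteriorCurrent_le {u : E3 → ℂ} {D : Fin 3 → E3 → ℂ} (h : IsH1 u D K)
    (hf : IsSmoothCutoff f) (μ : ℝ) : |exteriorCurrent f μ D u| ≤ 3 * K ^ 2 := by
  have := abs_current_le (W := radialField fun r => f (r / μ)) (B := 1)
    (fun k => measurable_radialField (hf.dilate_contDiff μ).continuous k)
    (fun k => .of_forall fun x => abs_radialField_le (by
      rw [abs_of_nonneg (hf.nonneg _)]; exact hf.le_one _) k) h
  simpa [exteriorCurrent] using this

/-- With m = τ^α the errors are of order τ^(α-2), τ^(-3α) and τ^(-3/2). The conditions on δ bound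
each by τ^(-1-δ), whose integral is a difference of powers τ^(-δ). -/
theorem IsDecayingEvolution.exteriorCurrent_monotone (h : IsDecayingEvolution φ J D K)
    (hf : IsSmoothCutoff f) (hα : α ∈ Ioo (1 / 3 : ℝ) 1) (hδ : 0 < δ) (hδ1 : δ ≤ 3 * α - 1)
    (hδ2 : δ ≤ 1 - α) :
    ∃ T A : ℝ, 1 ≤ T ∧ 0 ≤ A ∧ ∀ s t, T ≤ s → s ≤ t →
      exteriorCurrent f (s ^ α) (D s) (φ s) - A * s ^ (-δ)
        ≤ exteriorCurrent f (t ^ α) (D t) (φ t) - A * t ^ (-δ) := by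
  obtain ⟨C, hC0, hC⟩ := hf.exists_bound
  obtain ⟨hα1, hα2⟩ := hα
  -- A smaller admissible exponent: for large τ, τ^α' ≤ τ^α / 4, so the exterior decay covers the
  -- region |x| ≥ m/4 reached by mollification.
  set α' := (α + 1 / 3) / 2 with hα'
  obtain ⟨c, hc0, hc⟩ := h.exterior α' ⟨by linarith, by linarith⟩
  have t1 : ∀ᶠ τ : ℝ in atTop, 2 ≤ τ ^ α :=
    (tendsto_rpow_atTop (by linarith : 0 < α)).eventually_ge_atTop 2
  have t2 : ∀ᶠ τ : ℝ in atTop, 4 ≤ τ ^ (α - α') :=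
    (tendsto_rpow_atTop (by linarith : 0 < α - α')).eventually_ge_atTop 4
  obtain ⟨T, hT⟩ := eventually_atTop.mp ((t1.and t2).and (eventually_ge_atTop 1))
  set A₀ := (C + 9 * C + (2 * C + 4) * c + 6 * c) * K ^ 2 with hA₀
  have hA₀0 : 0 ≤ A₀ := by positivity
  refine ⟨max T 1, A₀ / δ, le_max_right _ _, by positivity, fun s t hs hst => ?_⟩
  have hs1 : 1 ≤ s := (le_max_right _ _).trans hs
  have hs0 : 0 < s := by linarith
  have hm : ∀ τ ∈ Icc s t, 1 ≤ τ ∧ 2 ≤ τ ^ α ∧ 4 ≤ τ ^ (α - α') := fun τ hτ => by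
    have := hT τ ((le_max_left _ _).trans (hs.trans hτ.1))
    exact ⟨this.2, this.1.1, this.1.2⟩
  have key := h.toIsEvolution.exteriorCurrent_sub_ge (m := fun τ => τ ^ α)
    (m' := fun τ => α * τ ^ (α - 1)) (c := fun τ => c * τ ^ (-(3 / 2) : ℝ))
    (E := fun τ => A₀ * τ ^ (-δ - 1)) hf hC hs0.le hst
    (fun τ hτ => hasDerivAt_rpow_of_pos α (by linarith [hτ.1])) (continuousOn_rpow_deriv α hs0)
    (fun τ hτ => (hm τ hτ).2.1)
    (fun τ hτ => mul_nonneg hc0 (Real.rpow_nonneg (by linarith [hτ.1]) _))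
    (by
      filter_upwards [hc] with τ h1 hτ
      obtain ⟨h2, h3, h4⟩ := hm τ hτ
      filter_upwards [h1 h2] with x hx hx2
      refine hx (le_trans ?_ hx2)
      have e : τ ^ α = τ ^ α' * τ ^ (α - α') := by
        rw [← Real.rpow_add (by linarith)]; congr 1; ring
      have : 0 ≤ τ ^ α' := Real.rpow_nonneg (by linarith) _
      rw [e]; nlinarith)
    ((intervalIntegrable_rpow_of_pos _ hs0 hst).const_mul _)
    (fun τ hτ => by
      obtain ⟨h2, h3, -⟩ := hm τ hτ
      have hτ0 : 0 < τ := by linarith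
      have p0 : 0 ≤ τ ^ (-δ - 1) := Real.rpow_nonneg hτ0.le _
      have p1 : (α * τ ^ (α - 1)) ^ 2 / τ ^ α ≤ τ ^ (-δ - 1) := by
        have e : (α * τ ^ (α - 1)) ^ 2 / τ ^ α = α ^ 2 * τ ^ (α - 2) := by
          rw [mul_pow, ← Real.rpow_natCast (τ ^ (α - 1)), ← Real.rpow_mul hτ0.le, mul_div_assoc,
            ← Real.rpow_sub hτ0]
          congr 2; push_cast; ring
        rw [e]
        have a1 : α ^ 2 ≤ 1 := by nlinarith
        have a2 : τ ^ (α - 2) ≤ τ ^ (-δ - 1) :=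
          Real.rpow_le_rpow_of_exponent_le h2 (by linarith)
        have a3 : 0 ≤ τ ^ (α - 2) := Real.rpow_nonneg hτ0.le _
        nlinarith
      have p2 : 1 / (τ ^ α) ^ 3 ≤ τ ^ (-δ - 1) := by
        have e : 1 / (τ ^ α) ^ 3 = τ ^ (-(α * 3)) := by
          rw [Real.rpow_neg hτ0.le, one_div, ← Real.rpow_natCast, ← Real.rpow_mul hτ0.le]
          norm_num
        rw [e]
        exact Real.rpow_le_rpow_of_exponent_le h2 (by linarith)
      -- Here δ ≤ 1/2 is used; it follows from 4δ ≤ (3α - 1) + 3(1 - α) = 2.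
      have p3 : τ ^ (-(3 / 2) : ℝ) ≤ τ ^ (-δ - 1) :=
        Real.rpow_le_rpow_of_exponent_le h2 (by linarith)
      have p4 : (2 * C + 4) / τ ^ α ≤ 2 * C + 4 := div_le_self (by positivity) (by linarith)
      have p5 : 0 ≤ τ ^ (-(3 / 2) : ℝ) := Real.rpow_nonneg hτ0.le _
      have e : A₀ * τ ^ (-δ - 1) = (C * τ ^ (-δ - 1) + 9 * C * τ ^ (-δ - 1)
        + (2 * C + 4) * (c * τ ^ (-δ - 1)) + 6 * (c * τ ^ (-δ - 1))) * K ^ 2 := by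
        rw [hA₀]; ring
      rw [e]
      gcongr
      · rw [mul_div_assoc]; gcongr
      · rw [div_eq_mul_one_div]; gcongr)
  rw [intervalIntegral.integral_const_mul, integral_rpow_of_pos (by linarith) hs0 hst] at key
  have e : -(A₀ * ((t ^ (-δ) - s ^ (-δ)) / -δ)) = A₀ / δ * t ^ (-δ) - A₀ / δ * s ^ (-δ) := by
    field_simp
  rw [e] at key
  linarith

theorem IsDecayingEvolution.exists_tendsto_exteriorCurrent (h : IsDecayingEvolution φ J D K)
    (hf : IsSmoothCutoff f) (hα : α ∈ Ioo (1 / 3 : ℝ) 1) (hδ : 0 < δ) (hδ1 : δ ≤ 3 * α - 1)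
    (hδ2 : δ ≤ 1 - α) :
    ∃ L T A : ℝ, 1 ≤ T ∧ 0 ≤ A ∧
      Tendsto (fun t => exteriorCurrent f (t ^ α) (D t) (φ t)) atTop (𝓝 L) ∧
      ∀ t, T ≤ t → exteriorCurrent f (t ^ α) (D t) (φ t) ≤ L + A * t ^ (-δ) := by
  obtain ⟨T, A, hT, hA, hmono⟩ := h.exteriorCurrent_monotone hf hα hδ hδ1 hδ2
  set G : ℝ → ℝ := fun t => exteriorCurrent f (t ^ α) (D t) (φ t) - A * t ^ (-δ) with hG
  -- Freezing the function before T makes it monotone on the whole line; its supremum is the limit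
  -- and also gives the one-sided rate.
  have hGm : Monotone fun t => G (max t T) := fun s t hst =>
    hmono _ _ (le_max_right _ _) (max_le_max_right T hst)
  have hGb : BddAbove (range fun t => G (max t T)) := by
    refine ⟨3 * K ^ 2, ?_⟩
    rintro _ ⟨t, rfl⟩
    have h0 : 0 ≤ max t T := by linarith [le_max_right t T]
    have h1 := (abs_le.mp ((h.toIsEvolution.isH1 _ h0).abs_exteriorCurrent_le hf
      ((max t T) ^ α))).2
    have h2 : 0 ≤ A * (max t T) ^ (-δ) := mul_nonneg hA (Real.rpow_nonneg h0 _)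
    simp only [hG]; linarith
  have hlim := tendsto_atTop_ciSup hGm hGb
  set L := ⨆ t, G (max t T) with hL
  have hGl : Tendsto G atTop (𝓝 L) := by
    refine hlim.congr' ?_
    filter_upwards [eventually_ge_atTop T] with t ht
    rw [max_eq_left ht]
  refine ⟨L, T, A, hT, hA, ?_, fun t ht => ?_⟩
  · have l2 : Tendsto (fun t : ℝ => A * t ^ (-δ)) atTop (𝓝 (A * 0)) :=
      (tendsto_rpow_neg_atTop hδ).const_mul A
    have := hGl.add l2
    simpa [hG] using this
  · have h1 : G (max t T) ≤ L := le_ciSup hGb t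
    rw [max_eq_left ht] at h1
    simp only [hG] at h1
    linarith

theorem IsDecayingEvolution.smoothMoment_sub_eq (h : IsDecayingEvolution φ J D K)
    (hf : IsSmoothCutoff f) (hs : 0 < s) (hst : s ≤ t) (hα : ∀ τ, s ≤ τ → 2 ≤ τ ^ α) :
    ∃ L : ℝ → ℝ, IntervalIntegrable L volume s t ∧
      smoothMoment f (t ^ α) (φ t) - smoothMoment f (s ^ α) (φ s) = ∫ τ in s..t, L τ ∧
      ∀ τ ∈ Icc s t, |L τ - 2 * exteriorCurrent f (τ ^ α) (D τ) (φ τ)|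
        ≤ |α| * τ ^ (α - 1) * K ^ 2 := by
  obtain ⟨h1, h2⟩ := h.toIsEvolution.smoothMoment_evolution (m := fun τ => τ ^ α)
    (m' := fun τ => α * τ ^ (α - 1)) hf hs.le hst
    (fun τ hτ => hasDerivAt_rpow_of_pos α (by linarith [hτ.1])) (continuousOn_rpow_deriv α hs)
    (fun τ hτ => hα τ hτ.1) h.radial h.real h.moment
  refine ⟨_, h1, h2, fun τ hτ => ?_⟩
  have hτ0 : 0 < τ := by linarith [hτ.1]
  rw [add_sub_cancel_right]
  refine (hf.abs_mass_primitiveDt_le (by linarith [hα τ hτ.1]) _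
    (h.toIsEvolution.isH1 τ hτ0.le)).trans_eq ?_
  rw [abs_mul, abs_of_pos (Real.rpow_pos_of_pos hτ0 _)]

/-- If L' exceeded L, the moment smoothed with f' would outgrow the one smoothed with f linearly in
time. But the former is at most the true moment, which exceeds the latter by at most t^α K², and α <
1. -/
theorem IsDecayingEvolution.limit_le {f' : ℝ → ℝ} {α' L L' : ℝ}
    (h : IsDecayingEvolution φ J D K) (hf : IsSmoothCutoff f) (hf' : IsSmoothCutoff f')
    (hα : α ∈ Ioo (1 / 3 : ℝ) 1) (hα' : α' ∈ Ioo (1 / 3 : ℝ) 1)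
    (hL : Tendsto (fun t => exteriorCurrent f (t ^ α) (D t) (φ t)) atTop (𝓝 L))
    (hL' : Tendsto (fun t => exteriorCurrent f' (t ^ α') (D t) (φ t)) atTop (𝓝 L')) :
    L' ≤ L := by
  by_contra hlt
  push Not at hlt
  -- Eventually the currents differ by more than d, hence the moment derivatives by more than 2d up
  -- to the scale-motion errors. Those are eventually below d, so a net rate d remains.
  set d := (L' - L) / 2 with hd
  have hd0 : 0 < d := by rw [hd]; linarith
  obtain ⟨hα1, hα2⟩ := hα
  obtain ⟨hα1', hα2'⟩ := hα'
  have b1 : ∀ᶠ τ : ℝ in atTop, 2 ≤ τ ^ α :=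
    (tendsto_rpow_atTop (by linarith : 0 < α)).eventually_ge_atTop 2
  have b2 : ∀ᶠ τ : ℝ in atTop, 2 ≤ τ ^ α' :=
    (tendsto_rpow_atTop (by linarith : 0 < α')).eventually_ge_atTop 2
  have b3 : ∀ᶠ τ : ℝ in atTop, d < exteriorCurrent f' (τ ^ α') (D τ) (φ τ)
      - exteriorCurrent f (τ ^ α) (D τ) (φ τ) :=
    (hL'.sub hL).eventually (lt_mem_nhds (by rw [hd]; linarith))
  have z : ∀ {β : ℝ}, β < 1 → Tendsto (fun τ : ℝ => |β| * τ ^ (β - 1) * K ^ 2) atTop (𝓝 0) := by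
    intro β hβ
    have := ((tendsto_rpow_neg_atTop (by linarith : 0 < 1 - β)).const_mul |β|).mul_const (K ^ 2)
    simpa using this
  have b4 : ∀ᶠ τ : ℝ in atTop,
      |α| * τ ^ (α - 1) * K ^ 2 + |α'| * τ ^ (α' - 1) * K ^ 2 < d := by
    have := (z hα2).add (z hα2')
    rw [add_zero] at this
    exact this.eventually (gt_mem_nhds hd0)
  obtain ⟨T₀, hT₀⟩ := eventually_atTop.mp ((b1.and b2).and (b3.and b4))
  set T := max T₀ 1 with hT
  have hT1 : 1 ≤ T := le_max_right _ _
  have hTT : ∀ τ, T ≤ τ → T₀ ≤ τ := fun τ hτ => (le_max_left _ _).trans hτ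
  set S := smoothMoment f' (T ^ α') (φ T) - smoothMoment f (T ^ α) (φ T) with hS
  have key : ∀ t, T ≤ t → d * (t - T) + S ≤ t ^ α * K ^ 2 := by
    intro t ht
    have ht0 : 0 ≤ t := by linarith
    obtain ⟨G, g1, g2, g3⟩ := h.smoothMoment_sub_eq hf (by linarith) ht
      fun τ hτ => (hT₀ τ (hTT τ hτ)).1.1
    obtain ⟨G', g1', g2', g3'⟩ := h.smoothMoment_sub_eq hf' (by linarith) ht
      fun τ hτ => (hT₀ τ (hTT τ hτ)).1.2
    have i1 := intervalIntegral.integral_mono_on (f := fun _ => d) ht intervalIntegrable_const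
      (g1'.sub g1) fun τ hτ => by
        have q1 := (abs_le.mp (g3 τ hτ)).2
        have q2 := (abs_le.mp (g3' τ hτ)).1
        have q3 := (hT₀ τ (hTT τ hτ.1)).2
        linarith [q3.1, q3.2]
    rw [intervalIntegral.integral_sub g1' g1, intervalIntegral.integral_const, smul_eq_mul,
      ← g2, ← g2'] at i1
    have hH := h.toIsEvolution.isH1 t ht0
    have hi := h.toIsEvolution.integrable_moment hf h.radial h.real h.moment ht0
    have p1 : 0 < t ^ α := Real.rpow_pos_of_pos (by linarith) _
    have p2 : 0 < t ^ α' := Real.rpow_pos_of_pos (by linarith) _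
    have m1 := hf'.smoothMoment_le p2 hi hH.memLp
    have m2 := hf.le_smoothMoment p1 hi hH
    rw [hS]; linarith
  have hz : Tendsto (fun t : ℝ => t ^ α * K ^ 2 / t) atTop (𝓝 0) := by
    have := (tendsto_rpow_neg_atTop (by linarith : 0 < 1 - α)).mul_const (K ^ 2)
    rw [zero_mul] at this
    refine this.congr' ?_
    filter_upwards [eventually_gt_atTop 0] with t ht
    rw [show -(1 - α) = α - 1 by ring, Real.rpow_sub_one ht.ne']
    ring
  have hz2 : Tendsto (fun t : ℝ => d + (S - d * T) / t) atTop (𝓝 d) := by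
    have := tendsto_const_nhds (x := d).add (tendsto_const_nhds (x := S - d * T).div_atTop tendsto_id)
    simpa using this
  have := le_of_tendsto_of_tendsto hz2 hz (by
    filter_upwards [eventually_ge_atTop T] with t ht
    have ht0 : 0 < t := by linarith
    rw [le_div_iff₀ ht0]
    have := key t ht
    field_simp
    linarith)
  linarith

theorem IsDecayingEvolution.exists_tendsto (h : IsDecayingEvolution φ J D K)
    (hf : IsSmoothCutoff f) (hα : α ∈ Ioo (1 / 3 : ℝ) 1) :
    ∃ L : ℝ, Tendsto (fun t => exteriorCurrent f (t ^ α) (D t) (φ t)) atTop (𝓝 L) := by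
  obtain ⟨L, T, A, -, -, hL, -⟩ := h.exists_tendsto_exteriorCurrent
    (δ := min (3 * α - 1) (1 - α)) hf hα
    (lt_min (by linarith [hα.1]) (by linarith [hα.2])) (min_le_left _ _) (min_le_right _ _)
  exact ⟨L, hL⟩

theorem IsDecayingEvolution.tendsto_zero_of_tendsto_zero {f' : ℝ → ℝ} {α' : ℝ}
    (h : IsDecayingEvolution φ J D K) (hf : IsSmoothCutoff f) (hf' : IsSmoothCutoff f')
    (hα : α ∈ Ioo (1 / 3 : ℝ) 1) (hα' : α' ∈ Ioo (1 / 3 : ℝ) 1)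
    (h0 : Tendsto (fun t => exteriorCurrent f (t ^ α) (D t) (φ t)) atTop (𝓝 0)) :
    Tendsto (fun t => exteriorCurrent f' (t ^ α') (D t) (φ t)) atTop (𝓝 0) := by
  obtain ⟨L, hL⟩ := h.exists_tendsto hf' hα'
  rwa [le_antisymm (h.limit_le hf hf' hα hα' h0 hL) (h.limit_le hf' hf hα' hα hL h0)] at hL

/-- The first moment of a state with vanishing limit grows at most like `t ^ (1/2)`. -/
theorem IsDecayingEvolution.exists_moment_le (h : IsDecayingEvolution φ J D K)
    (hf : IsSmoothCutoff f)
    (h0 : Tendsto (fun t => exteriorCurrent f (t ^ (1 / 2 : ℝ)) (D t) (φ t)) atTop (𝓝 0)) :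
    ∃ C : ℝ, ∀ t : ℝ, 1 ≤ t → ∫ x, ‖x‖ * ‖φ t x‖ ^ 2 ≤ C * t ^ (1 / 2 : ℝ) := by
  -- The exponent 1/2 is where 3α - 1 and 1 - α coincide, which gives the largest admissible δ.
  obtain ⟨L, T₁, A, hT₁, hA, hL, hle⟩ := h.exists_tendsto_exteriorCurrent (δ := 1 / 2)
    (α := 1 / 2) hf ⟨by norm_num, by norm_num⟩ (by norm_num) (by norm_num) (by norm_num)
  obtain rfl := tendsto_nhds_unique hL h0
  set T := max T₁ 4 with hT
  have hT4 : 4 ≤ T := le_max_right _ _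
  have hint := fun {t : ℝ} (ht : 0 ≤ t) =>
    h.toIsEvolution.integrable_moment hf h.radial h.real h.moment ht
  have hK := fun {t : ℝ} (ht : 0 ≤ t) => h.toIsEvolution.isH1 t ht
  set I := ∫ x, ‖x‖ * ‖φ 0 x‖ ^ 2 with hI
  have hI0 : 0 ≤ I := integral_nonneg fun x => by positivity
  -- linear growth
  have lin : ∀ t, 0 ≤ t → ∫ x, ‖x‖ * ‖φ t x‖ ^ 2 ≤ I + 6 * K ^ 2 * t + 2 * K ^ 2 := by
    intro t ht
    obtain ⟨h1, h2⟩ := h.toIsEvolution.smoothMoment_evolution (m := fun _ => 2)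
      (m' := fun _ => 0) hf le_rfl ht (fun τ _ => hasDerivAt_const τ 2) continuousOn_const
      (fun _ _ => le_rfl) h.radial h.real h.moment
    have i1 := intervalIntegral.integral_mono_on (g := fun _ => 6 * K ^ 2) ht h1
      intervalIntegrable_const fun τ hτ => by
        have := (abs_le.mp ((hK hτ.1).abs_exteriorCurrent_le hf 2)).2
        simp only [mul_zero, mass, zero_mul, integral_zero, zero_add]
        linarith
    rw [intervalIntegral.integral_const, smul_eq_mul, ← h2] at i1
    have m1 := hf.smoothMoment_le two_pos (hint le_rfl) (hK le_rfl).memLp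
    have m2 := hf.le_smoothMoment two_pos (hint ht) (hK ht)
    linarith
  have hTsq : ∀ τ, T ≤ τ → 2 ≤ τ ^ (1 / 2 : ℝ) := fun τ hτ => by
    rw [← Real.sqrt_eq_rpow]
    exact Real.le_sqrt_of_sq_le (by linarith)
  -- The motion of the scale τ^(1/2) contributes K²/2 and twice the current contributes 2A, both
  -- times τ^(-1/2).
  set B := K ^ 2 / 2 + 2 * A with hB
  have hB0 : 0 ≤ B := by positivity
  have large : ∀ t, T ≤ t → ∫ x, ‖x‖ * ‖φ t x‖ ^ 2
      ≤ (I + 6 * K ^ 2 * T + 2 * K ^ 2) + 2 * B * t ^ (1 / 2 : ℝ) + K ^ 2 * t ^ (1 / 2 : ℝ) := by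
    intro t ht
    have hT0 : 0 < T := by linarith
    have ht0 : 0 < t := by linarith
    obtain ⟨G, g1, g2, g3⟩ := h.smoothMoment_sub_eq hf hT0 ht hTsq
    have i1 := intervalIntegral.integral_mono_on (g := fun τ => B * τ ^ ((1 / 2 : ℝ) - 1)) ht g1
      ((intervalIntegrable_rpow_of_pos _ hT0 ht).const_mul B) fun τ hτ => by
        have q1 := (abs_le.mp (g3 τ hτ)).2
        have q2 := hle τ ((le_max_left _ _).trans hτ.1)
        have e1 : τ ^ (-(1 / 2) : ℝ) = τ ^ ((1 / 2 : ℝ) - 1) := by norm_num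
        rw [e1] at q2
        rw [abs_of_pos (by norm_num : (0 : ℝ) < 1 / 2)] at q1
        rw [hB]
        linarith
    rw [intervalIntegral.integral_const_mul, integral_rpow_of_pos (by norm_num) hT0 ht, ← g2] at i1
    have p1 : 0 < t ^ (1 / 2 : ℝ) := Real.rpow_pos_of_pos ht0 _
    have p2 : 0 < T ^ (1 / 2 : ℝ) := Real.rpow_pos_of_pos hT0 _
    have m1 := hf.smoothMoment_le p2 (hint hT0.le) (hK hT0.le).memLp
    have m2 := hf.le_smoothMoment p1 (hint ht0.le) (hK ht0.le)
    have m3 := lin T hT0.le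
    have e2 : B * ((t ^ (1 / 2 : ℝ) - T ^ (1 / 2 : ℝ)) / (1 / 2))
        ≤ 2 * B * t ^ (1 / 2 : ℝ) := by
      have : 0 ≤ B * T ^ (1 / 2 : ℝ) := by positivity
      linarith
    linarith
  refine ⟨(I + 6 * K ^ 2 * T + 2 * K ^ 2) + 2 * B + K ^ 2, fun t ht => ?_⟩
  have p1 : 1 ≤ t ^ (1 / 2 : ℝ) := Real.one_le_rpow ht (by norm_num)
  have p3 : 0 ≤ I + 6 * K ^ 2 * T + 2 * K ^ 2 := by positivity
  have p2 : I + 6 * K ^ 2 * T + 2 * K ^ 2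
      ≤ (I + 6 * K ^ 2 * T + 2 * K ^ 2) * t ^ (1 / 2 : ℝ) := le_mul_of_one_le_right p3 p1
  have p4 : 0 ≤ 2 * B * t ^ (1 / 2 : ℝ) + K ^ 2 * t ^ (1 / 2 : ℝ) := by positivity
  rcases le_total T t with hTt | hTt
  · have := large t hTt
    linarith
  · have q1 := lin t (by linarith)
    have q2 : 6 * K ^ 2 * t ≤ 6 * K ^ 2 * T := by gcongr
    linarith

end Asymptotics

/-! ### Assembly. -/

section Main

variable {N : ℝ → ℝ → ℝ → ℝ} {φ₀ : E3 → ℂ} {φ : ℝ → E3 → ℂ} {a F : ℝ → ℝ} {α : ℝ}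

theorem IsGlobalSolution.exists_isDecayingEvolution (hφ : IsGlobalSolution N φ₀ φ)
    (hφ₀ : MemLp (fun x => ((‖x‖ ^ (1 / 2 : ℝ) : ℝ) : ℂ) * φ₀ x) 2 volume)
    (hbound : (⨆ t ∈ Ici (0 : ℝ), h1Norm (φ t)) < ⊤) (hF : IsSmoothCutoff F)
    (hdecay : ∀ α ∈ Ioo (1 / 3 : ℝ) 1, ∃ β₀ C : ℝ, 3 / 2 ≤ β₀ ∧ ExteriorDecay N φ F α β₀ C) :
    ∃ (J : ℝ → E3 → ℂ) (K : ℝ), IsDecayingEvolution φ J (fun t => weakGrad (φ t)) K := by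
  obtain ⟨J, K, hJ, hae⟩ := hφ.exists_evolution hbound
  refine ⟨J, K, hJ, hφ.radial, ?_, hφ.integrable_initial hφ₀, fun α hα => ?_⟩
  · filter_upwards [hae] with τ h1 hτ
    filter_upwards [h1 hτ] with x hx
    rw [hx, im_interaction_mul_conj]
  · obtain ⟨β₀, C, hβ, hC⟩ := hdecay α hα
    exact ⟨|C|, abs_nonneg C, exists_exterior_bound hae hF hβ hC⟩

theorem IsDecayingEvolution.isWeaklyLocalized_iff {J : ℝ → E3 → ℂ} {K : ℝ}
    (h : IsDecayingEvolution φ J (fun t => weakGrad (φ t)) K) (ha : IsProfile a)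
    (hF : IsSmoothCutoff F) (hα : 0 < α) :
    IsWeaklyLocalized a F α φ ↔ Tendsto (fun t =>
      exteriorCurrent (fun l => F l ^ 2) (t ^ α) (weakGrad (φ t)) (φ t)) atTop (𝓝 0) := by
  have hev : (fun t => gammaExpectation a F α t (φ t)) =ᶠ[atTop] fun t =>
      (exteriorCurrent (fun l => F l ^ 2) (t ^ α) (weakGrad (φ t)) (φ t) : ℂ) := by
    filter_upwards [(tendsto_rpow_atTop hα).eventually_ge_atTop 4, eventually_ge_atTop 0]
      with t h4 ht
    exact (h.toIsEvolution.isH1 t ht).gammaExpectation_eq ha hF h4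
  rw [IsWeaklyLocalized, tendsto_congr' hev]
  refine ⟨fun hl => ?_, fun hl => ?_⟩
  · simpa [Function.comp_def] using (Complex.continuous_re.tendsto 0).comp hl
  · simpa [Function.comp_def] using (Complex.continuous_ofReal.tendsto 0).comp hl

end Main

end

end GammaLimit

theorem mainTheorem6
    (a : ℝ → ℝ) (ha : GammaLimit.IsProfile a)
    (N : ℝ → ℝ → ℝ → ℝ) (φ₀ : GammaLimit.E3 → ℂ) (φ : ℝ → GammaLimit.E3 → ℂ)
    -- the initial datum has finite `⟨|x|⟩`, and `φ` is a global solution bounded in `H¹`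
    (hφ₀ : MemLp (fun x => ((‖x‖ ^ (1 / 2 : ℝ) : ℝ) : ℂ) * φ₀ x) 2 volume)
    (hφ : GammaLimit.IsGlobalSolution N φ₀ φ)
    (hbound : (⨆ t ∈ Set.Ici (0 : ℝ), GammaLimit.h1Norm (φ t)) < ⊤)
    -- exterior decay for every cutoff and every exponent
    (hdecay : ∀ F : ℝ → ℝ, GammaLimit.IsSmoothCutoff F →
      ∀ α ∈ Set.Ioo (1 / 3 : ℝ) 1, ∃ β₀ C : ℝ, 3 / 2 ≤ β₀ ∧
        GammaLimit.ExteriorDecay N φ F α β₀ C) :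
    (∀ F F' : ℝ → ℝ, GammaLimit.IsSmoothCutoff F → GammaLimit.IsSmoothCutoff F' →
      ∀ α ∈ Set.Ioo (1 / 3 : ℝ) 1, ∀ α' ∈ Set.Ioo (1 / 3 : ℝ) 1,
        (GammaLimit.IsWeaklyLocalized a F α φ ↔ GammaLimit.IsWeaklyLocalized a F' α' φ)) ∧
    (∀ F : ℝ → ℝ, GammaLimit.IsSmoothCutoff F → ∀ α ∈ Set.Ioo (1 / 3 : ℝ) 1,
      GammaLimit.IsWeaklyLocalized a F α φ →
        ∃ C : ℝ, ∀ t : ℝ, 1 ≤ t →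
          Integrable (fun x => ‖x‖ * ‖φ t x‖ ^ 2) volume ∧
            ∫ x, ‖x‖ * ‖φ t x‖ ^ 2 ≤ C * t ^ (1 / 2 : ℝ)) := by
  refine ⟨fun F F' hF hF' α hα α' hα' => ?_, fun F hF α hα hloc => ?_⟩
  · obtain ⟨J, K, h⟩ := hφ.exists_isDecayingEvolution hφ₀ hbound hF (hdecay F hF)
    rw [h.isWeaklyLocalized_iff ha hF (by linarith [hα.1]),
      h.isWeaklyLocalized_iff ha hF' (by linarith [hα'.1])]
    exact ⟨h.tendsto_zero_of_tendsto_zero hF.sq hF'.sq hα hα',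
      h.tendsto_zero_of_tendsto_zero hF'.sq hF.sq hα' hα⟩
  · obtain ⟨J, K, h⟩ := hφ.exists_isDecayingEvolution hφ₀ hbound hF (hdecay F hF)
    rw [h.isWeaklyLocalized_iff ha hF (by linarith [hα.1])] at hloc
    -- Independence of the exponent moves the vanishing limit from α to 1/2, so the growth rate does
    -- not depend on α.
    obtain ⟨C, hC⟩ := h.exists_moment_le hF.sq (h.tendsto_zero_of_tendsto_zero hF.sq hF.sq hα
      ⟨by norm_num, by norm_num⟩ hloc)
    exact ⟨C, fun t ht => ⟨h.toIsEvolution.integrable_moment hF.sq h.radial h.real h.moment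
      (by linarith), hC t ht⟩⟩
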